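/- **Setting.** Let $L,H,k>0$, $\theta\in[-\pi,0]$. Let $D\subset\mathbb R^2$ be a (possibly empty) open Lipschitz set, $L$-periodic in $x_1$, with $\overline D\subset\{|x_2|<H\}$, and let the relative permittivity $\varepsilon$ be real, positive, piecewise constant, $L$-periodic in $x_1$, with $\varepsilon=\varepsilon^+$ for $x_2>H$ and $\varepsilon=\varepsilon^-$ for $x_2<-H$. Put $\kappa=k\sqrt{\varepsilon}$, $\kappa^\pm=k\sqrt{\varepsilon^\pm}$, $\Omega=\{(x_1,x_2)\notin\overline D:0<x_1<L,\ |x_2|<H\}$, $\Gamma_{\pm H}=[0,L]\times\{\pm H\}$, $\Gamma_D=\partial D\cap\overline\Omega$, let $\Gamma_{\rm left},\Gamma_{\rm right}$ be the sides of the cell on $x_1=0$ and $x_1=L$, let $\mathbf n$ be the outward unit normal on $\partial\Omega$, $\partial_{\mathbf n}=\mathbf n\cdot\nabla$, and $$u^{\rm inc}(\mathbf x)=e^{i\kappa^+(x_1\cos\theta+x_2\sin\theta)},\quad \alpha_n=\kappa^+\cos\theta+\tfrac{2\pi n}L,\quad \beta_n^\pm=\begin{cases}\sqrt{k^2\varepsilon^\pm-\alpha_n^2},&\alpha_n^2\le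 k^2\varepsilon^\pm,\\ i\sqrt{\alpha_n^2-k^2\varepsilon^\pm},&\alpha_n^2>k^2\varepsilon^\pm.\end{cases}$$ For $M\in\mathbb N$ the truncated Dirichlet-to-Neumann operators on $\Gamma_{\pm H}$ are $T_M^\pm\phi=i\sum_{|n|\le M}\phi_n\beta_n^\pm e^{i\alpha_nx_1}$, where $\phi_n=\frac1L\int_0^Le^{-i\alpha_nx_1}\phi(x_1)\,dx_1$. Let $H^1_{\alpha_0}(\Omega)$ be the closure in $H^1(\Omega)$ of the restrictions of smooth functions $\phi$ on $\mathbb R^2$ that vanish for large $|x_2|$ and satisfy $\phi(x_1+L,x_2)=e^{i\alpha_0L}\phi(x_1,x_2)$. **Truncated problem.** $u^M\in H^1_{\alpha_0}(\Omega)$ satisfies $$\Delta u^M+k^2\varepsilon u^M=0\text{ in }\Omega,\quad u^M=0\text{ on }\Gamma_D,\quad \partial_{\mathbf n}(u^M-u^{\rm inc})=T_M^+(u^M-u^{\rm inc})\text{ on }\Gamma_H,\quad \partial_{\mathbf n}u^M=T_M^-u^M\text{ on }\Gamma_{-H},$$ and $\partial_{x_1}u^M(L,\cdot)=e^{i\alpha_0L}\partial_{x_1}u^M(0,\cdot)$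 across the lateral sides. The normal derivatives of $u^M$ are understood weakly, through Green's formula tested against all $w\in H^1_{\alpha_0}(\Omega)$ with $w=0$ on $\Gamma_D$. **Mesh and spaces.** Let $\mathcal M_h$ be a finite partition of $\Omega$ into convex polygons $K$, matching across $\Gamma_{\rm left}$ and $\Gamma_{\rm right}$, with $\varepsilon$ constant in each $K$. Let $\mathbf n_K$ be the outward unit normal on $\partial K$, $\partial_{\mathbf n_K}=\mathbf n_K\cdot\nabla$, $\nabla_h$ the elementwise gradient, and $\mathcal F_h^I=\bigcup_K\partial K\setminus(\Gamma_D\cup\Gamma_H\cup\Gamma_{-H})$, where the faces on $\Gamma_{\rm left}$ are identified with those on $\Gamma_{\rm right}$ and count once. Let $$T(\mathcal M_h)=\{v\in L^2(\Omega): v|_K\in H^1(K),\ \Delta v+\kappa^2v=0\text{ in }K,\ \partial_{\mathbf n_K}v\in L^2(\partial K)\ \ \forall K\in\mathcal M_h\},$$ and let $V_p(\mathcal M_h)=\bigoplus_KV_{p_K}(K)$, where each $V_{p_K}(K)$ is a finite-dimensional subspace of $T(\mathcal M_h)$ of functions supported in $K$. On a face shared by $K_1,K_2$ put $\{\!\{v\}\!\}=\frac12(v_{|K_1}+v_{|K_2})$,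 $[\![v]\!]_N=v_{|K_1}\mathbf n_{K_1}+v_{|K_2}\mathbf n_{K_2}$, $\{\!\{\boldsymbol\tau\}\!\}=\frac12(\boldsymbol\tau_{|K_1}+\boldsymbol\tau_{|K_2})$, $[\![\boldsymbol\tau]\!]_N=\boldsymbol\tau_{|K_1}\cdot\mathbf n_{K_1}+\boldsymbol\tau_{|K_2}\cdot\mathbf n_{K_2}$; on a lateral face, with $K_1$ at $\Gamma_{\rm left}$ and $K_2$ at $\Gamma_{\rm right}$, the values from $K_1$ are multiplied by $e^{i\alpha_0L}$. Let $\xi=\frac12(\kappa_{|K_1}+\kappa_{|K_2})$ there, and let $\mathtt a\in L^\infty(\mathcal F_h^I\cup\Gamma_D)$, $\mathtt b\in L^\infty(\mathcal F_h^I)$, $\mathtt d\in L^\infty(\Gamma_H\cup\Gamma_{-H})$ be positive. **Form and functional.** For $u,v\in T(\mathcal M_h)$, $$\begin{aligned}\mathcal A_h^M(u,v)=&\int_{\mathcal F_h^I}\Big(\{\!\{u\}\!\}\overline{[\![\nabla_hv]\!]_N}-\{\!\{\nabla_hu\}\!\}\cdot\overline{[\![v]\!]_N}-i\xi\mathtt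 a[\![u]\!]_N\cdot\overline{[\![v]\!]_N}-i\xi^{-1}\mathtt b[\![\nabla_hu]\!]_N\overline{[\![\nabla_hv]\!]_N}\Big)ds\\&+\sum_{\pm}\int_{\Gamma_{\pm H}}\Big(u\,\overline{\partial_{\mathbf n}v}-T_M^\pm u\,\overline v-\mathtt d\,i\kappa^{-1}(\partial_{\mathbf n}u-T_M^\pm u)\overline{(\partial_{\mathbf n}v-T_M^\pm v)}\Big)ds+\int_{\Gamma_D}\big(-\partial_{\mathbf n}u\,\overline v-i\kappa\mathtt a\,u\,\overline v\big)ds,\end{aligned}$$ $$\ell_h^M(v)=\int_{\Gamma_H}-2i\beta_0^+u^{\rm inc}\Big(\overline v-\mathtt d\,i\kappa^{-1}\overline{(\partial_{\mathbf n}v-T_M^+v)}\Big)ds.$$ **Proposition (consistency of the DtN-TDG method).** Let $M\in\mathbb N$ and let $u^M$ be a solution of the truncated problem that belongs to $T(\mathcal M_h)$, the space on which $\mathcal A_h^M$ is defined. Then $\mathcal A_h^M(u^M,v_h)=\ell_h^M(v_h)$ for every $v_h\in V_p(\mathcal M_h)$. -/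

import Mathlib

open MeasureTheory Filter Topology Set
open scoped ContDiff ENNReal ComplexConjugate

noncomputable section

namespace DtNTDG

/-- The plane `ℝ²` with its Euclidean norm; `x 0`, `x 1` are the coordinates called `x₁`, `x₂` in
mathematical notation. One-dimensional integrals `∫ … ds` are taken with respect to the Hausdorff
measure `μH[1]`, which is arc length. -/
abbrev Plane : Type := EuclideanSpace ℝ (Fin 2)

/-! ### Sobolev spaces, traces and normal derivatives -/

/-- Classical partial derivative in the `i`-th coordinate direction. -/
def pderiv (i : Fin 2) (φ : Plane → ℂ) (x : Plane) : ℂ :=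
  fderiv ℝ φ x (EuclideanSpace.single i 1)

/-- `φ ∈ C_c^∞(U)`. -/
def IsTestFunction (U : Set Plane) (φ : Plane → ℂ) : Prop :=
  ContDiff ℝ ∞ φ ∧ HasCompactSupport φ ∧ tsupport φ ⊆ U

/-- `u ∈ L²(U)`. -/
def MemL2 (U : Set Plane) (u : Plane → ℂ) : Prop := MemLp u 2 (volume.restrict U)

/-- `τ ∈ L²(Γ)` for a curve `Γ`, with respect to arc length. -/
def MemL2Curve (Γ : Set Plane) (τ : Plane → ℂ) : Prop := MemLp τ 2 (μH[1].restrict Γ)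

/-- `G ∈ L²(U)²` is the distributional gradient of `u` in the open set `U`. -/
def IsWeakGrad (U : Set Plane) (u : Plane → ℂ) (G : Fin 2 → Plane → ℂ) : Prop :=
  (∀ i, MemL2 U (G i)) ∧
  ∀ i, ∀ φ, IsTestFunction U φ →
    ∫ x in U, u x * pderiv i φ x = - ∫ x in U, G i x * φ x

/-- `u ∈ H¹(U)`. -/
def MemH1 (U : Set Plane) (u : Plane → ℂ) : Prop := MemL2 U u ∧ ∃ G, IsWeakGrad U u G

open Classical in
/-- The distributional gradient in `U` of a function of `H¹(U)`. -/
def weakGrad (U : Set Plane) (u : Plane → ℂ) : Fin 2 → Plane → ℂ :=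
  if h : ∃ G, IsWeakGrad U u G then h.choose else 0

/-- `Δ u = f` in the open set `U`, in the sense of distributions. -/
def HasWeakLaplacian (U : Set Plane) (u f : Plane → ℂ) : Prop :=
  ∀ φ, IsTestFunction U φ →
    ∫ x in U, u x * (pderiv 0 (pderiv 0 φ) x + pderiv 1 (pderiv 1 φ) x) = ∫ x in U, f x * φ x

/-- `φ j → u` in the norm of `H¹(U)`. -/
def TendstoH1 (U : Set Plane) (φ : ℕ → Plane → ℂ) (u : Plane → ℂ) : Prop :=
  Tendsto (fun j => eLpNorm (fun x => φ j x - u x) 2 (volume.restrict U)) atTop (𝓝 0) ∧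
  ∀ i, Tendsto
    (fun j => eLpNorm (fun x => pderiv i (φ j) x - weakGrad U u i x) 2 (volume.restrict U))
    atTop (𝓝 0)

/-- `τ ∈ L²(Γ)` is the trace on `Γ ⊆ ∂U` of the function `u ∈ H¹(U)`, where the trace operator is
the extension by continuity of the pointwise restriction `φ ↦ φ|_Γ` of the smooth functions
`φ ∈ A`. -/
def HasTrace (A : Set (Plane → ℂ)) (U Γ : Set Plane) (u τ : Plane → ℂ) : Prop :=
  MemH1 U u ∧ MemL2Curve Γ τ ∧
  ∃ φ : ℕ → Plane → ℂ, (∀ j, φ j ∈ A) ∧ TendstoH1 U φ u ∧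
    Tendsto (fun j => eLpNorm (fun x => φ j x - τ x) 2 (μH[1].restrict Γ)) atTop (𝓝 0)

open Classical in
/-- The trace on `Γ ⊆ ∂U` of a function of `H¹(U)`. -/
def traceOn (A : Set (Plane → ℂ)) (U Γ : Set Plane) (u : Plane → ℂ) : Plane → ℂ :=
  if h : ∃ τ, HasTrace A U Γ u τ then h.choose else 0

/-- `C^∞(ℝ²)`. -/
def smoothFunctions : Set (Plane → ℂ) := {φ | ContDiff ℝ ∞ φ}

/-- The function `g ∈ L²(∂K)` is the outward normal derivative on `∂K` of `v ∈ H¹(K)`, where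
`Δ v ∈ L²(K)`: Green's formula `∫_K (∇v·∇φ + Δv φ) = ∫_{∂K} ∂_{n_K}v φ ds` holds for all smooth
`φ`. -/
def HasNormalDeriv (K : Set Plane) (v g : Plane → ℂ) : Prop :=
  MemH1 K v ∧ MemL2Curve (frontier K) g ∧
  ∃ f, MemL2 K f ∧ HasWeakLaplacian K v f ∧
    ∀ φ ∈ smoothFunctions,
      ∫ x in K, ((∑ i, weakGrad K v i x * pderiv i φ x) + f x * φ x)
        = ∫ x in frontier K, g x * φ x ∂μH[1]

open Classical in
/-- The outward normal derivative `∂_{n_K} v` on `∂K`, when it belongs to `L²(∂K)`. -/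
def normalDeriv (K : Set Plane) (v : Plane → ℂ) : Plane → ℂ :=
  if h : ∃ g, HasNormalDeriv K v g then h.choose else 0

/-! ### The diffraction grating -/

/-- The data of the scattering problem: period `L`, height `H`, impenetrable obstacle `D`, real
positive relative permittivity `ε` with values `εp`, `εm` above and below the grating, free-space
wavenumber `k`, and propagation angle `θ` of the incident plane wave. -/
structure Grating where
  L : ℝ
  H : ℝ
  D : Set Plane
  ε : Plane → ℝ
  εp : ℝ
  εm : ℝ
  k : ℝ
  θ : ℝ
  L_pos : 0 < L
  H_pos : 0 < H
  k_pos : 0 < k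
  θ_mem : θ ∈ Icc (-Real.pi) 0
  D_open : IsOpen D
  D_periodic : ∀ x, x ∈ D ↔ x + EuclideanSpace.single 0 L ∈ D
  D_bounded : ∀ x ∈ closure D, |x 1| < H
  ε_pos : ∀ x, 0 < ε x
  ε_periodic : ∀ x, ε (x + EuclideanSpace.single 0 L) = ε x
  ε_above : ∀ x, H < x 1 → ε x = εp
  ε_below : ∀ x, x 1 < -H → ε x = εm

namespace Grating

variable (g : Grating)

/-- The translation vector `(L, 0)`. -/
def shift : Plane := EuclideanSpace.single 0 g.L

/-- The truncated cell `Ω`. -/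
def Ω : Set Plane :=
  {x | x ∉ closure g.D ∧ 0 < x 0 ∧ x 0 < g.L ∧ -g.H < x 1 ∧ x 1 < g.H}

/-- The horizontal segment `[0, L] × {y}`; the artificial boundaries are `Γ_{±H}`, at heights
`y = ±H`. -/
def Γ (y : ℝ) : Set Plane := {x | 0 ≤ x 0 ∧ x 0 ≤ g.L ∧ x 1 = y}

/-- The Dirichlet boundary `Γ_D = ∂D ∩ closure Ω`. -/
def ΓD : Set Plane := frontier g.D ∩ closure g.Ω

/-- `κ⁺ = k √ε⁺`. -/
def κp : ℝ := g.k * √g.εp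

/-- `α_n = κ⁺ cos θ + 2πn/L`; in particular `α_0 = κ⁺ cos θ`. -/
def α (n : ℤ) : ℝ := g.κp * Real.cos g.θ + 2 * Real.pi * n / g.L

/-- `β_n` for the permittivity `e`; `β_n^±` is `β ε^± n`. -/
def β (e : ℝ) (n : ℤ) : ℂ :=
  if g.α n ^ 2 ≤ g.k ^ 2 * e then (√(g.k ^ 2 * e - g.α n ^ 2) : ℂ)
  else Complex.I * (√(g.α n ^ 2 - g.k ^ 2 * e) : ℂ)

/-- The incident plane wave. -/
def uInc (x : Plane) : ℂ :=
  Complex.exp (Complex.I * g.κp * (x 0 * Real.cos g.θ + x 1 * Real.sin g.θ))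

/-- The quasi-periodicity factor `e^{i α_0 L}`. -/
def phase : ℂ := Complex.exp (Complex.I * g.α 0 * g.L)

/-- `C^∞_{α_0}(ℝ²)`: smooth quasi-periodic functions vanishing for large `|x₂|`. -/
def smoothQP : Set (Plane → ℂ) :=
  {φ | ContDiff ℝ ∞ φ ∧ (∀ x, φ (x + g.shift) = g.phase * φ x) ∧
    ∃ R : ℝ, ∀ x, R < |x 1| → φ x = 0}

/-- `H¹_{α_0}(Ω)`: the closure of the restrictions of `C^∞_{α_0}(ℝ²)` in `H¹(Ω)`. -/
def H1QP : Set (Plane → ℂ) :=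
  {u | MemH1 g.Ω u ∧ ∃ φ : ℕ → Plane → ℂ, (∀ j, φ j ∈ g.smoothQP) ∧ TendstoH1 g.Ω φ u}

/-- `H¹_{α_0,0}(Ω)`: functions of `H¹_{α_0}(Ω)` whose trace on `Γ_D` vanishes. -/
def H1QP0 : Set (Plane → ℂ) :=
  {u | u ∈ g.H1QP ∧ HasTrace g.smoothQP g.Ω g.ΓD u 0}

/-- The trace on `Γ_{±H}` (that is, on `Γ y` with `y = ±H`) of a function of `H¹_{α_0}(Ω)`. -/
def traceΓ (y : ℝ) (u : Plane → ℂ) : Plane → ℂ := traceOn g.smoothQP g.Ω (g.Γ y) u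

/-- The quasi-periodic Fourier coefficient `φ_n = L⁻¹ ∫_0^L e^{-iα_n x₁} φ(x₁) dx₁` of a function
`φ` on `Γ y`. -/
def fourierCoef (y : ℝ) (φ : Plane → ℂ) (n : ℤ) : ℂ :=
  (g.L : ℂ)⁻¹ * ∫ x in g.Γ y, Complex.exp (-(Complex.I * g.α n * x 0)) * φ x ∂μH[1]

/-- The truncated Dirichlet-to-Neumann operator on `Γ y` for the permittivity `e`,
`(T_M φ)(x₁) = i ∑_{|n| ≤ M} φ_n β_n e^{iα_n x₁}`. -/
def T (y e : ℝ) (M : ℕ) (φ : Plane → ℂ) (x : Plane) : ℂ :=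
  Complex.I * ∑ n ∈ Finset.Icc (-(M : ℤ)) M,
    g.fourierCoef y φ n * g.β e n * Complex.exp (Complex.I * g.α n * x 0)

/-- `T_M^+`, acting on functions on `Γ_H`. -/
def Tp (M : ℕ) (φ : Plane → ℂ) : Plane → ℂ := g.T g.H g.εp M φ

/-- `T_M^-`, acting on functions on `Γ_{-H}`. -/
def Tm (M : ℕ) (φ : Plane → ℂ) : Plane → ℂ := g.T (-g.H) g.εm M φ

/-- `u` solves the truncated boundary value problem: `u ∈ H¹_{α_0}(Ω)`, `Δu + k²εu = 0` in `Ω`,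
`u = 0` on `Γ_D`, `∂_n u = ∂_n u^inc + T_M^+(u - u^inc)` on `Γ_H` and `∂_n u = T_M^- u` on
`Γ_{-H}`, with the quasi-periodicity `∂_{x₁}u(L, ·) = e^{iα_0L} ∂_{x₁}u(0, ·)` across the lateral
sides. For a function of `H¹(Ω)` the normal derivative is the functional
`w ↦ ∫_Ω (∇u·∇w̄ + Δu w̄)`; the field `neumann` says that, against quasi-periodic `w` vanishing on
`Γ_D`, it reduces to the prescribed data on `Γ_{±H}` (the contributions of the two lateral sides
cancel). Note that the outward normal is `(0, 1)` on `Γ_H`. -/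
structure IsTruncatedSolution (M : ℕ) (u : Plane → ℂ) : Prop where
  mem : u ∈ g.H1QP
  helmholtz : HasWeakLaplacian g.Ω u (fun x => -((g.k ^ 2 * g.ε x : ℝ) : ℂ) * u x)
  dirichlet : HasTrace g.smoothQP g.Ω g.ΓD u 0
  neumann : ∀ w ∈ g.H1QP0,
    ∫ x in g.Ω, ((∑ i, weakGrad g.Ω u i x * conj (weakGrad g.Ω w i x))
        - ((g.k ^ 2 * g.ε x : ℝ) : ℂ) * u x * conj (w x))
      = (∫ x in g.Γ g.H,
          (pderiv 1 g.uInc x + g.Tp M (fun z => g.traceΓ g.H u z - g.uInc z) x)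
            * conj (g.traceΓ g.H w x) ∂μH[1])
        + ∫ x in g.Γ (-g.H),
            g.Tm M (g.traceΓ (-g.H) u) x * conj (g.traceΓ (-g.H) w x) ∂μH[1]

end Grating

/-! ### Meshes and Trefftz spaces -/

/-- A finite partition of `Ω` into (open) convex polygons, on each of which `ε` is constant. -/
structure Mesh (g : Grating) where
  N : ℕ
  vertices : Fin N → Finset Plane
  εK : Fin N → ℝ
  elem_nonempty : ∀ i, (interior (convexHull ℝ (vertices i : Set Plane))).Nonempty
  elem_subset : ∀ i, interior (convexHull ℝ (vertices i : Set Plane)) ⊆ g.Ω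
  elem_disjoint : ∀ i j, i ≠ j → Disjoint (interior (convexHull ℝ (vertices i : Set Plane)))
    (interior (convexHull ℝ (vertices j : Set Plane)))
  elem_cover : g.Ω ⊆ ⋃ i, convexHull ℝ (vertices i : Set Plane)
  ε_const : ∀ i, ∀ x ∈ interior (convexHull ℝ (vertices i : Set Plane)), g.ε x = εK i

namespace Mesh

variable {g : Grating} (m : Mesh g)

/-- The `i`-th element `K` of the mesh. -/
def elem (i : Fin m.N) : Set Plane := interior (convexHull ℝ (m.vertices i : Set Plane))

/-- The wavenumber `κ = k √ε` on the `i`-th element. -/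
def κ (i : Fin m.N) : ℝ := g.k * √(m.εK i)

/-- The part of the boundary of the cell whose faces are not interior ones. -/
def outer (_ : Mesh g) : Set Plane := g.ΓD ∪ g.Γ g.H ∪ g.Γ (-g.H)

/-- The inner part `F_h^I = F_h \ (Γ_D ∪ Γ_H ∪ Γ_{-H})` of the mesh skeleton `F_h = ⋃ ∂K`. -/
def innerSkeleton : Set Plane := (⋃ i, frontier (m.elem i)) \ m.outer

/-- The common part of the boundaries of two elements inside the cell. -/
def interface (i j : Fin m.N) : Set Plane :=
  (frontier (m.elem i) ∩ frontier (m.elem j)) \ m.outer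

/-- The common part of the boundaries of the element `i`, adjacent to `Γ_left`, and the element `j`,
adjacent to `Γ_right`, when `Γ_left` is identified with `Γ_right`; it is represented as a subset of
`Γ_right`. -/
def periodicInterface (i j : Fin m.N) : Set Plane :=
  {x | x - g.shift ∈ frontier (m.elem i) ∧ x ∈ frontier (m.elem j)} \ m.outer

/-- The trace on `∂K` of `v|_K`, where `K` is the `i`-th element. -/
def tr (i : Fin m.N) (v : Plane → ℂ) : Plane → ℂ :=
  traceOn smoothFunctions (m.elem i) (frontier (m.elem i)) v

/-- The normal derivative `∂_{n_K} v` on `∂K`, where `K` is the `i`-th element. -/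
def dn (i : Fin m.N) (v : Plane → ℂ) : Plane → ℂ := normalDeriv (m.elem i) v

/-- The elementwise trace of `v` on the artificial boundaries `Γ_{±H}`, almost every point of which
belongs to the boundary of exactly one element. -/
def outerTr (v : Plane → ℂ) (x : Plane) : ℂ :=
  ∑ i, (frontier (m.elem i)).indicator (m.tr i v) x

/-- The Trefftz space `T(M_h)`: functions of `L²(Ω)` that on each element `K` belong to `H¹(K)`,
satisfy `Δv + κ²v = 0`, and have a normal derivative in `L²(∂K)`. -/
def trefftz : Set (Plane → ℂ) :=
  {v | MemL2 g.Ω v ∧ ∀ i, MemH1 (m.elem i) v ∧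
    HasWeakLaplacian (m.elem i) v (fun x => -((m.κ i ^ 2 : ℝ) : ℂ) * v x) ∧
    ∃ q, HasNormalDeriv (m.elem i) v q}

end Mesh

/-- A discrete Trefftz space `V_p(M_h) = ⨁_K V_{p_K}(K)`: each local space is a finite-dimensional
subspace of `T(M_h)` of functions supported in `K`. -/
structure DiscreteTrefftz {g : Grating} (m : Mesh g) where
  loc : Fin m.N → Submodule ℂ (Plane → ℂ)
  finite_dim : ∀ i, FiniteDimensional ℂ (loc i)
  loc_trefftz : ∀ i, ∀ v ∈ loc i, v ∈ m.trefftz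
  loc_support : ∀ i, ∀ v ∈ loc i, ∀ x, x ∉ m.elem i → v x = 0

/-- The global discrete space `V_p(M_h)`. -/
def DiscreteTrefftz.space {g : Grating} {m : Mesh g} (V : DiscreteTrefftz m) :
    Submodule ℂ (Plane → ℂ) := ⨆ i, V.loc i

/-- Bounded positive flux coefficients `a` on `F_h^I ∪ Γ_D`, `b` on `F_h^I`, `d` on
`Γ_H ∪ Γ_{-H}`. On the identified lateral faces the value is the one on `Γ_right`. -/
structure Flux {g : Grating} (m : Mesh g) where
  a : Plane → ℝ
  b : Plane → ℝ
  d : Plane → ℝ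
  a_bdd : MemLp a ⊤ (μH[1].restrict (m.innerSkeleton ∪ g.ΓD))
  b_bdd : MemLp b ⊤ (μH[1].restrict m.innerSkeleton)
  d_bdd : MemLp d ⊤ (μH[1].restrict (g.Γ g.H ∪ g.Γ (-g.H)))
  a_pos : ∀ᵐ x ∂(μH[1].restrict (m.innerSkeleton ∪ g.ΓD)), 0 < a x
  b_pos : ∀ᵐ x ∂(μH[1].restrict m.innerSkeleton), 0 < b x
  d_pos : ∀ᵐ x ∂(μH[1].restrict (g.Γ g.H ∪ g.Γ (-g.H))), 0 < d x

/-! ### The DtN-TDG sesquilinear form and functional -/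

/-- The integrand on an interior face shared by `K₁`, `K₂`,
`{{u}} ⟦∇v̄⟧ - {{∇u}}·⟦v̄⟧ - iξa ⟦u⟧·⟦v̄⟧ - iξ⁻¹b ⟦∇u⟧ ⟦∇v̄⟧`, in terms of the traces
`u₁, u₂, v₁, v₂` and of the outward normal derivatives `∂u₁ = ∂_{n_{K₁}}u|_{K₁}`, … Since
`n_{K₂} = -n_{K₁}` on the face, `⟦∇u⟧ = ∂u₁ + ∂u₂`, `{{∇u}}·⟦v̄⟧ = ½(∂u₁ - ∂u₂) (v̄₁ - v̄₂)` and
`⟦u⟧·⟦v̄⟧ = (u₁ - u₂)(v̄₁ - v̄₂)`. -/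
def faceIntegrand (ξ a b : ℝ) (u₁ u₂ du₁ du₂ v₁ v₂ dv₁ dv₂ : ℂ) : ℂ :=
  (u₁ + u₂) / 2 * conj (dv₁ + dv₂)
    - (du₁ - du₂) / 2 * conj (v₁ - v₂)
    - Complex.I * ξ * a * (u₁ - u₂) * conj (v₁ - v₂)
    - Complex.I * (ξ : ℂ)⁻¹ * b * (du₁ + du₂) * conj (dv₁ + dv₂)

namespace Mesh

variable {g : Grating} (m : Mesh g)

/-- `ξ` on the faces shared by the elements `i` and `j`. -/
def ξ (i j : Fin m.N) : ℝ := (m.κ i + m.κ j) / 2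

/-- The integral over `F_h^I` in `A_h^M(u, v)`: interfaces inside the cell, each counted once, and
lateral faces on `Γ_left`, identified with `Γ_right`, where the trace from the element adjacent to
`Γ_left` is multiplied by `e^{iα_0L}`. -/
def innerForm (c : Flux m) (u v : Plane → ℂ) : ℂ :=
  (∑ i, ∑ j ∈ Finset.univ.filter (fun j => i < j), ∫ x in m.interface i j,
      faceIntegrand (m.ξ i j) (c.a x) (c.b x)
        (m.tr i u x) (m.tr j u x) (m.dn i u x) (m.dn j u x)
        (m.tr i v x) (m.tr j v x) (m.dn i v x) (m.dn j v x) ∂μH[1])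
  + ∑ i, ∑ j, ∫ x in m.periodicInterface i j,
      faceIntegrand (m.ξ i j) (c.a x) (c.b x)
        (g.phase * m.tr i u (x - g.shift)) (m.tr j u x)
        (g.phase * m.dn i u (x - g.shift)) (m.dn j u x)
        (g.phase * m.tr i v (x - g.shift)) (m.tr j v x)
        (g.phase * m.dn i v (x - g.shift)) (m.dn j v x) ∂μH[1]

/-- The integral over `Γ y` (with `y = ±H`, and `T = T_M^±`) in `A_h^M(u, v)`. -/
def artificialForm (c : Flux m) (y : ℝ) (T : (Plane → ℂ) → Plane → ℂ) (u v : Plane → ℂ) : ℂ :=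
  ∑ i, ∫ x in frontier (m.elem i) ∩ g.Γ y,
    (m.tr i u x * conj (m.dn i v x) - T (m.outerTr u) x * conj (m.tr i v x)
      - c.d x * Complex.I * (m.κ i : ℂ)⁻¹ * (m.dn i u x - T (m.outerTr u) x)
          * conj (m.dn i v x - T (m.outerTr v) x)) ∂μH[1]

/-- The integral over `Γ_D` in `A_h^M(u, v)`. -/
def dirichletForm (c : Flux m) (u v : Plane → ℂ) : ℂ :=
  ∑ i, ∫ x in frontier (m.elem i) ∩ g.ΓD,
    (-(m.dn i u x) * conj (m.tr i v x)
      - Complex.I * m.κ i * c.a x * m.tr i u x * conj (m.tr i v x)) ∂μH[1]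

/-- The sesquilinear form `A_h^M(u, v)` for `u, v ∈ T(M_h)`. -/
def form (c : Flux m) (M : ℕ) (u v : Plane → ℂ) : ℂ :=
  m.innerForm c u v + m.artificialForm c g.H (g.Tp M) u v
    + m.artificialForm c (-g.H) (g.Tm M) u v + m.dirichletForm c u v

/-- The functional `ℓ_h^M(v)` for `v ∈ T(M_h)`. -/
def functional (c : Flux m) (M : ℕ) (v : Plane → ℂ) : ℂ :=
  ∑ i, ∫ x in frontier (m.elem i) ∩ g.Γ g.H,
    -2 * Complex.I * g.β g.εp 0 * g.uInc x
      * (conj (m.tr i v x) - c.d x * Complex.I * (m.κ i : ℂ)⁻¹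
          * conj (m.dn i v x - g.Tp M (m.outerTr v) x)) ∂μH[1]

end Mesh

end DtNTDG

end

namespace DtNTDG

/-! ### Integration against `L²` functions -/

/-! Both the solution `u` and the test function `v` solve the same Helmholtz equation with real `κ`
in each element, so Green's second formula makes the integral of `u ∂v̄ - ∂u v̄` over each `∂K`
vanish (`integral_wronskian`). The form differs from the functional by exactly the sum of these
integrals. On an inner face the traces of `u` agree and its normal derivatives are opposite, so the
jump terms drop out and the averages reduce to the two one-sided integrands (`faceIntegrand_eq`). On
`Γ_D` the trace of `u` is zero. On `Γ_{-H}` the residual `∂u - T u` is zero, and on `Γ_H` it equals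
`-2iβ₀ u^inc`, which produces the functional (`topData_eq`, `artificialForm_top_eq`). Summation is
`form_eq_functional`.

The work lies in justifying these statements for weak traces and weak normal derivatives.

Traces on a convex polygon: a trace inequality on boundary parallelograms (`exists_trace_le`) and
density of smooth functions, by contraction towards an interior point followed by mollification
(`exists_tendstoH1_of_convex`). They give existence and uniqueness of traces and extend Green's
formula from smooth to `H¹` test functions (`Mesh.green`). Traces of `u` from two elements agree
because one sequence of smooth quasi-periodic functions approximates `u` on both (`tr_ae_eq_tr`,
`phase_mul_tr_ae_eq`).

Normal derivatives: comparing elementwise Green's formulas with the weak Neumann condition shows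
that a certain density on the skeleton is orthogonal to every smooth quasi-periodic function
vanishing on `Γ_D` (`integral_neumannDefect`). Folding the cell onto a cylinder turns quasi-periodic
functions into arbitrary test functions, so the density vanishes almost everywhere off `Γ_D`
(`ae_eq_zero_of_integral_mul_smoothQP`). Reading this off on faces, lateral sides and `Γ_{±H}` gives
the required relations.

Geometry: faces are intersections of element boundaries, so it must be known that almost every
boundary point belongs to at most two elements. Almost every such point is the centre of a half disc
in each adjacent element, and three disjoint sets cannot contain half discs with a common centre
(`not_three_halfDiscs`). Hence the boundary splits, up to null sets, into the pieces over which the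
form integrates (`integral_frontier`). -/

theorem eLpNorm_one_mul_le {α : Type*} [MeasurableSpace α] {μ : Measure α} {f g : α → ℂ}
    (hf : AEStronglyMeasurable f μ) (hg : AEStronglyMeasurable g μ) :
    eLpNorm (fun x => f x * g x) 1 μ ≤ eLpNorm f 2 μ * eLpNorm g 2 μ :=
  (eLpNorm_smul_le_mul_eLpNorm (p := 2) (q := 2) (r := 1) (φ := f) (f := g) hg hf :
    eLpNorm (f • g) 1 μ ≤ _)

theorem tendsto_integral_mul_of_tendsto_L2 {α : Type*} [MeasurableSpace α] {μ : Measure α}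
    {G w : α → ℂ} {φ : ℕ → α → ℂ} (hG : MemLp G 2 μ) (hw : MemLp w 2 μ)
    (hφ : ∀ j, AEStronglyMeasurable (φ j) μ)
    (h : Tendsto (fun j => eLpNorm (fun x => φ j x - w x) 2 μ) atTop (𝓝 0)) :
    Tendsto (fun j => ∫ x, G x * φ j x ∂μ) atTop (𝓝 (∫ x, G x * w x ∂μ)) := by
  refine tendsto_integral_of_L1' (fun x => G x * w x) (hG.1.mul hw.1) ?_ ?_
  -- The functions `φ j` are not assumed to be in `L²`; convergence puts `φ j - w`, and hence `φ j`,
  -- there for large `j`.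
  · have h1 := h.eventually (gt_mem_nhds (zero_lt_one' ℝ≥0∞))
    filter_upwards [h1] with j hj
    have h2 : MemLp (fun x => φ j x - w x) 2 μ := ⟨(hφ j).sub hw.1, hj.trans ENNReal.one_lt_top⟩
    have h3 := (hG.integrable_mul h2).add (hG.integrable_mul hw)
    refine h3.congr (Eventually.of_forall fun x => ?_)
    simp only [Pi.add_apply, Pi.mul_apply]
    ring
  · have h1 : Tendsto (fun j => eLpNorm G 2 μ * eLpNorm (fun x => φ j x - w x) 2 μ) atTop (𝓝 0) := by
      simpa using ENNReal.Tendsto.const_mul h (Or.inr hG.2.ne)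
    refine tendsto_of_tendsto_of_tendsto_of_le_of_le tendsto_const_nhds h1 (fun _ => zero_le) ?_
    intro j
    have e : ((fun x => G x * φ j x) - fun x => G x * w x)
        = fun x => G x * (φ j x - w x) := by
      ext x
      simp only [Pi.sub_apply]
      ring
    simp only [e]
    exact eLpNorm_one_mul_le (f := G) (g := fun x => φ j x - w x) hG.1 ((hφ j).sub hw.1)

theorem eLpNorm_conj {α : Type*} [MeasurableSpace α] {μ : Measure α} (f : α → ℂ) (p : ℝ≥0∞) :
    eLpNorm (fun x => conj (f x)) p μ = eLpNorm f p μ :=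
  eLpNorm_congr_norm_ae (Eventually.of_forall fun x => by simp)

theorem memLp_conj {α : Type*} [MeasurableSpace α] {μ : Measure α} {f : α → ℂ} {p : ℝ≥0∞}
    (hf : MemLp f p μ) : MemLp (fun x => conj (f x)) p μ :=
  ⟨Complex.continuous_conj.comp_aestronglyMeasurable hf.1, by rw [eLpNorm_conj]; exact hf.2⟩

theorem eLpNorm_conj_sub {α : Type*} [MeasurableSpace α] {μ : Measure α} (f g : α → ℂ) (p : ℝ≥0∞) :
    eLpNorm (fun x => conj (f x) - conj (g x)) p μ = eLpNorm (fun x => f x - g x) p μ := by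
  rw [← eLpNorm_conj (fun x => f x - g x)]
  simp

theorem memLp_restrict_of_continuous {μ : Measure Plane} {S : Set Plane} {f : Plane → ℂ}
    (hf : Continuous f) (hS : MeasurableSet S) (hb : Bornology.IsBounded S) (hμ : μ S ≠ ⊤)
    (p : ℝ≥0∞) : MemLp f p (μ.restrict S) := by
  have : IsFiniteMeasure (μ.restrict S) := ⟨by simpa using hμ.lt_top⟩
  obtain ⟨C, hC⟩ := (hb.isCompact_closure.image hf).isBounded.exists_norm_le
  refine MemLp.of_bound hf.aestronglyMeasurable C ?_
  filter_upwards [ae_restrict_mem hS] with x hx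
  exact hC _ (mem_image_of_mem f (subset_closure hx))

/-- Limits in `L²` are unique. -/
theorem ae_eq_of_tendsto_L2 {α : Type*} [MeasurableSpace α] {μ : Measure α}
    {σ τ : α → ℂ} {φ ψ : ℕ → α → ℂ} (hφ : ∀ j, AEStronglyMeasurable (φ j) μ)
    (hψ : ∀ j, AEStronglyMeasurable (ψ j) μ) (hσ : AEStronglyMeasurable σ μ)
    (hτ : AEStronglyMeasurable τ μ)
    (h1 : Tendsto (fun j => eLpNorm (fun x => φ j x - σ x) 2 μ) atTop (𝓝 0))
    (h2 : Tendsto (fun j => eLpNorm (fun x => ψ j x - τ x) 2 μ) atTop (𝓝 0))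
    (h3 : Tendsto (fun j => eLpNorm (fun x => φ j x - ψ j x) 2 μ) atTop (𝓝 0)) :
    σ =ᵐ[μ] τ := by
  have h : Tendsto (fun j => eLpNorm (fun x => φ j x - σ x) 2 μ
      + eLpNorm (fun x => φ j x - ψ j x) 2 μ + eLpNorm (fun x => ψ j x - τ x) 2 μ) atTop (𝓝 0) := by
    simpa using (h1.add h3).add h2
  have hle : ∀ j, eLpNorm (fun x => σ x - τ x) 2 μ ≤ eLpNorm (fun x => φ j x - σ x) 2 μ
      + eLpNorm (fun x => φ j x - ψ j x) 2 μ + eLpNorm (fun x => ψ j x - τ x) 2 μ := by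
    intro j
    have e : (fun x => σ x - τ x) = (fun x => (-(φ j x - σ x) + (φ j x - ψ j x))) +
        (fun x => ψ j x - τ x) := by
      ext x; simp only [Pi.add_apply]; ring
    rw [e]
    refine (eLpNorm_add_le (((hφ j).sub hσ).neg.add ((hφ j).sub (hψ j))) ((hψ j).sub hτ)
      one_le_two).trans (add_le_add_left ?_ _)
    refine (eLpNorm_add_le (f := fun x => -(φ j x - σ x)) (((hφ j).sub hσ).neg)
      ((hφ j).sub (hψ j)) one_le_two).trans (add_le_add_left ?_ _)
    exact le_of_eq (eLpNorm_neg (fun x => φ j x - σ x) 2 μ)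
  have h0 : eLpNorm (fun x => σ x - τ x) 2 μ = 0 :=
    le_antisymm (ge_of_tendsto' h hle) zero_le
  have h0 := (eLpNorm_eq_zero_iff (hσ.sub hτ) two_ne_zero).1 h0
  filter_upwards [h0] with x hx
  exact sub_eq_zero.1 hx

/-! ### Partial derivatives -/

theorem contDiff_pderiv {φ : Plane → ℂ} (hφ : ContDiff ℝ ∞ φ) (i : Fin 2) :
    ContDiff ℝ ∞ (pderiv i φ) :=
  (hφ.fderiv_right (m := ∞) (by simp)).clm_apply contDiff_const

theorem hasCompactSupport_pderiv {φ : Plane → ℂ} (hφ : HasCompactSupport φ) (i : Fin 2) :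
    HasCompactSupport (pderiv i φ) :=
  hφ.fderiv_apply ℝ _

theorem tsupport_pderiv_subset (φ : Plane → ℂ) (i : Fin 2) : tsupport (pderiv i φ) ⊆ tsupport φ :=
  tsupport_fderiv_apply_subset ℝ _

theorem IsTestFunction.pderiv {U : Set Plane} {φ : Plane → ℂ} (hφ : IsTestFunction U φ)
    (i : Fin 2) : IsTestFunction U (pderiv i φ) :=
  ⟨contDiff_pderiv hφ.1 i, hasCompactSupport_pderiv hφ.2.1 i,
    (tsupport_pderiv_subset φ i).trans hφ.2.2⟩

theorem contDiff_conj {φ : Plane → ℂ} (hφ : ContDiff ℝ ∞ φ) :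
    ContDiff ℝ ∞ (fun x => conj (φ x)) :=
  Complex.conjCLE.contDiff.comp hφ

theorem pderiv_conj {φ : Plane → ℂ} (hφ : ContDiff ℝ ∞ φ) (i : Fin 2) (x : Plane) :
    pderiv i (fun y => conj (φ y)) x = conj (pderiv i φ x) := by
  have h := (hφ.differentiable (by simp) x).hasFDerivAt
  have h2 := (Complex.conjCLE.toContinuousLinearMap.hasFDerivAt (x := φ x)).comp x h
  unfold pderiv
  erw [h2.fderiv]
  rfl

theorem pderiv_sub {φ ψ : Plane → ℂ} (hφ : ContDiff ℝ ∞ φ) (hψ : ContDiff ℝ ∞ ψ) (i : Fin 2)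
    (x : Plane) : pderiv i (fun y => φ y - ψ y) x = pderiv i φ x - pderiv i ψ x := by
  unfold pderiv
  rw [fderiv_fun_sub (hφ.differentiable (by simp) x) (hψ.differentiable (by simp) x)]
  rfl

theorem IsTestFunction.mono {U V : Set Plane} {φ : Plane → ℂ} (h : IsTestFunction V φ)
    (hVU : V ⊆ U) : IsTestFunction U φ := ⟨h.1, h.2.1, h.2.2.trans hVU⟩

theorem IsTestFunction.memLp {U : Set Plane} {φ : Plane → ℂ} (h : IsTestFunction U φ) (p : ℝ≥0∞)
    (S : Set Plane) : MemLp φ p (volume.restrict S) :=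
  (h.1.continuous.memLp_of_hasCompactSupport h.2.1 (μ := volume)).restrict S

theorem MemL2.integrable_mul_test {U V : Set Plane} {u φ : Plane → ℂ} (hu : MemL2 U u)
    (hφ : IsTestFunction V φ) : Integrable (fun x => u x * φ x) (volume.restrict U) :=
  hu.integrable_mul (hφ.memLp 2 U)

/-- Both integrals live on the closed support of `φ`, which lies in `V`. That support supplies the
measurability, so `U` and `V` may be arbitrary sets. -/
theorem setIntegral_mul_test_eq {U V : Set Plane} {φ : Plane → ℂ} (u : Plane → ℂ)
    (h : IsTestFunction V φ) (hVU : V ⊆ U) :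
    ∫ x in U, u x * φ x = ∫ x in V, u x * φ x := by
  have hT : MeasurableSet (tsupport φ) := (isClosed_tsupport φ).measurableSet
  have e : (fun x => u x * φ x) = (tsupport φ).indicator fun x => u x * φ x := by
    ext x
    by_cases hx : x ∈ tsupport φ
    · rw [indicator_of_mem hx]
    · rw [indicator_of_notMem hx, image_eq_zero_of_notMem_tsupport hx, mul_zero]
  rw [e, setIntegral_indicator hT, setIntegral_indicator hT, inter_eq_self_of_subset_right h.2.2,
    inter_eq_self_of_subset_right (h.2.2.trans hVU)]

/-! ### Uniqueness and locality of weak derivatives -/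

theorem MemL2.mono {U V : Set Plane} {u : Plane → ℂ} (h : MemL2 U u) (hVU : V ⊆ U) : MemL2 V u :=
  h.mono_measure (Measure.restrict_mono_set _ hVU)

/-- The fundamental lemma of the calculus of variations needs only real test functions, which are
complex test functions after coercion. Uniqueness of weak gradients and weak Laplacians rests on
this. -/
theorem ae_eq_zero_of_integral_mul_test {U : Set Plane} (hU : IsOpen U) {f : Plane → ℂ}
    (hf : MemL2 U f) (h : ∀ φ, IsTestFunction U φ → ∫ x in U, f x * φ x = 0) :
    f =ᵐ[volume.restrict U] 0 := by
  have hloc : LocallyIntegrableOn f U volume :=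
    locallyIntegrableOn_of_locallyIntegrable_restrict (MemLp.locallyIntegrable hf one_le_two)
  rw [EventuallyEq, ae_restrict_iff' hU.measurableSet]
  refine hU.ae_eq_zero_of_integral_contDiff_smul_eq_zero hloc ?_
  intro g hg hgc hgs
  have ht : tsupport (fun x => (g x : ℂ)) ⊆ tsupport g := by
    apply closure_mono
    intro x hx
    simpa using hx
  have hφ : IsTestFunction U (fun x => (g x : ℂ)) :=
    ⟨Complex.ofRealCLM.contDiff.comp hg, hgc.comp_left (g := fun r : ℝ => (r : ℂ)) (by simp),
      ht.trans hgs⟩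
  have h1 := h _ hφ
  have h2 := setIntegral_mul_test_eq f hφ (subset_univ U)
  rw [h1, Measure.restrict_univ] at h2
  rw [← h2]
  refine integral_congr_ae (Eventually.of_forall fun x => ?_)
  simp [mul_comm]

theorem ae_eq_of_integral_mul_test {U : Set Plane} (hU : IsOpen U) {f g : Plane → ℂ}
    (hf : MemL2 U f) (hg : MemL2 U g)
    (h : ∀ φ, IsTestFunction U φ → ∫ x in U, f x * φ x = ∫ x in U, g x * φ x) :
    f =ᵐ[volume.restrict U] g := by
  have h1 := ae_eq_zero_of_integral_mul_test hU (hf.sub hg) fun φ hφ => by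
    have := h φ hφ
    rw [← sub_eq_zero, ← integral_sub (hf.integrable_mul_test hφ) (hg.integrable_mul_test hφ)]
      at this
    simpa [sub_mul] using this
  filter_upwards [h1] with x hx
  exact sub_eq_zero.1 hx

theorem IsWeakGrad.ae_unique {U : Set Plane} (hU : IsOpen U) {u : Plane → ℂ}
    {G G' : Fin 2 → Plane → ℂ} (h : IsWeakGrad U u G) (h' : IsWeakGrad U u G') (i : Fin 2) :
    G i =ᵐ[volume.restrict U] G' i :=
  ae_eq_of_integral_mul_test hU (h.1 i) (h'.1 i) fun φ hφ =>
    neg_injective ((h.2 i φ hφ).symm.trans (h'.2 i φ hφ))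

theorem isWeakGrad_weakGrad {U : Set Plane} {u : Plane → ℂ} (h : MemH1 U u) :
    IsWeakGrad U u (weakGrad U u) := by
  unfold weakGrad
  rw [dif_pos h.2]
  exact h.2.choose_spec

theorem MemH1.memL2_weakGrad {U : Set Plane} {u : Plane → ℂ} (h : MemH1 U u) (i : Fin 2) :
    MemL2 U (weakGrad U u i) := (isWeakGrad_weakGrad h).1 i

theorem IsWeakGrad.mono {U V : Set Plane} {u : Plane → ℂ} {G : Fin 2 → Plane → ℂ}
    (h : IsWeakGrad U u G) (hVU : V ⊆ U) : IsWeakGrad V u G := by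
  refine ⟨fun i => (h.1 i).mono hVU, fun i φ hφ => ?_⟩
  rw [← setIntegral_mul_test_eq u (hφ.pderiv i) hVU, ← setIntegral_mul_test_eq (G i) hφ hVU]
  exact h.2 i φ (hφ.mono hVU)

theorem MemH1.mono {U V : Set Plane} {u : Plane → ℂ} (h : MemH1 U u) (hVU : V ⊆ U) : MemH1 V u :=
  ⟨h.1.mono hVU, _, (isWeakGrad_weakGrad h).mono hVU⟩

theorem weakGrad_ae_eq_of_isWeakGrad {U : Set Plane} (hU : IsOpen U) {u : Plane → ℂ}
    {G : Fin 2 → Plane → ℂ} (hu : MemL2 U u) (h : IsWeakGrad U u G) (i : Fin 2) :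
    weakGrad U u i =ᵐ[volume.restrict U] G i :=
  (isWeakGrad_weakGrad ⟨hu, G, h⟩).ae_unique hU h i

theorem weakGrad_ae_eq_of_subset {U V : Set Plane} (hV : IsOpen V) (hVU : V ⊆ U) {u : Plane → ℂ}
    (hu : MemH1 U u) (i : Fin 2) : weakGrad V u i =ᵐ[volume.restrict V] weakGrad U u i :=
  weakGrad_ae_eq_of_isWeakGrad hV (hu.mono hVU).1 ((isWeakGrad_weakGrad hu).mono hVU) i

theorem IsWeakGrad.add {U : Set Plane} {u v : Plane → ℂ} {G G' : Fin 2 → Plane → ℂ}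
    (hu : MemL2 U u) (hv : MemL2 U v) (h : IsWeakGrad U u G) (h' : IsWeakGrad U v G') :
    IsWeakGrad U (u + v) (G + G') := by
  refine ⟨fun i => (h.1 i).add (h'.1 i), fun i φ hφ => ?_⟩
  simp only [Pi.add_apply, add_mul]
  rw [integral_add (hu.integrable_mul_test (hφ.pderiv i)) (hv.integrable_mul_test (hφ.pderiv i)),
    integral_add ((h.1 i).integrable_mul_test hφ) ((h'.1 i).integrable_mul_test hφ),
    h.2 i φ hφ, h'.2 i φ hφ]
  ring

/-- The test function extends both integrals to the whole plane, where integration by parts has no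
boundary term. Boundedness of `U` serves only to put the derivatives in `L²(U)`. -/
theorem isWeakGrad_pderiv {U : Set Plane} (hU : IsOpen U) (hb : Bornology.IsBounded U)
    {φ : Plane → ℂ} (hφ : ContDiff ℝ ∞ φ) : IsWeakGrad U φ (fun i => pderiv i φ) := by
  refine ⟨fun i => memLp_restrict_of_continuous (contDiff_pderiv hφ i).continuous
    hU.measurableSet hb hb.measure_lt_top.ne 2, fun i ψ hψ => ?_⟩
  have e1 := setIntegral_mul_test_eq φ (hψ.pderiv i) (subset_univ U)
  have e2 := setIntegral_mul_test_eq (pderiv i φ) hψ (subset_univ U)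
  rw [Measure.restrict_univ] at e1 e2
  rw [← e1, ← e2]
  refine integral_mul_fderiv_eq_neg_fderiv_mul_of_integrable ?_ ?_ ?_
    (fun x _ => hφ.differentiable (by simp) x) (fun x _ => hψ.1.differentiable (by simp) x)
  · exact ((contDiff_pderiv hφ i).continuous.mul hψ.1.continuous).integrable_of_hasCompactSupport
      hψ.2.1.mul_left
  · exact (hφ.continuous.mul (hψ.pderiv i).1.continuous).integrable_of_hasCompactSupport
      (hψ.pderiv i).2.1.mul_left
  · exact (hφ.continuous.mul hψ.1.continuous).integrable_of_hasCompactSupport hψ.2.1.mul_left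

theorem memL2_of_contDiff {U : Set Plane} (hU : IsOpen U) (hb : Bornology.IsBounded U)
    {φ : Plane → ℂ} (hφ : ContDiff ℝ ∞ φ) : MemL2 U φ :=
  memLp_restrict_of_continuous hφ.continuous hU.measurableSet hb hb.measure_lt_top.ne 2

theorem memH1_of_contDiff {U : Set Plane} (hU : IsOpen U) (hb : Bornology.IsBounded U)
    {φ : Plane → ℂ} (hφ : ContDiff ℝ ∞ φ) : MemH1 U φ :=
  ⟨memL2_of_contDiff hU hb hφ, _, isWeakGrad_pderiv hU hb hφ⟩

theorem weakGrad_ae_eq_pderiv {U : Set Plane} (hU : IsOpen U) (hb : Bornology.IsBounded U)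
    {φ : Plane → ℂ} (hφ : ContDiff ℝ ∞ φ) (i : Fin 2) :
    weakGrad U φ i =ᵐ[volume.restrict U] pderiv i φ :=
  weakGrad_ae_eq_of_isWeakGrad hU (memL2_of_contDiff hU hb hφ) (isWeakGrad_pderiv hU hb hφ) i

theorem HasWeakLaplacian.ae_unique {U : Set Plane} (hU : IsOpen U) {u f f' : Plane → ℂ}
    (hf : MemL2 U f) (hf' : MemL2 U f') (h : HasWeakLaplacian U u f)
    (h' : HasWeakLaplacian U u f') : f =ᵐ[volume.restrict U] f' :=
  ae_eq_of_integral_mul_test hU hf hf' fun φ hφ => (h φ hφ).symm.trans (h' φ hφ)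

theorem HasWeakLaplacian.add {U : Set Plane} {u v f g : Plane → ℂ} (hu : MemL2 U u)
    (hv : MemL2 U v) (hf : MemL2 U f) (hg : MemL2 U g) (h : HasWeakLaplacian U u f)
    (h' : HasWeakLaplacian U v g) : HasWeakLaplacian U (u + v) (f + g) := by
  intro φ hφ
  have hΔ : ∀ w, MemL2 U w → Integrable (fun x => w x * (DtNTDG.pderiv 0 (DtNTDG.pderiv 0 φ) x
      + DtNTDG.pderiv 1 (DtNTDG.pderiv 1 φ) x)) (volume.restrict U) := by
    intro w hw
    refine ((hw.integrable_mul_test ((hφ.pderiv 0).pderiv 0)).add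
      (hw.integrable_mul_test ((hφ.pderiv 1).pderiv 1))).congr (Eventually.of_forall fun x => ?_)
    simp only [Pi.add_apply]
    ring
  simp only [Pi.add_apply, add_mul]
  rw [integral_add (hΔ u hu) (hΔ v hv), integral_add (hf.integrable_mul_test hφ)
    (hg.integrable_mul_test hφ), h φ hφ, h' φ hφ]

/-! ### Convergence in `H¹` -/

theorem eLpNorm_congr_sub {α : Type*} [MeasurableSpace α] {μ : Measure α} {f g h : α → ℂ}
    (e : g =ᵐ[μ] h) (p : ℝ≥0∞) :
    eLpNorm (fun x => f x - g x) p μ = eLpNorm (fun x => f x - h x) p μ :=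
  eLpNorm_congr_ae (by filter_upwards [e] with x hx; rw [hx])

/-- The gradients `weakGrad U u` and `weakGrad V u` are independent choices, equal only almost
everywhere on `V`, so the second convergence has to be transported across that equality. -/
theorem TendstoH1.mono {U V : Set Plane} (hV : IsOpen V) (hVU : V ⊆ U) {φ : ℕ → Plane → ℂ}
    {u : Plane → ℂ} (hu : MemH1 U u) (h : TendstoH1 U φ u) : TendstoH1 V φ u := by
  refine ⟨?_, fun i => ?_⟩
  · exact tendsto_of_tendsto_of_tendsto_of_le_of_le tendsto_const_nhds h.1 (fun _ => zero_le)
      fun j => eLpNorm_mono_measure _ (Measure.restrict_mono_set _ hVU)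
  · refine tendsto_of_tendsto_of_tendsto_of_le_of_le tendsto_const_nhds (h.2 i) (fun _ => zero_le)
      fun j => ?_
    simp only
    rw [eLpNorm_congr_sub (weakGrad_ae_eq_of_subset hV hVU hu i)]
    exact eLpNorm_mono_measure _ (Measure.restrict_mono_set _ hVU)

theorem tendstoH1_const {U : Set Plane} (hU : IsOpen U) (hb : Bornology.IsBounded U)
    {φ : Plane → ℂ} (hφ : ContDiff ℝ ∞ φ) : TendstoH1 U (fun _ => φ) φ := by
  refine ⟨by simp, fun i => ?_⟩
  simp only
  rw [eLpNorm_congr_sub (weakGrad_ae_eq_pderiv hU hb hφ i)]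
  simp

/-- If `φ_j → u` and `ψ_j → u` in `H¹(U)`, then `φ_j - ψ_j → 0` in `L²(U)` together with its partial
derivatives. -/
theorem TendstoH1.sub_tendsto {U : Set Plane} {φ ψ : ℕ → Plane → ℂ} {u : Plane → ℂ}
    (hu : MemH1 U u) (hφ : ∀ j, ContDiff ℝ ∞ (φ j)) (hψ : ∀ j, ContDiff ℝ ∞ (ψ j))
    (h1 : TendstoH1 U φ u) (h2 : TendstoH1 U ψ u) :
    Tendsto (fun j => eLpNorm (fun x => φ j x - ψ j x) 2 (volume.restrict U)) atTop (𝓝 0) ∧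
    ∀ i, Tendsto (fun j => eLpNorm (pderiv i (fun x => φ j x - ψ j x)) 2 (volume.restrict U))
      atTop (𝓝 0) := by
  have key : ∀ (a b : ℕ → Plane → ℂ) (w : Plane → ℂ), (∀ j, Continuous (a j)) →
      (∀ j, Continuous (b j)) → MemL2 U w →
      Tendsto (fun j => eLpNorm (fun x => a j x - w x) 2 (volume.restrict U)) atTop (𝓝 0) →
      Tendsto (fun j => eLpNorm (fun x => b j x - w x) 2 (volume.restrict U)) atTop (𝓝 0) →
      Tendsto (fun j => eLpNorm (fun x => a j x - b j x) 2 (volume.restrict U)) atTop (𝓝 0) := by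
    intro a b w ha hb hw h h'
    have h3 : Tendsto (fun j => eLpNorm (fun x => a j x - w x) 2 (volume.restrict U)
        + eLpNorm (fun x => b j x - w x) 2 (volume.restrict U)) atTop (𝓝 0) := by
      simpa using h.add h'
    refine tendsto_of_tendsto_of_tendsto_of_le_of_le tendsto_const_nhds h3 (fun _ => zero_le)
      fun j => ?_
    have e : (fun x => a j x - b j x) = (fun x => a j x - w x) - (fun x => b j x - w x) := by
      ext x; simp
    simp only [e]
    exact eLpNorm_sub_le ((ha j).aestronglyMeasurable.sub hw.1)
      ((hb j).aestronglyMeasurable.sub hw.1) one_le_two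
  refine ⟨key φ ψ u (fun j => (hφ j).continuous) (fun j => (hψ j).continuous) hu.1 h1.1 h2.1,
    fun i => ?_⟩
  have := key (fun j => pderiv i (φ j)) (fun j => pderiv i (ψ j)) (weakGrad U u i)
    (fun j => (contDiff_pderiv (hφ j) i).continuous)
    (fun j => (contDiff_pderiv (hψ j) i).continuous) (hu.memL2_weakGrad i) (h1.2 i) (h2.2 i)
  refine this.congr fun j => ?_
  congr 1
  ext x
  exact (pderiv_sub (hφ j) (hψ j) i x).symm

/-! ### The boundary of a convex polygon -/

/-- The linear coordinates `(s, t) ↦ s d + t e` on the plane. -/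
noncomputable def frame (d e : Plane) (h : d 0 * e 1 - d 1 * e 0 ≠ 0) : (ℝ × ℝ) ≃L[ℝ] Plane :=
  LinearEquiv.toContinuousLinearEquiv
    { toFun := fun q => q.1 • d + q.2 • e
      map_add' := fun q r => by simp only [Prod.fst_add, Prod.snd_add, add_smul]; abel
      map_smul' := fun c q => by simp [smul_smul]
      invFun := fun y => ((y 0 * e 1 - y 1 * e 0) / (d 0 * e 1 - d 1 * e 0),
        (d 0 * y 1 - d 1 * y 0) / (d 0 * e 1 - d 1 * e 0))
      left_inv := fun q => by
        ext <;> simp only [PiLp.add_apply, PiLp.smul_apply, smul_eq_mul] <;>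
          rw [div_eq_iff h] <;> ring
      right_inv := fun y => by
        ext i
        fin_cases i <;> simp only [PiLp.add_apply, PiLp.smul_apply, smul_eq_mul, Fin.zero_eta,
          Fin.mk_one] <;>
          rw [div_mul_eq_mul_div, div_mul_eq_mul_div, ← add_div, div_eq_iff h] <;> ring }

theorem frame_apply (d e : Plane) (h : d 0 * e 1 - d 1 * e 0 ≠ 0) (q : ℝ × ℝ) :
    frame d e h q = q.1 • d + q.2 • e := rfl

/-- The segment `p + [0, ℓ] d` is a part of the boundary of `K`, and the parallelogram spanned by
`ℓ d` and `e` at `p` lies in `K`. -/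
structure BoundaryChart (K : Set Plane) (p d e : Plane) (ℓ : ℝ) : Prop where
  norm_d : ‖d‖ = 1
  det : d 0 * e 1 - d 1 * e 0 ≠ 0
  mem : ∀ s ∈ Ioo 0 ℓ, ∀ t ∈ Ioo (0 : ℝ) 1, p + s • d + t • e ∈ K

/-- A nonzero functional and its rotation by a quarter turn are coordinates on the plane, with
determinant `a ^ 2 + b ^ 2`. The rotated functional will measure position along a supporting line.
-/
theorem ext_of_functional {f : Plane →L[ℝ] ℝ} (hf : f ≠ 0) {x y : Plane} (h1 : f x = f y)
    (h2 : f (EuclideanSpace.single 0 1) * x 1 - f (EuclideanSpace.single 1 1) * x 0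
      = f (EuclideanSpace.single 0 1) * y 1 - f (EuclideanSpace.single 1 1) * y 0) : x = y := by
  have hx : ∀ z : Plane, f z = f (EuclideanSpace.single 0 1) * z 0
      + f (EuclideanSpace.single 1 1) * z 1 := by
    intro z
    have : z = z 0 • EuclideanSpace.single 0 (1 : ℝ) + z 1 • EuclideanSpace.single 1 (1 : ℝ) := by
      ext i; fin_cases i <;> simp
    conv_lhs => rw [this]
    simp [mul_comm]
  set a := f (EuclideanSpace.single 0 1)
  set b := f (EuclideanSpace.single 1 1)
  have hab : a ^ 2 + b ^ 2 ≠ 0 := by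
    intro h0
    have ha : a = 0 := by nlinarith [sq_nonneg a, sq_nonneg b]
    have hb : b = 0 := by nlinarith [sq_nonneg a, sq_nonneg b]
    apply hf
    ext z
    rw [hx z, ha, hb]
    simp
  rw [hx x, hx y] at h1
  have e0 : (a ^ 2 + b ^ 2) * (x 0 - y 0) = 0 := by linear_combination a * h1 - b * h2
  have e1 : (a ^ 2 + b ^ 2) * (x 1 - y 1) = 0 := by linear_combination b * h1 + a * h2
  ext i
  fin_cases i
  · exact sub_eq_zero.1 ((mul_eq_zero.1 e0).resolve_left hab)
  · exact sub_eq_zero.1 ((mul_eq_zero.1 e1).resolve_left hab)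

/-- The point `a + s d + t e` combines the interior point `c`, with weight `t / 2`, and a point of
the segment from `a` to `b`, with weight `1 - t / 2`. The chart stops at half of the segment so that
this second point does not run past `b`. -/
theorem exists_boundaryChart_of_mem {C : Set Plane} (hC : Convex ℝ C) {a b c : Plane}
    (ha : a ∈ C) (hb : b ∈ C) (hc : c ∈ interior C) {f : Plane →L[ℝ] ℝ} (hfab : f a = f b)
    (hfc : f c < f a) (hab : a ≠ b) :
    BoundaryChart (interior C) a (‖b - a‖⁻¹ • (b - a)) ((1 / 2 : ℝ) • (c - a)) (‖b - a‖ / 2) := by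
  have hn : 0 < ‖b - a‖ := norm_pos_iff.2 (sub_ne_zero.2 hab.symm)
  refine ⟨by rw [norm_smul, norm_inv, norm_norm, inv_mul_cancel₀ hn.ne'], ?_, ?_⟩
  · intro h
    have hx : ∀ z : Plane, f z = f (EuclideanSpace.single 0 1) * z 0
        + f (EuclideanSpace.single 1 1) * z 1 := by
      intro z
      have : z = z 0 • EuclideanSpace.single 0 (1 : ℝ)
          + z 1 • EuclideanSpace.single 1 (1 : ℝ) := by
        ext i; fin_cases i <;> simp
      conv_lhs => rw [this]
      simp [mul_comm]
    simp only [PiLp.smul_apply, PiLp.sub_apply, smul_eq_mul] at h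
    have h' : (b 0 - a 0) * (c 1 - a 1) - (b 1 - a 1) * (c 0 - a 0) = 0 := by
      have : ‖b - a‖⁻¹ * (1 / 2) * ((b 0 - a 0) * (c 1 - a 1) - (b 1 - a 1) * (c 0 - a 0)) = 0 := by
        linear_combination h
      exact (mul_eq_zero.1 this).resolve_left (by positivity)
    rw [hx a, hx b] at hfab
    rw [hx c, hx a] at hfc
    -- If the determinant vanished, `b - a` would be parallel to `c - a`; but `f` kills `b - a` and
    -- not `c - a`, which forces `b = a`. This is one coordinate of `(f c - f a) (b - a) = 0`.
    have e0 : (f (EuclideanSpace.single 0 1) * (c 0 - a 0)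
        + f (EuclideanSpace.single 1 1) * (c 1 - a 1)) * (b 0 - a 0) = 0 := by
      linear_combination f (EuclideanSpace.single 1 1) * h' - (c 0 - a 0) * hfab
    have e1 : (f (EuclideanSpace.single 0 1) * (c 0 - a 0)
        + f (EuclideanSpace.single 1 1) * (c 1 - a 1)) * (b 1 - a 1) = 0 := by
      linear_combination - f (EuclideanSpace.single 0 1) * h' - (c 1 - a 1) * hfab
    have hne : f (EuclideanSpace.single 0 1) * (c 0 - a 0)
        + f (EuclideanSpace.single 1 1) * (c 1 - a 1) ≠ 0 := by
      intro h0; linarith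
    apply hab
    ext i
    fin_cases i
    · exact (sub_eq_zero.1 ((mul_eq_zero.1 e0).resolve_left hne)).symm
    · exact (sub_eq_zero.1 ((mul_eq_zero.1 e1).resolve_left hne)).symm
  · intro s hs t ht
    have hy : (1 - s / ‖b - a‖ / (1 - t / 2)) • a + (s / ‖b - a‖ / (1 - t / 2)) • b ∈ C := by
      have h1 : 0 < 1 - t / 2 := by linarith [ht.2]
      have h2 : s / ‖b - a‖ ≤ 1 / 2 := by
        rw [div_le_iff₀ hn]; linarith [hs.2]
      refine hC ha hb ?_ (div_nonneg (div_nonneg hs.1.le hn.le) h1.le) (by ring)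
      rw [sub_nonneg, div_le_one h1]
      linarith [ht.2]
    have := hC.combo_interior_self_mem_interior hc hy (a := t / 2) (b := 1 - t / 2)
      (by linarith [ht.1]) (by linarith [ht.2]) (by ring)
    convert this using 1
    have h1 : 1 - t / 2 ≠ 0 := by linarith [ht.2]
    ext i
    simp only [PiLp.add_apply, PiLp.smul_apply, PiLp.sub_apply, smul_eq_mul]
    have h2 : (1 - t / 2) * (s / ‖b - a‖ / (1 - t / 2)) = s * ‖b - a‖⁻¹ := by
      rw [mul_div_cancel₀ _ h1, div_eq_mul_inv]
    linear_combination (a i - b i) * h2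

theorem mem_convexHull_of_mem_frontier {V : Finset Plane} {x : Plane}
    (hx : x ∈ frontier (interior (convexHull ℝ (V : Set Plane)))) :
    x ∈ convexHull ℝ (V : Set Plane) := by
  have hcl : IsClosed (convexHull ℝ (V : Set Plane)) := (V.finite_toSet.isClosed_convexHull ℝ)
  exact closure_minimal interior_subset hcl (frontier_subset_closure hx)

/-- Apart from finitely many points, the boundary of a convex polygon is covered by finitely many
charts. -/
theorem exists_boundaryChart_cover (V : Finset Plane)
    (hV : (interior (convexHull ℝ (V : Set Plane))).Nonempty) :
    ∃ (T : Finset (Plane × Plane × Plane × ℝ)) (E : Finset Plane),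
      (∀ q ∈ T, BoundaryChart (interior (convexHull ℝ (V : Set Plane)))
        q.1 q.2.1 q.2.2.1 q.2.2.2) ∧
      frontier (interior (convexHull ℝ (V : Set Plane))) ⊆
        (E : Set Plane) ∪ ⋃ q ∈ T, (fun s : ℝ => q.1 + s • q.2.1) '' Ioo 0 q.2.2.2 := by
  classical
  obtain ⟨c, hc⟩ := hV
  set C := convexHull ℝ (V : Set Plane) with hCdef
  have hC : Convex ℝ C := convex_convexHull ℝ _
  have hVC : ∀ a ∈ V, a ∈ C := fun a ha => subset_convexHull ℝ _ ha
  -- Each ordered pair of vertices proposes a chart on the first half of the segment joining them,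
  -- and the filter keeps the proposals that are charts. The exceptional points are the vertices and
  -- the midpoints of these segments.
  let chart : Plane × Plane → Plane × Plane × Plane × ℝ := fun q =>
    (q.1, ‖q.2 - q.1‖⁻¹ • (q.2 - q.1), (1 / 2 : ℝ) • (c - q.1), ‖q.2 - q.1‖ / 2)
  refine ⟨((V ×ˢ V).image chart).filter fun q => BoundaryChart (interior C)
    q.1 q.2.1 q.2.2.1 q.2.2.2, V ∪ (V ×ˢ V).image fun q => (1 / 2 : ℝ) • (q.1 + q.2), ?_, ?_⟩
  · intro q hq
    exact (Finset.mem_filter.1 hq).2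
  intro x hx
  have hxC : x ∈ C := mem_convexHull_of_mem_frontier hx
  have hxK : x ∉ interior C := by
    have := hx.2
    rwa [interior_interior] at this
  by_cases hxV : x ∈ V
  · exact Or.inl (by simp [hxV])
  obtain ⟨f, hf⟩ := geometric_hahn_banach_open_point hC.interior isOpen_interior hxK
  have hf0 : f ≠ 0 := by
    rintro rfl
    simpa using hf c hc
  have hfC : ∀ y ∈ C, f y ≤ f x := by
    intro y hy
    have hy' : y ∈ closure (interior C) := by
      rw [hC.closure_interior_eq_closure_of_nonempty_interior ⟨c, hc⟩]
      exact subset_closure hy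
    exact closure_minimal (t := {z | f z ≤ f x}) (fun z hz => (hf z hz).le)
      (isClosed_le f.continuous continuous_const) hy'
  -- Since `f` is at most `f x` on `C`, a convex combination of vertices equal to `x` can give
  -- positive weight only to vertices on the supporting line `f = f x`.
  obtain ⟨w, hw0, hw1, hwx⟩ := Finset.mem_convexHull'.1 hxC
  have hfw : ∀ v ∈ V, 0 < w v → f v = f x := by
    have hsum : ∑ v ∈ V, w v * (f x - f v) = 0 := by
      simp only [mul_sub, Finset.sum_sub_distrib, ← Finset.sum_mul, hw1]
      rw [← hwx]
      simp [map_sum]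
    intro v hv hwv
    have := (Finset.sum_eq_zero_iff_of_nonneg fun v hv =>
      mul_nonneg (hw0 v hv) (sub_nonneg.2 (hfC v (hVC v hv)))).1 hsum v hv
    linarith [(mul_eq_zero.1 this).resolve_left hwv.ne']
  -- `h` is a coordinate along the supporting line. The weighted mean of its values is `h x`, and no
  -- vertex of positive weight attains `h x` because `x` is not a vertex, so there is such a vertex
  -- on each side of `x`.
  set h : Plane → ℝ := fun y => f (EuclideanSpace.single 0 1) * y 1
    - f (EuclideanSpace.single 1 1) * y 0 with hh
  have hhsum : ∑ v ∈ V, w v * (h v - h x) = 0 := by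
    have : h x = ∑ v ∈ V, w v * h v := by
      have e : ∀ i, x i = ∑ v ∈ V, w v * v i := fun i => by
        conv_lhs => rw [← hwx]
        simp [Finset.sum_apply]
      simp only [hh, e, Finset.mul_sum, mul_sub, Finset.sum_sub_distrib]
      congr 1 <;> refine Finset.sum_congr rfl fun v _ => by ring
    simp only [mul_sub, Finset.sum_sub_distrib, ← Finset.sum_mul, hw1, this]
    ring
  have hhne : ∀ v ∈ V, 0 < w v → h v ≠ h x := by
    intro v hv hwv e
    exact hxV ((ext_of_functional hf0 (hfw v hv hwv) e) ▸ hv)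
  have hex : ∃ v ∈ V, 0 < w v := by
    by_contra hcon
    push Not at hcon
    have : ∑ v ∈ V, w v = 0 :=
      Finset.sum_eq_zero fun v hv => le_antisymm (hcon v hv) (hw0 v hv)
    linarith
  obtain ⟨v₀, hv₀, hwv₀⟩ := hex
  obtain ⟨a, ha, hwa, hha⟩ : ∃ a ∈ V, 0 < w a ∧ h a < h x := by
    by_contra hcon
    push Not at hcon
    have h0 : ∀ v ∈ V, 0 ≤ w v * (h v - h x) := by
      intro v hv
      rcases (hw0 v hv).eq_or_lt with h1 | h1
      · rw [← h1, zero_mul]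
      · exact mul_nonneg h1.le (sub_nonneg.2 (hcon v hv h1))
    have := (Finset.sum_eq_zero_iff_of_nonneg h0).1 hhsum v₀ hv₀
    exact hhne v₀ hv₀ hwv₀ (sub_eq_zero.1 ((mul_eq_zero.1 this).resolve_left hwv₀.ne'))
  obtain ⟨b, hb, hwb, hhb⟩ : ∃ b ∈ V, 0 < w b ∧ h x < h b := by
    by_contra hcon
    push Not at hcon
    have h0 : ∀ v ∈ V, w v * (h v - h x) ≤ 0 := by
      intro v hv
      rcases (hw0 v hv).eq_or_lt with h1 | h1
      · rw [← h1, zero_mul]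
      · exact mul_nonpos_of_nonneg_of_nonpos h1.le (sub_nonpos.2 (hcon v hv h1))
    have := (Finset.sum_eq_zero_iff_of_nonpos h0).1 hhsum v₀ hv₀
    exact hhne v₀ hv₀ hwv₀ (sub_eq_zero.1 ((mul_eq_zero.1 this).resolve_left hwv₀.ne'))
  have hab : a ≠ b := by rintro rfl; linarith
  have hfab : f a = f b := (hfw a ha hwa).trans (hfw b hb hwb).symm
  have hfc : f c < f x := hf c hc
  have hpos : 0 < h b - h a := by linarith
  have hxs : x = a + ((h x - h a) / (h b - h a)) • (b - a) := by
    refine ext_of_functional hf0 ?_ ?_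
    · rw [map_add, map_smul, map_sub, hfab, sub_self, smul_zero, add_zero, hfw b hb hwb]
    · have : ∀ s : ℝ, h (a + s • (b - a)) = h a + s * (h b - h a) := by
        intro s
        simp only [hh, PiLp.add_apply, PiLp.smul_apply, PiLp.sub_apply, smul_eq_mul]
        ring
      change h x = h _
      rw [this, div_mul_cancel₀ _ hpos.ne']
      ring
  set s := (h x - h a) / (h b - h a) with hs
  have hs0 : 0 < s := div_pos (by linarith) hpos
  have hs1 : s < 1 := (div_lt_one hpos).2 (by linarith)
  have hn : 0 < ‖b - a‖ := norm_pos_iff.2 (sub_ne_zero.2 hab.symm)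
  -- The point is covered by the chart starting at the nearer of the two vertices, or else it is the
  -- midpoint.
  rcases lt_trichotomy s (1 / 2) with hlt | heq | hgt
  · refine Or.inr (mem_iUnion₂.2 ⟨chart (a, b), ?_, s * ‖b - a‖, ⟨by positivity, ?_⟩, ?_⟩)
    · refine Finset.mem_filter.2 ⟨Finset.mem_image_of_mem _ (Finset.mk_mem_product ha hb), ?_⟩
      exact exists_boundaryChart_of_mem hC (hVC a ha) (hVC b hb) hc hfab
        (by rw [hfw a ha hwa]; exact hfc) hab
    · change s * ‖b - a‖ < ‖b - a‖ / 2
      nlinarith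
    · change a + (s * ‖b - a‖) • (‖b - a‖⁻¹ • (b - a)) = x
      rw [smul_smul, mul_assoc, mul_inv_cancel₀ hn.ne', mul_one, ← hxs]
  · refine Or.inl ?_
    have : x = (1 / 2 : ℝ) • (a + b) := by
      rw [hxs, heq]
      module
    rw [Finset.mem_coe, Finset.mem_union]
    refine Or.inr (Finset.mem_image.2 ⟨(a, b), Finset.mk_mem_product ha hb, this.symm⟩)
  · have hn' : ‖a - b‖ = ‖b - a‖ := norm_sub_rev a b
    refine Or.inr (mem_iUnion₂.2 ⟨chart (b, a), ?_, (1 - s) * ‖a - b‖,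
      ⟨mul_pos (by linarith) (by rw [hn']; exact hn), ?_⟩, ?_⟩)
    · refine Finset.mem_filter.2 ⟨Finset.mem_image_of_mem _ (Finset.mk_mem_product hb ha), ?_⟩
      exact exists_boundaryChart_of_mem hC (hVC b hb) (hVC a ha) hc hfab.symm
        (by rw [hfw b hb hwb]; exact hfc) hab.symm
    · change (1 - s) * ‖a - b‖ < ‖a - b‖ / 2
      rw [hn']
      nlinarith
    · change b + ((1 - s) * ‖a - b‖) • (‖a - b‖⁻¹ • (a - b)) = x
      rw [smul_smul, mul_assoc, mul_inv_cancel₀ (by rw [hn']; exact hn.ne'), mul_one]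
      conv_rhs => rw [hxs]
      module

/-- Near `x`, the set `K` contains a half disc with centre `x`, on the side `f < f x`. -/
def HasHalfDisc (K : Set Plane) (x : Plane) (f : Plane →L[ℝ] ℝ) : Prop :=
  f ≠ 0 ∧ ∀ᶠ y in 𝓝 x, f y < f x → y ∈ K

/-- In the oblique coordinates of the frame, points near `p + s d` with positive second coordinate
lie in the parallelogram of the chart. The functional is minus that coordinate. -/
theorem BoundaryChart.exists_hasHalfDisc {K : Set Plane} {p d e : Plane} {ℓ : ℝ}
    (h : BoundaryChart K p d e ℓ) {s : ℝ} (hs : s ∈ Ioo 0 ℓ) :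
    ∃ f, HasHalfDisc K (p + s • d) f := by
  set Φ := frame d e h.det with hΦ
  set σ : Plane →L[ℝ] ℝ := (ContinuousLinearMap.fst ℝ ℝ ℝ).comp Φ.symm.toContinuousLinearMap
  set τ : Plane →L[ℝ] ℝ := (ContinuousLinearMap.snd ℝ ℝ ℝ).comp Φ.symm.toContinuousLinearMap
  have hdec : ∀ y, y = σ y • d + τ y • e := fun y => (Φ.apply_symm_apply y).symm
  have hd : Φ.symm d = (1, 0) := by
    rw [ContinuousLinearEquiv.symm_apply_eq]; simp [hΦ, frame_apply]
  have he : Φ.symm e = (0, 1) := by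
    rw [ContinuousLinearEquiv.symm_apply_eq]; simp [hΦ, frame_apply]
  have hσd : σ d = 1 := congrArg Prod.fst hd
  have hτd : τ d = 0 := congrArg Prod.snd hd
  have hτe : τ e = 1 := congrArg Prod.snd he
  refine ⟨-τ, ?_, ?_⟩
  · intro h0
    have : (-τ) e = 0 := by rw [h0]; rfl
    rw [neg_apply, hτe] at this
    norm_num at this
  have c1 : ∀ᶠ y in 𝓝 (p + s • d), σ (y - p) ∈ Ioo 0 ℓ := by
    have hc : ContinuousAt (fun y => σ (y - p)) (p + s • d) := by fun_prop
    refine hc.eventually_mem (Ioo_mem_nhds ?_ ?_) <;> simp [hσd, hs.1, hs.2]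
  have c2 : ∀ᶠ y in 𝓝 (p + s • d), τ (y - p) < 1 := by
    have hc : ContinuousAt (fun y => τ (y - p)) (p + s • d) := by fun_prop
    refine hc.eventually_mem (Iio_mem_nhds ?_)
    simp [hτd]
  filter_upwards [c1, c2] with y h1 h2 hy
  have hy' : 0 < τ (y - p) := by
    simp only [neg_apply, map_add, map_smul, hτd, smul_eq_mul] at hy
    rw [map_sub]; linarith
  have := h.mem _ h1 _ ⟨hy', h2⟩
  rwa [add_assoc, ← hdec (y - p), add_sub_cancel] at this

/-! ### Arc length on segments -/

theorem isometry_line (p : Plane) {d : Plane} (hd : ‖d‖ = 1) :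
    Isometry fun s : ℝ => p + s • d := by
  refine Isometry.of_dist_eq fun s t => ?_
  rw [dist_add_left, dist_eq_norm, ← sub_smul, norm_smul, hd, mul_one, Real.dist_eq,
    Real.norm_eq_abs]

/-- Isometries preserve Hausdorff measure, and on the line `μH[1]` is Lebesgue measure. This turns
integrals along segments into integrals over intervals. -/
theorem map_volume_restrict_of_isometry {ι : ℝ → Plane} (hι : Isometry ι) (A : Set ℝ) :
    (volume.restrict A).map ι = (μH[1] : Measure Plane).restrict (ι '' A) := by
  have he := hι.isClosedEmbedding.measurableEmbedding
  have h1 : (volume : Measure ℝ).map ι = (μH[1] : Measure Plane).restrict (range ι) := by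
    rw [← hausdorffMeasure_real]
    exact hι.map_hausdorffMeasure (Or.inl zero_le_one)
  have h2 := he.restrict_map volume (ι '' A)
  rw [preimage_image_eq _ hι.injective] at h2
  rw [← h2, h1, Measure.restrict_restrict_of_subset (image_subset_range _ _)]

theorem hausdorffMeasure_isometry_image_ne_top {ι : ℝ → Plane} (hι : Isometry ι) {A : Set ℝ}
    (hA : Bornology.IsBounded A) : (μH[1] : Measure Plane) (ι '' A) ≠ ⊤ := by
  rw [hι.hausdorffMeasure_image (Or.inl zero_le_one), hausdorffMeasure_real]
  exact hA.measure_lt_top.ne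

theorem hausdorffMeasure_frontier_ne_top (V : Finset Plane)
    (hV : (interior (convexHull ℝ (V : Set Plane))).Nonempty) :
    (μH[1] : Measure Plane) (frontier (interior (convexHull ℝ (V : Set Plane)))) ≠ ⊤ := by
  obtain ⟨T, E, hT, hcov⟩ := exists_boundaryChart_cover V hV
  have := Measure.nullSingletonClass_hausdorff Plane one_pos
  refine ne_top_of_le_ne_top ?_ ((measure_mono hcov).trans (measure_union_le _ _))
  rw [ENNReal.add_ne_top]
  refine ⟨by rw [E.finite_toSet.measure_zero]; simp, ?_⟩
  refine ne_top_of_le_ne_top ?_ (measure_biUnion_finset_le T _)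
  refine ENNReal.sum_ne_top.2 fun q hq => ?_
  exact hausdorffMeasure_isometry_image_ne_top (isometry_line q.1 (hT q hq).norm_d)
    (Metric.isBounded_Ioo _ _)

/-- Almost every point of the boundary of a convex polygon is the centre of a half disc in it. -/
theorem ae_exists_hasHalfDisc (V : Finset Plane)
    (hV : (interior (convexHull ℝ (V : Set Plane))).Nonempty) :
    ∀ᵐ x ∂(μH[1] : Measure Plane), x ∈ frontier (interior (convexHull ℝ (V : Set Plane))) →
      ∃ f, HasHalfDisc (interior (convexHull ℝ (V : Set Plane))) x f := by
  obtain ⟨T, E, hT, hcov⟩ := exists_boundaryChart_cover V hV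
  have := Measure.nullSingletonClass_hausdorff Plane one_pos
  have hE : ∀ᵐ x ∂(μH[1] : Measure Plane), x ∉ (E : Set Plane) :=
    measure_eq_zero_iff_ae_notMem.1 (E.finite_toSet.measure_zero _)
  filter_upwards [hE] with x hxE hx
  rcases hcov hx with h | h
  · exact absurd h hxE
  · obtain ⟨q, hq, s, hs, rfl⟩ := mem_iUnion₂.1 h
    exact (hT q hq).exists_hasHalfDisc hs

/-! ### The trace inequality -/

theorem eLpNorm_two_sq {α E : Type*} [MeasurableSpace α] [NormedAddCommGroup E] {μ : Measure α}
    (f : α → E) : eLpNorm f 2 μ ^ 2 = ∫⁻ x, ‖f x‖ₑ ^ 2 ∂μ := by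
  have := eLpNorm_nnreal_pow_eq_lintegral (f := f) (μ := μ) (p := 2) two_ne_zero
  norm_cast at this
  simpa using this

/-- On a probability space the `L¹` norm is at most the `L²` norm. It is applied to the unit
interval, in the trace inequality, and to the measure whose density is a mollifier. -/
theorem lintegral_enorm_sq_le {α : Type*} [MeasurableSpace α] {μ : Measure α}
    [IsProbabilityMeasure μ] {E : Type*} [NormedAddCommGroup E] {f : α → E}
    (hf : AEStronglyMeasurable f μ) : (∫⁻ x, ‖f x‖ₑ ∂μ) ^ 2 ≤ ∫⁻ x, ‖f x‖ₑ ^ 2 ∂μ := by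
  rw [← eLpNorm_two_sq, ← eLpNorm_one_eq_lintegral_enorm]
  gcongr
  exact eLpNorm_le_eLpNorm_of_exponent_le one_le_two hf

/-- The image measure is a Haar measure, hence a multiple of Lebesgue measure; only the finiteness
of the factor matters, so the Jacobian is not computed. -/
theorem exists_map_frame_eq_smul {d e : Plane} (h : d 0 * e 1 - d 1 * e 0 ≠ 0) :
    ∃ c : ℝ≥0∞, c ≠ ⊤ ∧ (volume : Measure (ℝ × ℝ)).map (frame d e h) = c • volume := by
  have : ((volume : Measure (ℝ × ℝ)).map (frame d e h)).IsAddHaarMeasure :=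
    (frame d e h).isAddHaarMeasure_map _
  exact ⟨_, ENNReal.coe_ne_top, Measure.isAddLeftInvariant_eq_smul _ _⟩

theorem fderiv_apply_eq_pderiv (φ : Plane → ℂ) (x e : Plane) :
    fderiv ℝ φ x e = e 0 * pderiv 0 φ x + e 1 * pderiv 1 φ x := by
  have : e = e 0 • EuclideanSpace.single 0 (1 : ℝ) + e 1 • EuclideanSpace.single 1 (1 : ℝ) := by
    ext i; fin_cases i <;> simp
  conv_lhs => rw [this]
  simp [pderiv]

/-- By the fundamental theorem of calculus the value at `y` is bounded by the value at `y + t e`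
plus the integral of the directional derivative, and averaging over `t` in the unit interval removes
the dependence on `t`. -/
theorem norm_le_integral_segment {φ : Plane → ℂ} (hφ : ContDiff ℝ ∞ φ) (y e : Plane) :
    ‖φ y‖ₑ ≤ ∫⁻ t in Ioo (0 : ℝ) 1, ‖‖φ (y + t • e)‖ + ‖fderiv ℝ φ (y + t • e) e‖‖ₑ := by
  have hd : ∀ t : ℝ, HasDerivAt (fun t : ℝ => φ (y + t • e)) (fderiv ℝ φ (y + t • e) e) t := by
    intro t
    have h1 : HasDerivAt (fun t : ℝ => y + t • e) e t := by
      simpa using ((hasDerivAt_id t).smul_const e).const_add y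
    exact (hφ.differentiable (by simp) _).hasFDerivAt.comp_hasDerivAt t h1
  have hcont : Continuous fun t : ℝ => fderiv ℝ φ (y + t • e) e := by
    have := (hφ.continuous_fderiv (by simp))
    fun_prop
  have hφc := hφ.continuous
  have hint : ∀ a b, IntervalIntegrable (fun t : ℝ => ‖fderiv ℝ φ (y + t • e) e‖) volume a b :=
    fun a b => hcont.norm.intervalIntegrable _ _
  have key : ∀ t ∈ Icc (0 : ℝ) 1,
      ‖φ y‖ ≤ ‖φ (y + t • e)‖ + ∫ r in (0 : ℝ)..1, ‖fderiv ℝ φ (y + r • e) e‖ := by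
    intro t ht
    have h1 := intervalIntegral.integral_eq_sub_of_hasDerivAt (fun r _ => hd r)
      (hcont.intervalIntegrable 0 t)
    simp only [zero_smul, add_zero] at h1
    have h2 : ‖∫ r in (0 : ℝ)..t, fderiv ℝ φ (y + r • e) e‖
        ≤ ∫ r in (0 : ℝ)..1, ‖fderiv ℝ φ (y + r • e) e‖ := by
      refine (intervalIntegral.norm_integral_le_integral_norm ht.1).trans ?_
      exact intervalIntegral.integral_mono_interval le_rfl ht.1 ht.2
        (Eventually.of_forall fun _ => norm_nonneg _) (hint 0 1)
    have h3 : φ y = φ (y + t • e) - ∫ r in (0 : ℝ)..t, fderiv ℝ φ (y + r • e) e := by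
      rw [h1]; ring
    rw [h3]
    exact (norm_sub_le _ _).trans (by gcongr)
  have hG : Continuous fun t : ℝ => ‖φ (y + t • e)‖ + ‖fderiv ℝ φ (y + t • e) e‖ := by
    fun_prop
  have h4 : ‖φ y‖ ≤ ∫ t in (0 : ℝ)..1, (‖φ (y + t • e)‖ + ‖fderiv ℝ φ (y + t • e) e‖) := by
    rw [intervalIntegral.integral_add ((by fun_prop : Continuous fun t : ℝ =>
      ‖φ (y + t • e)‖).intervalIntegrable _ _) (hint 0 1)]
    have h5 : ∫ _ in (0 : ℝ)..1, (‖φ y‖ - ∫ r in (0 : ℝ)..1, ‖fderiv ℝ φ (y + r • e) e‖)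
        ≤ ∫ t in (0 : ℝ)..1, ‖φ (y + t • e)‖ := by
      refine intervalIntegral.integral_mono_on zero_le_one
        (continuous_const.intervalIntegrable _ _)
        ((by fun_prop : Continuous fun t : ℝ => ‖φ (y + t • e)‖).intervalIntegrable _ _) ?_
      intro t ht
      linarith [key t ht]
    simp only [intervalIntegral.integral_const, sub_zero, one_smul] at h5
    linarith
  rw [intervalIntegral.integral_of_le zero_le_one, integral_Ioc_eq_integral_Ioo] at h4
  have hnn : ∀ t : ℝ, 0 ≤ ‖φ (y + t • e)‖ + ‖fderiv ℝ φ (y + t • e) e‖ := fun t => by positivity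
  calc ‖φ y‖ₑ = ENNReal.ofReal ‖φ y‖ := (ofReal_norm _).symm
    _ ≤ ENNReal.ofReal _ := ENNReal.ofReal_le_ofReal h4
    _ = ∫⁻ t in Ioo (0 : ℝ) 1,
          ENNReal.ofReal (‖φ (y + t • e)‖ + ‖fderiv ℝ φ (y + t • e) e‖) := by
        refine ofReal_integral_eq_lintegral_ofReal ?_ (Eventually.of_forall hnn)
        exact (hG.integrableOn_Icc (a := 0) (b := 1)).mono_set Ioo_subset_Icc_self
    _ = _ := by
        refine lintegral_congr fun t => ?_
        rw [← ofReal_norm, Real.norm_of_nonneg (hnn t)]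

/-- The sum of the `L²` norms of a smooth function and of its partial derivatives. -/
noncomputable def sobolevNorm (K : Set Plane) (φ : Plane → ℂ) : ℝ≥0∞ :=
  eLpNorm φ 2 (volume.restrict K) + eLpNorm (pderiv 0 φ) 2 (volume.restrict K)
    + eLpNorm (pderiv 1 φ) 2 (volume.restrict K)

/-- Square the segment estimate with `lintegral_enorm_sq_le`, integrate along the boundary segment,
and change variables: the double integral is over a parallelogram contained in `K`, so it is
controlled by `φ` and its derivative in the direction `e`. -/
theorem BoundaryChart.trace_le {K : Set Plane} {p d e : Plane} {ℓ : ℝ}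
    (h : BoundaryChart K p d e ℓ) (hK : MeasurableSet K) :
    ∃ C : ℝ≥0∞, C ≠ ⊤ ∧ ∀ φ : Plane → ℂ, ContDiff ℝ ∞ φ →
      eLpNorm φ 2 (μH[1].restrict ((fun s : ℝ => p + s • d) '' Ioo 0 ℓ))
        ≤ C * sobolevNorm K φ := by
  obtain ⟨c, hc, hmap⟩ := exists_map_frame_eq_smul h.det
  have hc' : c ^ (1 / 2 : ℝ) ≠ ⊤ := ENNReal.rpow_ne_top_of_nonneg (by norm_num) hc
  refine ⟨c ^ (1 / 2 : ℝ) * (1 + ‖e 0‖ₑ + ‖e 1‖ₑ),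
    ENNReal.mul_ne_top hc' (by finiteness), fun φ hφ => ?_⟩
  set G : Plane → ℝ := fun y => ‖φ y‖ + ‖fderiv ℝ φ y e‖ with hG
  have hGc : Continuous G := by
    have h1 := hφ.continuous
    have h2 := hφ.continuous_fderiv (by simp)
    fun_prop
  have : IsProbabilityMeasure ((volume : Measure ℝ).restrict (Ioo (0 : ℝ) 1)) := ⟨by simp⟩
  set Φ : ℝ × ℝ → Plane := fun q => p + frame d e h.det q with hΦ
  have hΦm : Measurable Φ := by fun_prop
  have hΦmap : (volume : Measure (ℝ × ℝ)).map Φ = c • volume := by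
    have : Φ = (fun y => p + y) ∘ frame d e h.det := rfl
    rw [this, ← Measure.map_map (measurable_const_add p) (by fun_prop), hmap, Measure.map_smul,
      map_add_left_eq_self]
  have hsq : eLpNorm φ 2 (μH[1].restrict ((fun s : ℝ => p + s • d) '' Ioo 0 ℓ)) ^ 2
      ≤ c * eLpNorm G 2 (volume.restrict K) ^ 2 := by
    rw [eLpNorm_two_sq, eLpNorm_two_sq, ← map_volume_restrict_of_isometry (isometry_line p h.norm_d),
      lintegral_map (by have := hφ.continuous; fun_prop) (isometry_line p h.norm_d).continuous.measurable]
    calc ∫⁻ s in Ioo 0 ℓ, ‖φ (p + s • d)‖ₑ ^ 2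
        ≤ ∫⁻ s in Ioo 0 ℓ, ∫⁻ t in Ioo (0 : ℝ) 1, ‖G (Φ (s, t))‖ₑ ^ 2 := by
          refine lintegral_mono fun s => ?_
          refine le_trans ?_ (lintegral_enorm_sq_le (by fun_prop))
          gcongr
          have := norm_le_integral_segment hφ (p + s • d) e
          simpa [hΦ, frame_apply, add_assoc, hG] using this
      _ = ∫⁻ q in Ioo 0 ℓ ×ˢ Ioo (0 : ℝ) 1, ‖G (Φ q)‖ₑ ^ 2 := by
          rw [Measure.volume_eq_prod, ← Measure.prod_restrict, lintegral_prod]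
          exact ((hGc.measurable.comp hΦm).enorm.pow_const 2).aemeasurable
      _ = ∫⁻ y, ‖G y‖ₑ ^ 2 ∂((volume.restrict (Ioo 0 ℓ ×ˢ Ioo (0 : ℝ) 1)).map Φ) := by
          rw [lintegral_map (by fun_prop) hΦm]
      _ ≤ ∫⁻ y, ‖G y‖ₑ ^ 2 ∂(c • volume.restrict K) := by
          refine lintegral_mono' ?_ le_rfl
          rw [← Measure.restrict_smul, ← hΦmap, Measure.restrict_map hΦm hK]
          refine Measure.map_mono (Measure.restrict_mono_set _ ?_) hΦm
          rintro ⟨s, t⟩ ⟨hs, ht⟩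
          change p + frame d e h.det (s, t) ∈ K
          rw [frame_apply, ← add_assoc]
          exact h.mem s hs t ht
      _ = _ := by rw [lintegral_smul_measure, smul_eq_mul]
  have h1 : eLpNorm φ 2 (μH[1].restrict ((fun s : ℝ => p + s • d) '' Ioo 0 ℓ))
      ≤ c ^ (1 / 2 : ℝ) * eLpNorm G 2 (volume.restrict K) := by
    rw [← ENNReal.pow_le_pow_left_iff two_ne_zero, mul_pow]
    refine hsq.trans (le_of_eq ?_)
    rw [← ENNReal.rpow_natCast (c ^ (1 / 2 : ℝ)) 2, ← ENNReal.rpow_mul]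
    norm_num
  have h2 : eLpNorm G 2 (volume.restrict K) ≤ (1 + ‖e 0‖ₑ + ‖e 1‖ₑ) * sobolevNorm K φ := by
    have hp := fun i => (contDiff_pderiv hφ i).continuous
    have hG' : eLpNorm G 2 (volume.restrict K) ≤ eLpNorm (fun y => ‖φ y‖
        + (‖(e 0 : ℂ) * pderiv 0 φ y‖ + ‖(e 1 : ℂ) * pderiv 1 φ y‖)) 2 (volume.restrict K) := by
      refine eLpNorm_mono_real fun y => ?_
      rw [Real.norm_of_nonneg (by positivity)]
      simp only [hG]
      gcongr
      rw [fderiv_apply_eq_pderiv]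
      exact norm_add_le _ _
    refine hG'.trans ((eLpNorm_add_le (hφ.continuous.norm.aestronglyMeasurable)
      (by fun_prop) one_le_two).trans ?_)
    refine (add_le_add_right (eLpNorm_add_le (by fun_prop) (by fun_prop) one_le_two) _).trans ?_
    rw [eLpNorm_norm, eLpNorm_norm, eLpNorm_norm]
    have hm : ∀ i, eLpNorm (fun y => (e i : ℂ) * pderiv i φ y) 2 (volume.restrict K)
        = ‖e i‖ₑ * eLpNorm (pderiv i φ) 2 (volume.restrict K) := by
      intro i
      have := eLpNorm_const_smul (e i : ℂ) (pderiv i φ) 2 (volume.restrict K)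
      have he : ‖(e i : ℂ)‖ₑ = ‖e i‖ₑ := by
        rw [← ofReal_norm, ← ofReal_norm, Complex.norm_real]
      rw [he] at this
      exact this
    rw [hm, hm]
    unfold sobolevNorm
    set A := eLpNorm φ 2 (volume.restrict K)
    set B := eLpNorm (pderiv 0 φ) 2 (volume.restrict K)
    set D := eLpNorm (pderiv 1 φ) 2 (volume.restrict K)
    calc A + (‖e 0‖ₑ * B + ‖e 1‖ₑ * D)
        ≤ 1 * (A + B + D) + ‖e 0‖ₑ * (A + B + D) + ‖e 1‖ₑ * (A + B + D) := by
          rw [one_mul, add_assoc]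
          refine add_le_add ?_ (add_le_add (mul_le_mul_right ?_ _) (mul_le_mul_right ?_ _))
          · rw [add_assoc]; exact le_self_add
          · rw [add_comm A, add_assoc]; exact le_self_add
          · exact le_add_self
      _ = _ := by ring
  calc _ ≤ _ := h1
    _ ≤ _ := by
      rw [mul_assoc]
      gcongr

theorem eLpNorm_restrict_union_le {μ : Measure Plane} (A B : Set Plane) (φ : Plane → ℂ) :
    eLpNorm φ 2 (μ.restrict (A ∪ B)) ≤ eLpNorm φ 2 (μ.restrict A) + eLpNorm φ 2 (μ.restrict B) := by
  rw [← ENNReal.pow_le_pow_left_iff two_ne_zero, eLpNorm_two_sq]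
  refine (lintegral_union_le _ A B).trans ?_
  rw [← eLpNorm_two_sq, ← eLpNorm_two_sq]
  set a := eLpNorm φ 2 (μ.restrict A)
  set b := eLpNorm φ 2 (μ.restrict B)
  calc a ^ 2 + b ^ 2 ≤ a ^ 2 + b ^ 2 + 2 * a * b := le_self_add
    _ = (a + b) ^ 2 := by ring

/-- The trace inequality for smooth functions on a convex polygon. -/
theorem exists_trace_le (V : Finset Plane)
    (hV : (interior (convexHull ℝ (V : Set Plane))).Nonempty) :
    ∃ C : ℝ≥0∞, C ≠ ⊤ ∧ ∀ φ : Plane → ℂ, ContDiff ℝ ∞ φ →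
      eLpNorm φ 2 (μH[1].restrict (frontier (interior (convexHull ℝ (V : Set Plane)))))
        ≤ C * sobolevNorm (interior (convexHull ℝ (V : Set Plane))) φ := by
  classical
  obtain ⟨T, E, hT, hcov⟩ := exists_boundaryChart_cover V hV
  set K := interior (convexHull ℝ (V : Set Plane)) with hK
  have hKm : MeasurableSet K := isOpen_interior.measurableSet
  have hE : ∀ φ : Plane → ℂ, eLpNorm φ 2 (μH[1].restrict (E : Set Plane)) = 0 := by
    intro φ
    have := Measure.nullSingletonClass_hausdorff Plane one_pos
    rw [Measure.restrict_eq_zero.2 (E.finite_toSet.measure_zero _)]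
    simp
  suffices h : ∀ S ⊆ T, ∃ C : ℝ≥0∞, C ≠ ⊤ ∧ ∀ φ : Plane → ℂ, ContDiff ℝ ∞ φ →
      eLpNorm φ 2 (μH[1].restrict
        (⋃ q ∈ S, (fun s : ℝ => q.1 + s • q.2.1) '' Ioo 0 q.2.2.2)) ≤ C * sobolevNorm K φ by
    obtain ⟨C, hC, h⟩ := h T subset_rfl
    refine ⟨C, hC, fun φ hφ => ?_⟩
    calc _ ≤ _ := eLpNorm_mono_measure φ (Measure.restrict_mono_set _ hcov)
      _ ≤ _ := eLpNorm_restrict_union_le _ _ _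
      _ ≤ _ := by rw [hE, zero_add]; exact h φ hφ
  intro S
  induction S using Finset.induction_on with
  | empty => exact fun _ => ⟨0, by simp, fun φ _ => by simp⟩
  | insert q S hq ih =>
    intro hS
    obtain ⟨C, hC, h⟩ := ih ((Finset.subset_insert _ _).trans hS)
    obtain ⟨C', hC', h'⟩ := (hT q (hS (Finset.mem_insert_self _ _))).trace_le hKm
    refine ⟨C' + C, by finiteness, fun φ hφ => ?_⟩
    rw [Finset.set_biUnion_insert]
    calc _ ≤ _ := eLpNorm_restrict_union_le _ _ _
      _ ≤ _ := add_le_add (h' φ hφ) (h φ hφ)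
      _ = _ := by rw [add_mul]

open scoped Convolution


/-! ### Density of smooth functions in `H¹` of a convex set -/

/-- Convolution with a normalized bump averages over a probability measure, so the square of the
average is at most the average of the square; Tonelli and translation invariance finish. -/
theorem eLpNorm_normed_convolution_le (ψ : ContDiffBump (0 : Plane)) {F : Plane → ℂ}
    (hF : MemLp F 2 volume) :
    eLpNorm (ψ.normed volume ⋆[ContinuousLinearMap.lsmul ℝ ℝ] F) 2 volume ≤ eLpNorm F 2 volume := by
  -- Tonelli requires measurability of `F (x - t)` jointly in both variables, so `F` is replaced by
  -- a strongly measurable representative.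
  obtain ⟨F', hF', hFF'⟩ := hF.1
  rw [convolution_congr _ (EventuallyEq.refl _ _) hFF', eLpNorm_congr_ae hFF']
  set w : Plane → ℝ≥0∞ := fun t => ENNReal.ofReal (ψ.normed volume t) with hw
  have hwm : Measurable w := by
    have := ψ.continuous_normed (μ := volume)
    fun_prop
  have : IsProbabilityMeasure (volume.withDensity w) := by
    refine ⟨?_⟩
    rw [withDensity_apply _ MeasurableSet.univ, Measure.restrict_univ,
      ← ofReal_integral_eq_lintegral_ofReal ψ.integrable_normed
        (Eventually.of_forall ψ.nonneg_normed), ψ.integral_normed, ENNReal.ofReal_one]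
  have hm : ∀ x, Measurable fun t => F' (x - t) := fun x =>
    hF'.measurable.comp (measurable_const.sub measurable_id)
  rw [← ENNReal.pow_le_pow_left_iff two_ne_zero, eLpNorm_two_sq, eLpNorm_two_sq]
  calc ∫⁻ x, ‖(ψ.normed volume ⋆[ContinuousLinearMap.lsmul ℝ ℝ] F') x‖ₑ ^ 2
      ≤ ∫⁻ x, ∫⁻ t, w t * ‖F' (x - t)‖ₑ ^ 2 := by
        refine lintegral_mono fun x => ?_
        have h1 : ‖(ψ.normed volume ⋆[ContinuousLinearMap.lsmul ℝ ℝ] F') x‖ₑ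
            ≤ ∫⁻ t, ‖F' (x - t)‖ₑ ∂(volume.withDensity w) := by
          rw [lintegral_withDensity_eq_lintegral_mul _ hwm (hm x).enorm, convolution_def]
          refine (enorm_integral_le_lintegral_enorm _).trans (le_of_eq ?_)
          refine lintegral_congr fun t => ?_
          simp only [ContinuousLinearMap.lsmul_apply, Pi.mul_apply, enorm_smul, hw]
          rw [Real.enorm_of_nonneg (ψ.nonneg_normed t)]
        calc _ ≤ (∫⁻ t, ‖F' (x - t)‖ₑ ∂(volume.withDensity w)) ^ 2 := by gcongr
          _ ≤ ∫⁻ t, ‖F' (x - t)‖ₑ ^ 2 ∂(volume.withDensity w) :=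
            lintegral_enorm_sq_le (hm x).aestronglyMeasurable
          _ = _ := by
            rw [lintegral_withDensity_eq_lintegral_mul _ hwm ((hm x).enorm.pow_const 2)]
            rfl
    _ = ∫⁻ t, ∫⁻ x, w t * ‖F' (x - t)‖ₑ ^ 2 := by
        refine lintegral_lintegral_swap ?_
        refine Measurable.aemeasurable ?_
        exact (hwm.comp measurable_snd).mul
          ((hF'.measurable.comp (measurable_fst.sub measurable_snd)).enorm.pow_const 2)
    _ = ∫⁻ t, w t * ∫⁻ x, ‖F' x‖ₑ ^ 2 := by
        refine lintegral_congr fun t => ?_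
        rw [lintegral_const_mul' _ _ ENNReal.ofReal_ne_top,
          lintegral_sub_right_eq_self (fun x => ‖F' x‖ₑ ^ 2) t]
    _ = _ := by
        rw [lintegral_mul_const _ hwm]
        have h1 : ∫⁻ t, w t = 1 := by
          have := measure_univ (μ := volume.withDensity w)
          rwa [withDensity_apply _ MeasurableSet.univ, Measure.restrict_univ] at this
        rw [h1, one_mul]

/-- The contraction by `1 - δ` multiplies the square of the norm by `(1 - δ)⁻²`, which is at most
`4` when `δ ≤ 1 / 2`; the constant `2` is its square root. -/
theorem eLpNorm_comp_homothety_le {g : Plane → ℂ} (hg : Continuous g) (c : Plane) {δ : ℝ}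
    (hδ : δ ≤ 1 / 2) :
    eLpNorm (fun x => g ((1 - δ) • x + δ • c)) 2 volume ≤ 2 * eLpNorm g 2 volume := by
  have h1 : (1 / 2 : ℝ) ≤ 1 - δ := by linarith
  have hne : (1 - δ) ≠ 0 := by linarith
  rw [← ENNReal.pow_le_pow_left_iff two_ne_zero, mul_pow, eLpNorm_two_sq, eLpNorm_two_sq]
  have hm : (volume : Measure Plane).map (fun x => (1 - δ) • x + δ • c)
      = ENNReal.ofReal |((1 - δ) ^ 2)⁻¹| • volume := by
    have : (fun x : Plane => (1 - δ) • x + δ • c) = (fun x => x + δ • c) ∘ fun x => (1 - δ) • x :=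
      rfl
    rw [this, ← Measure.map_map (measurable_add_const _) (measurable_const_smul _),
      Measure.map_addHaar_smul _ hne, Measure.map_smul, map_add_right_eq_self]
    simp
  have hm2 : Measurable fun x : Plane => (1 - δ) • x + δ • c := by fun_prop
  have := lintegral_map (μ := volume) ((hg.measurable).enorm.pow_const 2) hm2
  rw [← this, hm, lintegral_smul_measure, smul_eq_mul]
  gcongr
  have h4 : ENNReal.ofReal |((1 - δ) ^ 2)⁻¹| ≤ ENNReal.ofReal 4 := by
    refine ENNReal.ofReal_le_ofReal ?_
    rw [abs_of_nonneg (by positivity)]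
    refine inv_le_of_inv_le₀ (by norm_num) ?_
    nlinarith
  refine h4.trans (le_of_eq ?_)
  norm_num

/-- A bump function of radius `δ r`, where `δ = 1 / (j + 2)`. -/
noncomputable def dilatedBump {r : ℝ} (hr : 0 < r) (j : ℕ) : ContDiffBump (0 : Plane) where
  rIn := (1 / ((j : ℝ) + 2)) * r / 2
  rOut := (1 / ((j : ℝ) + 2)) * r
  rIn_pos := by positivity
  rIn_lt_rOut := half_lt_self (by positivity)

/-- Dilation about `c` followed by mollification: the value at `x` averages `F` over the ball of
radius `δ r` about `(1 - δ) x + δ c`, where `δ = 1 / (j + 2)`. -/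
noncomputable def dilatedMollify {r : ℝ} (hr : 0 < r) (c : Plane) (j : ℕ) (F : Plane → ℂ)
    (x : Plane) : ℂ :=
  ((dilatedBump hr j).normed volume ⋆[ContinuousLinearMap.lsmul ℝ ℝ] F)
    ((1 - 1 / ((j : ℝ) + 2)) • x + (1 / ((j : ℝ) + 2)) • c)

theorem contDiff_normed_convolution (ψ : ContDiffBump (0 : Plane)) {F : Plane → ℂ}
    (hF : LocallyIntegrable F volume) :
    ContDiff ℝ ∞ (ψ.normed volume ⋆[ContinuousLinearMap.lsmul ℝ ℝ] F) :=
  ψ.hasCompactSupport_normed.contDiff_convolution_left _ ψ.contDiff_normed hF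

theorem contDiff_dilatedMollify {r : ℝ} (hr : 0 < r) (c : Plane) (j : ℕ) {F : Plane → ℂ}
    (hF : LocallyIntegrable F volume) : ContDiff ℝ ∞ (dilatedMollify hr c j F) :=
  (contDiff_normed_convolution _ hF).comp
    (by fun_prop : ContDiff ℝ ∞ fun x : Plane =>
      (1 - 1 / ((j : ℝ) + 2)) • x + (1 / ((j : ℝ) + 2)) • c)

theorem one_div_add_two_le (j : ℕ) : 1 / ((j : ℝ) + 2) ≤ 1 / 2 :=
  one_div_le_one_div_of_le (by norm_num) (by linarith [(Nat.cast_nonneg j : (0 : ℝ) ≤ j)])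

theorem tendsto_one_div_add_two : Tendsto (fun j : ℕ => 1 / ((j : ℝ) + 2)) atTop (𝓝 0) := by
  have h := tendsto_one_div_add_atTop_nhds_zero_nat (𝕜 := ℝ)
  have h2 := (tendsto_add_atTop_iff_nat 1).2 h
  refine h2.congr fun j => ?_
  push_cast
  ring

theorem eLpNorm_dilatedMollify_le {r : ℝ} (hr : 0 < r) (c : Plane) (j : ℕ) {F : Plane → ℂ}
    (hF : MemLp F 2 volume) :
    eLpNorm (dilatedMollify hr c j F) 2 volume ≤ 2 * eLpNorm F 2 volume := by
  refine (eLpNorm_comp_homothety_le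
    (contDiff_normed_convolution (dilatedBump hr j) (hF.locallyIntegrable one_le_two)).continuous
    c (one_div_add_two_le j)).trans ?_
  gcongr
  exact eLpNorm_normed_convolution_le _ hF

theorem dilatedMollify_sub {r : ℝ} (hr : 0 < r) (c : Plane) (j : ℕ) {F G : Plane → ℂ}
    (hF : LocallyIntegrable F volume) (hG : LocallyIntegrable G volume) (x : Plane) :
    dilatedMollify hr c j (F - G) x = dilatedMollify hr c j F x - dilatedMollify hr c j G x := by
  have hex : ∀ H : Plane → ℂ, LocallyIntegrable H volume → ConvolutionExists
      ((dilatedBump hr j).normed volume) H (ContinuousLinearMap.lsmul ℝ ℝ) volume := fun H hH =>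
    (dilatedBump hr j).hasCompactSupport_normed.convolutionExists_left _
      (dilatedBump hr j).continuous_normed hH
  unfold dilatedMollify
  simp only [convolution_def, Pi.sub_apply, map_sub]
  exact integral_sub (hex F hF _) (hex G hG _)

/-- The operators are bounded on `L²` uniformly in `j`, by `2`, so it is enough to treat a
continuous `g` with compact support. With `F` within `ε / 4` of `g`, the three errors add up to `2
(ε / 4) + ε / 4 + ε / 4 = ε`. -/
theorem tendsto_dilatedMollify {r : ℝ} (hr : 0 < r) (c : Plane) {F : Plane → ℂ}
    (hF : MemLp F 2 volume) {K : Set Plane} (hK : MeasurableSet K)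
    (hb : Bornology.IsBounded K) :
    Tendsto (fun j => eLpNorm (fun x => dilatedMollify hr c j F x - F x) 2 (volume.restrict K))
      atTop (𝓝 0) := by
  rw [ENNReal.tendsto_nhds_zero]
  intro ε hε
  obtain ⟨g, hgc, hFg, hg, hg2⟩ := hF.exists_hasCompactSupport_eLpNorm_sub_le (by simp)
    (ε := ε / 4) (by simpa using hε.ne')
  obtain ⟨R, hR⟩ := hb.subset_closedBall c
  have hR' : K ⊆ Metric.closedBall c (max R 1) :=
    hR.trans (Metric.closedBall_subset_closedBall (le_max_left _ _))
  set S := max R 1 with hS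
  have hS1 : 0 < S := lt_of_lt_of_le one_pos (le_max_right _ _)
  have hvol : volume K ≠ ⊤ := hb.measure_lt_top.ne
  have hmid : Tendsto (fun j => eLpNorm (fun x => dilatedMollify hr c j g x - g x) 2
      (volume.restrict K)) atTop (𝓝 0) := by
    have huc : UniformContinuous g := hgc.uniformContinuous_of_continuous hg
    rw [Metric.uniformContinuous_iff] at huc
    -- Uniform continuity of `g` is used twice, once for the displacement of the centre by `δ (c -
    -- x)` and once for the averaging over a ball of radius `δ r`; hence `2 * η`.
    have hbound : ∀ η : ℝ, 0 < η → ∀ᶠ j in atTop, eLpNorm (fun x => dilatedMollify hr c j g x - g x)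
        2 (volume.restrict K) ≤ volume K ^ (1 / 2 : ℝ) * ENNReal.ofReal (2 * η) := by
      intro η hη
      obtain ⟨ρ, hρ, hgρ⟩ := huc η hη
      have e1 : ∀ᶠ j : ℕ in atTop, 1 / ((j : ℝ) + 2) * r < ρ := by
        have := tendsto_one_div_add_two.mul_const r
        rw [zero_mul] at this
        exact this.eventually (gt_mem_nhds hρ)
      have e2 : ∀ᶠ j : ℕ in atTop, 1 / ((j : ℝ) + 2) * S < ρ := by
        have := tendsto_one_div_add_two.mul_const S
        rw [zero_mul] at this
        exact this.eventually (gt_mem_nhds hρ)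
      filter_upwards [e1, e2] with j h1 h2
      have hbd : ∀ᵐ x ∂(volume.restrict K), ‖dilatedMollify hr c j g x - g x‖ ≤ 2 * η := by
        filter_upwards [ae_restrict_mem hK] with x hx
        have hx' := hR' hx
        rw [Metric.mem_closedBall, dist_eq_norm] at hx'
        set y := (1 - 1 / ((j : ℝ) + 2)) • x + (1 / ((j : ℝ) + 2)) • c with hy
        have hxy : dist y x < ρ := by
          have : y - x = (1 / ((j : ℝ) + 2)) • (c - x) := by rw [hy]; module
          rw [dist_eq_norm, this, norm_smul, Real.norm_of_nonneg (by positivity), norm_sub_rev]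
          exact (mul_le_mul_of_nonneg_left hx' (by positivity)).trans_lt h2
        have hmoll : dist (dilatedMollify hr c j g x) (g y) ≤ η := by
          refine ContDiffBump.dist_normed_convolution_le hg.aestronglyMeasurable fun z hz => ?_
          exact (hgρ ((Metric.mem_ball.1 hz).trans h1)).le
        rw [← dist_eq_norm]
        calc _ ≤ dist (dilatedMollify hr c j g x) (g y) + dist (g y) (g x) := dist_triangle _ _ _
          _ ≤ η + η := add_le_add hmoll (hgρ hxy).le
          _ = 2 * η := by ring
      have := eLpNorm_le_of_ae_bound (p := 2) hbd
      simpa using this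
    rw [ENNReal.tendsto_nhds_zero]
    intro κ hκ
    have hlim : Tendsto (fun η : ℝ => volume K ^ (1 / 2 : ℝ) * ENNReal.ofReal (2 * η)) (𝓝[>] 0)
        (𝓝 0) := by
      have h1 : Tendsto (fun η : ℝ => ENNReal.ofReal (2 * η)) (𝓝[>] 0) (𝓝 0) := by
        have h0 : Tendsto (fun η : ℝ => 2 * η) (𝓝[>] 0) (𝓝 0) := by
          have : Tendsto (fun η : ℝ => 2 * η) (𝓝 0) (𝓝 (2 * 0)) := (continuous_const_mul 2).tendsto 0
          rw [mul_zero] at this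
          exact this.mono_left nhdsWithin_le_nhds
        simpa using ENNReal.tendsto_ofReal h0
      simpa using ENNReal.Tendsto.const_mul h1
        (Or.inr (ENNReal.rpow_ne_top_of_nonneg (by norm_num) hvol))
    obtain ⟨η, hη1, hη2⟩ := ((hlim.eventually (ge_mem_nhds hκ)).and self_mem_nhdsWithin).exists
    filter_upwards [hbound η hη2] with j hj
    exact hj.trans hη1
  rw [ENNReal.tendsto_nhds_zero] at hmid
  have hε4 : 0 < ε / 4 := ENNReal.div_pos hε.ne' (by simp)
  filter_upwards [hmid (ε / 4) hε4] with j hj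
  have hFl := hF.locallyIntegrable one_le_two
  have hgl := hg2.locallyIntegrable one_le_two
  have hdiff : MemLp (F - g) 2 volume := hF.sub hg2
  have e : (fun x => dilatedMollify hr c j F x - F x) = (dilatedMollify hr c j (F - g)
      + fun x => dilatedMollify hr c j g x - g x) - (F - g) := by
    ext x
    simp only [Pi.sub_apply, Pi.add_apply, dilatedMollify_sub hr c j hFl hgl]
    ring
  have m1 : AEStronglyMeasurable (dilatedMollify hr c j (F - g)) (volume.restrict K) :=
    (contDiff_dilatedMollify hr c j (hdiff.locallyIntegrable one_le_two)).continuous.aestronglyMeasurable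
  have m2 : AEStronglyMeasurable (fun x => dilatedMollify hr c j g x - g x)
      (volume.restrict K) :=
    ((contDiff_dilatedMollify hr c j hgl).continuous.sub hg).aestronglyMeasurable
  have m3 : AEStronglyMeasurable (F - g) (volume.restrict K) := hdiff.1.restrict
  rw [e]
  calc _ ≤ eLpNorm (dilatedMollify hr c j (F - g) + fun x => dilatedMollify hr c j g x - g x) 2
        (volume.restrict K) + eLpNorm (F - g) 2 (volume.restrict K) :=
        eLpNorm_sub_le (m1.add m2) m3 one_le_two
    _ ≤ (eLpNorm (dilatedMollify hr c j (F - g)) 2 (volume.restrict K)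
        + eLpNorm (fun x => dilatedMollify hr c j g x - g x) 2 (volume.restrict K))
        + eLpNorm (F - g) 2 (volume.restrict K) := by
        gcongr
        exact eLpNorm_add_le m1 m2 one_le_two
    _ ≤ (2 * (ε / 4) + ε / 4) + ε / 4 := by
        gcongr
        · refine (eLpNorm_mono_measure _ Measure.restrict_le_self).trans
            ((eLpNorm_dilatedMollify_le hr c j hdiff).trans ?_)
          gcongr
        · exact (eLpNorm_mono_measure _ Measure.restrict_le_self).trans hFg
    _ = 4 * (ε / 4) := by ring
    _ = ε := ENNReal.mul_div_cancel (by simp) (by simp)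

theorem fderiv_normed_convolution_apply (ψ : ContDiffBump (0 : Plane)) {F : Plane → ℂ}
    (hF : LocallyIntegrable F volume) (p e : Plane) :
    fderiv ℝ (ψ.normed volume ⋆[ContinuousLinearMap.lsmul ℝ ℝ] F) p e
      = ∫ y, fderiv ℝ (ψ.normed volume) (p - y) e • F y := by
  rw [(ψ.hasCompactSupport_normed.hasFDerivAt_convolution_left (ContinuousLinearMap.lsmul ℝ ℝ)
    ψ.contDiff_normed hF p).fderiv, convolution_eq_swap]
  have hint : Integrable (fun t => (ContinuousLinearMap.precompL Plane
      (ContinuousLinearMap.lsmul ℝ ℝ : ℝ →L[ℝ] ℂ →L[ℝ] ℂ)) (fderiv ℝ (ψ.normed volume) (p - t))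
        (F t)) volume := by
    have h1 : ContDiff ℝ 1 (ψ.normed (volume : Measure Plane)) := ψ.contDiff_normed
    exact ((ψ.hasCompactSupport_normed.fderiv ℝ).convolutionExists_left
      (ContinuousLinearMap.precompL Plane (ContinuousLinearMap.lsmul ℝ ℝ : ℝ →L[ℝ] ℂ →L[ℝ] ℂ))
      (h1.continuous_fderiv one_ne_zero) hF p).integrable_swap
  rw [ContinuousLinearMap.integral_apply hint]
  rfl

/-- Convexity places the ball of radius `δ r` about `(1 - δ) x + δ c` inside `K`. The translated
kernel is therefore a test function in `K`, and its derivative can be moved onto `v` as the weak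
gradient, even though the extension of `v` by zero need not be in `H¹` of the plane. The factor `1 -
δ` comes from the chain rule. -/
theorem pderiv_dilatedMollify {K : Set Plane} (hK : Convex ℝ K) (hKo : IsOpen K) {r : ℝ}
    (hr : 0 < r) {c : Plane} (hc : Metric.closedBall c r ⊆ K) {v : Plane → ℂ}
    {G : Fin 2 → Plane → ℂ} (hv : MemL2 K v) (hG : IsWeakGrad K v G) (j : ℕ) (i : Fin 2)
    {x : Plane} (hx : x ∈ K) :
    pderiv i (dilatedMollify hr c j (K.indicator v)) x
      = (1 - 1 / ((j : ℝ) + 2) : ℝ) * dilatedMollify hr c j (K.indicator (G i)) x := by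
  have hvl : LocallyIntegrable (K.indicator v) volume :=
    ((memLp_indicator_iff_restrict hKo.measurableSet).2 hv).locallyIntegrable one_le_two
  set ψ := dilatedBump hr j with hψ
  set δ : ℝ := 1 / ((j : ℝ) + 2) with hδ
  have hδ0 : 0 < δ := by positivity
  have hδ1 : δ ≤ 1 / 2 := one_div_add_two_le j
  set p := (1 - δ) • x + δ • c with hp
  set n := ψ.normed (volume : Measure Plane) with hn
  have hnsm : ContDiff ℝ ∞ n := ψ.contDiff_normed
  have hA : HasFDerivAt (fun y : Plane => (1 - δ) • y + δ • c)
      ((1 - δ) • ContinuousLinearMap.id ℝ Plane) x :=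
    ((hasFDerivAt_id x).const_smul (1 - δ)).add_const _
  have hconv := ((contDiff_normed_convolution ψ hvl).differentiable (by simp) p).hasFDerivAt
  have hcomp : HasFDerivAt (dilatedMollify hr c j (K.indicator v)) _ x :=
    HasFDerivAt.comp x hconv hA
  have e1 : pderiv i (dilatedMollify hr c j (K.indicator v)) x
      = (1 - δ : ℝ) * ∫ y, fderiv ℝ n (p - y) (EuclideanSpace.single i 1) • K.indicator v y := by
    unfold pderiv
    rw [hcomp.fderiv, ← fderiv_normed_convolution_apply ψ hvl]
    simp
  set χ : Plane → ℂ := fun y => (n (p - y) : ℂ) with hχ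
  have hχK : IsTestFunction K χ := by
    have hsub : Function.support χ ⊆ Metric.closedBall p ψ.rOut := by
      intro y hy
      have h0 : p - y ∈ Function.support n := by
        intro h0
        apply hy
        simp [hχ, h0]
      rw [hn, ψ.support_normed_eq] at h0
      rw [Metric.mem_closedBall, dist_comm, dist_eq_norm]
      exact (mem_ball_zero_iff.1 h0).le
    have hts : tsupport χ ⊆ Metric.closedBall p ψ.rOut :=
      closure_minimal hsub Metric.isClosed_closedBall
    refine ⟨Complex.ofRealCLM.contDiff.comp (hnsm.comp (contDiff_const.sub contDiff_id)),
      HasCompactSupport.of_support_subset_isCompact (isCompact_closedBall p ψ.rOut) hsub,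
      hts.trans ?_⟩
    intro y hy
    -- This point lies in the ball of radius `r` about `c`, and `y` is the combination of it and `x`
    -- with weights `δ` and `1 - δ`.
    have hy' : c + δ⁻¹ • (y - p) ∈ K := by
      apply hc
      rw [Metric.mem_closedBall, dist_eq_norm, add_sub_cancel_left, norm_smul, norm_inv,
        Real.norm_of_nonneg hδ0.le, inv_mul_le_iff₀ hδ0, ← dist_eq_norm]
      exact hy
    have := hK hx hy' (a := 1 - δ) (b := δ) (by linarith) hδ0.le (by ring)
    convert this using 1
    rw [smul_add, smul_smul, mul_inv_cancel₀ hδ0.ne', one_smul, hp]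
    module
  have e2 : ∀ y, pderiv i χ y = -((fderiv ℝ n (p - y) (EuclideanSpace.single i 1) : ℝ) : ℂ) := by
    intro y
    have h1 : HasFDerivAt (fun y : Plane => p - y) (-ContinuousLinearMap.id ℝ Plane) y :=
      (hasFDerivAt_id y).const_sub p
    have h2 := (hnsm.differentiable (by simp) (p - y)).hasFDerivAt.comp y h1
    have h3 : HasFDerivAt χ _ y := (Complex.ofRealCLM.hasFDerivAt (x := n (p - y))).comp y h2
    unfold pderiv
    rw [h3.fderiv]
    simp
  have hind : ∀ (w : Plane → ℂ) (a : Plane → ℂ), ∫ y, a y * K.indicator w y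
      = ∫ y in K, w y * a y := by
    intro w a
    rw [← integral_indicator hKo.measurableSet]
    refine integral_congr_ae (Eventually.of_forall fun y => ?_)
    by_cases hy : y ∈ K <;> simp [hy, mul_comm]
  have e3 : ∫ y, fderiv ℝ n (p - y) (EuclideanSpace.single i 1) • K.indicator v y
      = ∫ y in K, G i y * χ y := by
    rw [← neg_eq_iff_eq_neg.2 (hG.2 i χ hχK), ← integral_neg]
    simp only [e2, Complex.real_smul]
    rw [hind]
    refine integral_congr_ae (Eventually.of_forall fun y => ?_)
    simp
  have e4 : dilatedMollify hr c j (K.indicator (G i)) x = ∫ y in K, G i y * χ y := by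
    unfold dilatedMollify
    rw [convolution_lsmul_swap, ← hind]
    simp only [Complex.real_smul]
    rfl
  rw [e1, e3, e4]

/-- Smooth functions on the plane are dense in `H¹(K)` for a bounded convex open set `K`. -/
theorem exists_tendstoH1_of_convex {K : Set Plane} (hK : Convex ℝ K) (hKo : IsOpen K)
    (hb : Bornology.IsBounded K) (hne : K.Nonempty) {v : Plane → ℂ} (hv : MemH1 K v) :
    ∃ φ : ℕ → Plane → ℂ, (∀ j, ContDiff ℝ ∞ (φ j)) ∧ TendstoH1 K φ v := by
  obtain ⟨c, hc⟩ := hne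
  obtain ⟨r, hr, hcr⟩ := Metric.nhds_basis_closedBall.mem_iff.1 (hKo.mem_nhds hc)
  have hind : ∀ {w : Plane → ℂ}, MemL2 K w → MemLp (K.indicator w) 2 volume := fun hw =>
    (memLp_indicator_iff_restrict hKo.measurableSet).2 hw
  have hindae : ∀ w : Plane → ℂ, K.indicator w =ᵐ[volume.restrict K] w := fun w =>
    indicator_ae_eq_restrict hKo.measurableSet
  refine ⟨fun j => dilatedMollify hr c j (K.indicator v), fun j =>
    contDiff_dilatedMollify hr c j ((hind hv.1).locallyIntegrable one_le_two), ?_, fun i => ?_⟩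
  · refine (tendsto_dilatedMollify hr c (hind hv.1) hKo.measurableSet hb).congr fun j => ?_
    exact eLpNorm_congr_sub (hindae v) 2
  · have hG := hv.memL2_weakGrad i
    set G := K.indicator (weakGrad K v i) with hGdef
    have hG2 : MemLp G 2 volume := hind hG
    have t1 := tendsto_dilatedMollify hr c hG2 hKo.measurableSet hb
    -- The chain-rule factor `1 - δ` leaves an extra term `δ` times the mollified gradient, which
    -- tends to zero by the uniform `L²` bound.
    have t2 : Tendsto (fun j : ℕ => ‖1 / ((j : ℝ) + 2)‖ₑ * (2 * eLpNorm G 2 volume)) atTop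
        (𝓝 0) := by
      have := (tendsto_one_div_add_two).enorm
      rw [enorm_zero] at this
      simpa using ENNReal.Tendsto.mul_const this
        (Or.inr (ENNReal.mul_ne_top (by simp) hG2.2.ne))
    have t3 := t1.add t2
    rw [add_zero] at t3
    refine tendsto_of_tendsto_of_tendsto_of_le_of_le tendsto_const_nhds t3 (fun _ => zero_le)
      fun j => ?_
    have hmeas : Continuous (dilatedMollify hr c j G) :=
      (contDiff_dilatedMollify hr c j (hG2.locallyIntegrable one_le_two)).continuous
    have e : eLpNorm (fun x => pderiv i (dilatedMollify hr c j (K.indicator v)) x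
        - weakGrad K v i x) 2 (volume.restrict K)
        = eLpNorm ((fun x => dilatedMollify hr c j G x - G x)
          - (1 / ((j : ℝ) + 2)) • dilatedMollify hr c j G) 2 (volume.restrict K) := by
      refine eLpNorm_congr_ae ?_
      filter_upwards [ae_restrict_mem hKo.measurableSet, hindae (weakGrad K v i)] with x hx hx2
      rw [pderiv_dilatedMollify hK hKo hr hcr hv.1 (isWeakGrad_weakGrad hv) j i hx, ← hx2]
      simp only [Pi.sub_apply, Pi.smul_apply, Complex.real_smul]
      push_cast
      ring
    simp only
    rw [e]
    refine (eLpNorm_sub_le (hmeas.aestronglyMeasurable.sub hG2.1.restrict)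
      (hmeas.aestronglyMeasurable.const_smul _) one_le_two).trans ?_
    refine add_le_add_right ?_ _
    rw [eLpNorm_const_smul]
    gcongr
    exact (eLpNorm_mono_measure _ Measure.restrict_le_self).trans
      (eLpNorm_dilatedMollify_le hr c j hG2)

/-! ### Existence and uniqueness of traces -/

theorem integrable_mul_of_L2 {α : Type*} [MeasurableSpace α] {μ : Measure α} {f g : α → ℂ}
    (hf : MemLp f 2 μ) (hg : MemLp g 2 μ) : Integrable (fun x => f x * g x) μ :=
  hf.integrable_mul hg

/-- The `L²(Γ)` norm of smooth functions is controlled by their `H¹(U)` norm. -/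
def TraceBound (U Γ : Set Plane) : Prop :=
  ∃ C : ℝ≥0∞, C ≠ ⊤ ∧ ∀ φ : Plane → ℂ, ContDiff ℝ ∞ φ →
    eLpNorm φ 2 (μH[1].restrict Γ) ≤ C * sobolevNorm U φ

theorem sobolevNorm_mono {U V : Set Plane} (h : U ⊆ V) (φ : Plane → ℂ) :
    sobolevNorm U φ ≤ sobolevNorm V φ := by
  unfold sobolevNorm
  gcongr

theorem TraceBound.mono {U V Γ Γ' : Set Plane} (h : TraceBound U Γ) (hU : U ⊆ V) (hΓ : Γ' ⊆ Γ) :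
    TraceBound V Γ' := by
  obtain ⟨C, hC, h⟩ := h
  refine ⟨C, hC, fun φ hφ => ?_⟩
  calc _ ≤ _ := eLpNorm_mono_measure φ (Measure.restrict_mono_set _ hΓ)
    _ ≤ _ := h φ hφ
    _ ≤ _ := mul_le_mul_right (sobolevNorm_mono hU φ) C

theorem TraceBound.iUnion {ι : Type*} [Finite ι] {U : Set Plane} {Γ : ι → Set Plane}
    (h : ∀ i, TraceBound U (Γ i)) : TraceBound U (⋃ i, Γ i) := by
  classical
  have := Fintype.ofFinite ι
  suffices hs : ∀ S : Finset ι, TraceBound U (⋃ i ∈ S, Γ i) by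
    refine (hs Finset.univ).mono subset_rfl ?_
    simp
  intro S
  induction S using Finset.induction_on with
  | empty => exact ⟨0, by simp, fun φ _ => by simp⟩
  | insert i S hi ih =>
    obtain ⟨C, hC, ih⟩ := ih
    obtain ⟨C', hC', h'⟩ := h i
    refine ⟨C' + C, by finiteness, fun φ hφ => ?_⟩
    rw [Finset.set_biUnion_insert]
    calc _ ≤ _ := eLpNorm_restrict_union_le _ _ _
      _ ≤ _ := add_le_add (h' φ hφ) (ih φ hφ)
      _ = _ := by rw [add_mul]

/-- The filter is arbitrary so that the same statement serves sequences and, for the Cauchy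
property, pairs of indices. -/
theorem TraceBound.tendsto_zero {U Γ : Set Plane} (h : TraceBound U Γ) {ι : Type*} {l : Filter ι}
    {φ : ι → Plane → ℂ} (hφ : ∀ j, ContDiff ℝ ∞ (φ j))
    (h0 : Tendsto (fun j => eLpNorm (φ j) 2 (volume.restrict U)) l (𝓝 0))
    (h1 : ∀ i, Tendsto (fun j => eLpNorm (pderiv i (φ j)) 2 (volume.restrict U)) l (𝓝 0)) :
    Tendsto (fun j => eLpNorm (φ j) 2 (μH[1].restrict Γ)) l (𝓝 0) := by
  obtain ⟨C, hC, h⟩ := h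
  have hs : Tendsto (fun j => C * sobolevNorm U (φ j)) l (𝓝 0) := by
    have := (h0.add (h1 0)).add (h1 1)
    simp only [add_zero] at this
    simpa [sobolevNorm] using ENNReal.Tendsto.const_mul this (Or.inr hC)
  exact tendsto_of_tendsto_of_tendsto_of_le_of_le tendsto_const_nhds hs (fun _ => zero_le)
    fun j => h _ (hφ j)

/-- The traces of two sequences with the same limit in `H¹(U)` are asymptotically equal. -/
theorem TraceBound.tendsto_sub {U Γ : Set Plane} (h : TraceBound U Γ) {φ ψ : ℕ → Plane → ℂ}
    {u : Plane → ℂ} (hu : MemH1 U u) (hφ : ∀ j, ContDiff ℝ ∞ (φ j))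
    (hψ : ∀ j, ContDiff ℝ ∞ (ψ j)) (h1 : TendstoH1 U φ u) (h2 : TendstoH1 U ψ u) :
    Tendsto (fun j => eLpNorm (fun x => φ j x - ψ j x) 2 (μH[1].restrict Γ)) atTop (𝓝 0) := by
  obtain ⟨h0, h1⟩ := h1.sub_tendsto hu hφ hψ h2
  exact h.tendsto_zero (fun j => (hφ j).sub (hψ j)) h0 h1

theorem exists_tendsto_L2_of_cauchy {α : Type*} [MeasurableSpace α] {μ : Measure α}
    {φ : ℕ → α → ℂ} (hφ : ∀ j, MemLp (φ j) 2 μ)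
    (h : Tendsto (fun n : ℕ × ℕ => eLpNorm (fun x => φ n.1 x - φ n.2 x) 2 μ) atTop (𝓝 0)) :
    ∃ τ, MemLp τ 2 μ ∧ Tendsto (fun j => eLpNorm (fun x => φ j x - τ x) 2 μ) atTop (𝓝 0) := by
  have : Fact ((1 : ℝ≥0∞) ≤ 2) := ⟨one_le_two⟩
  set f : ℕ → Lp ℂ 2 μ := fun j => (hφ j).toLp (φ j) with hf
  have hc : CauchySeq f := by
    rw [Lp.cauchySeq_Lp_iff_cauchySeq_eLpNorm]
    refine h.congr fun n => ?_
    refine eLpNorm_congr_ae ?_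
    filter_upwards [(hφ n.1).coeFn_toLp, (hφ n.2).coeFn_toLp] with x h1 h2
    simp [hf, h1, h2]
  obtain ⟨τ, hτ⟩ := cauchySeq_tendsto_of_complete hc
  refine ⟨τ, Lp.memLp τ, ?_⟩
  rw [Lp.tendsto_Lp_iff_tendsto_eLpNorm'] at hτ
  refine hτ.congr fun j => ?_
  refine eLpNorm_congr_ae ?_
  filter_upwards [(hφ j).coeFn_toLp] with x h1
  simp [hf, h1]

/-- A sequence converging in `H¹(U)` is Cauchy there, so by the trace bound its restrictions are
Cauchy in the complete space `L²(Γ)`. -/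
theorem TraceBound.exists_limit {U Γ : Set Plane} (h : TraceBound U Γ) {φ : ℕ → Plane → ℂ}
    {u : Plane → ℂ} (hu : MemH1 U u) (hφ : ∀ j, ContDiff ℝ ∞ (φ j)) (hΓ : ∀ j, MemL2Curve Γ (φ j))
    (h1 : TendstoH1 U φ u) :
    ∃ τ, MemL2Curve Γ τ ∧
      Tendsto (fun j => eLpNorm (fun x => φ j x - τ x) 2 (μH[1].restrict Γ)) atTop (𝓝 0) := by
  refine exists_tendsto_L2_of_cauchy hΓ ?_
  have key : ∀ (a : ℕ → Plane → ℂ) (w : Plane → ℂ), (∀ j, Continuous (a j)) → MemL2 U w →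
      Tendsto (fun j => eLpNorm (fun x => a j x - w x) 2 (volume.restrict U)) atTop (𝓝 0) →
      Tendsto (fun n : ℕ × ℕ => eLpNorm (fun x => a n.1 x - a n.2 x) 2 (volume.restrict U)) atTop
        (𝓝 0) := by
    intro a w ha hw h
    have e1 := h.comp (tendsto_fst (f := (atTop : Filter ℕ)) (g := (atTop : Filter ℕ)))
    have e2 := h.comp (tendsto_snd (f := (atTop : Filter ℕ)) (g := (atTop : Filter ℕ)))
    have e3 := e1.add e2
    rw [add_zero, prod_atTop_atTop_eq] at e3
    refine tendsto_of_tendsto_of_tendsto_of_le_of_le tendsto_const_nhds e3 (fun _ => zero_le)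
      fun n => ?_
    have e : (fun x => a n.1 x - a n.2 x) = (fun x => a n.1 x - w x) - (fun x => a n.2 x - w x) := by
      ext x; simp
    simp only [e]
    exact eLpNorm_sub_le ((ha n.1).aestronglyMeasurable.sub hw.1)
      ((ha n.2).aestronglyMeasurable.sub hw.1) one_le_two
  refine h.tendsto_zero (φ := fun n : ℕ × ℕ => fun x => φ n.1 x - φ n.2 x)
    (fun n => (hφ n.1).sub (hφ n.2)) (key φ u (fun j => (hφ j).continuous) hu.1 h1.1) fun i => ?_
  refine (key (fun j => pderiv i (φ j)) (weakGrad U u i)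
    (fun j => (contDiff_pderiv (hφ j) i).continuous) (hu.memL2_weakGrad i) (h1.2 i)).congr
    fun n => ?_
  congr 1
  ext x
  exact (pderiv_sub (hφ n.1) (hφ n.2) i x).symm

theorem hasTrace_traceOn {A : Set (Plane → ℂ)} {U Γ : Set Plane} {u : Plane → ℂ}
    (h : ∃ τ, HasTrace A U Γ u τ) : HasTrace A U Γ u (traceOn A U Γ u) := by
  unfold traceOn
  rw [dif_pos h]
  exact h.choose_spec

theorem tendsto_trans_L2 {α : Type*} [MeasurableSpace α] {μ : Measure α} {φ ψ : ℕ → α → ℂ}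
    {τ : α → ℂ} (hφ : ∀ j, AEStronglyMeasurable (φ j) μ) (hψ : ∀ j, AEStronglyMeasurable (ψ j) μ)
    (hτ : AEStronglyMeasurable τ μ)
    (h1 : Tendsto (fun j => eLpNorm (fun x => φ j x - ψ j x) 2 μ) atTop (𝓝 0))
    (h2 : Tendsto (fun j => eLpNorm (fun x => ψ j x - τ x) 2 μ) atTop (𝓝 0)) :
    Tendsto (fun j => eLpNorm (fun x => φ j x - τ x) 2 μ) atTop (𝓝 0) := by
  have h3 := h1.add h2
  rw [add_zero] at h3
  refine tendsto_of_tendsto_of_tendsto_of_le_of_le tendsto_const_nhds h3 (fun _ => zero_le)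
    fun j => ?_
  have e : (fun x => φ j x - τ x) = (fun x => φ j x - ψ j x) + fun x => ψ j x - τ x := by
    ext x; simp
  simp only [e]
  exact eLpNorm_add_le ((hφ j).sub (hψ j)) ((hψ j).sub hτ) one_le_two

/-- Every sequence of smooth functions converging to `u` in `H¹(U)` converges on `Γ` to the trace
of `u`. -/
theorem HasTrace.tendsto {A : Set (Plane → ℂ)} (hA : A ⊆ smoothFunctions) {U Γ : Set Plane}
    (hb : TraceBound U Γ) {u τ : Plane → ℂ} (hτ : HasTrace A U Γ u τ) {φ : ℕ → Plane → ℂ}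
    (hφ : ∀ j, ContDiff ℝ ∞ (φ j)) (h : TendstoH1 U φ u) :
    Tendsto (fun j => eLpNorm (fun x => φ j x - τ x) 2 (μH[1].restrict Γ)) atTop (𝓝 0) := by
  obtain ⟨hu, hτ2, ψ, hψA, hψ, hψτ⟩ := hτ
  have hψs : ∀ j, ContDiff ℝ ∞ (ψ j) := fun j => hA (hψA j)
  exact tendsto_trans_L2 (fun j => (hφ j).continuous.aestronglyMeasurable)
    (fun j => (hψs j).continuous.aestronglyMeasurable) hτ2.1
    (hb.tendsto_sub hu hφ hψs h hψ) hψτ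

theorem ae_eq_of_tendsto_L2_same {α : Type*} [MeasurableSpace α] {μ : Measure α}
    {σ τ : α → ℂ} {φ : ℕ → α → ℂ} (hφ : ∀ j, AEStronglyMeasurable (φ j) μ)
    (hσ : AEStronglyMeasurable σ μ) (hτ : AEStronglyMeasurable τ μ)
    (h1 : Tendsto (fun j => eLpNorm (fun x => φ j x - σ x) 2 μ) atTop (𝓝 0))
    (h2 : Tendsto (fun j => eLpNorm (fun x => φ j x - τ x) 2 μ) atTop (𝓝 0)) : σ =ᵐ[μ] τ :=
  ae_eq_of_tendsto_L2 hφ hφ hσ hτ h1 h2 (by simp)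

namespace Mesh

variable {g : Grating} (m : Mesh g)

theorem isOpen_elem (i : Fin m.N) : IsOpen (m.elem i) := isOpen_interior

theorem convex_elem (i : Fin m.N) : Convex ℝ (m.elem i) := (convex_convexHull ℝ _).interior

theorem isBounded_elem (i : Fin m.N) : Bornology.IsBounded (m.elem i) :=
  ((isBounded_convexHull.2 (m.vertices i).finite_toSet.isBounded).subset interior_subset)

theorem nonempty_elem (i : Fin m.N) : (m.elem i).Nonempty := m.elem_nonempty i

theorem elem_subset_Ω (i : Fin m.N) : m.elem i ⊆ g.Ω := m.elem_subset i

theorem measure_frontier_ne_top (i : Fin m.N) :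
    (μH[1] : Measure Plane) (frontier (m.elem i)) ≠ ⊤ :=
  hausdorffMeasure_frontier_ne_top _ (m.elem_nonempty i)

theorem isBounded_frontier (i : Fin m.N) : Bornology.IsBounded (frontier (m.elem i)) :=
  (m.isBounded_elem i).closure.subset frontier_subset_closure

theorem memL2Curve_frontier (i : Fin m.N) {φ : Plane → ℂ} (hφ : Continuous φ) :
    MemL2Curve (frontier (m.elem i)) φ :=
  memLp_restrict_of_continuous hφ isClosed_frontier.measurableSet (m.isBounded_frontier i)
    (m.measure_frontier_ne_top i) 2

theorem traceBound_elem (i : Fin m.N) : TraceBound (m.elem i) (frontier (m.elem i)) :=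
  exists_trace_le _ (m.elem_nonempty i)

/-- Density of smooth functions and the trace inequality produce a trace for every `H¹` function on
an element, so `traceOn` never falls back on its default value here. -/
theorem hasTrace_tr (i : Fin m.N) {v : Plane → ℂ} (hv : MemH1 (m.elem i) v) :
    HasTrace smoothFunctions (m.elem i) (frontier (m.elem i)) v (m.tr i v) := by
  obtain ⟨φ, hφ, hφv⟩ := exists_tendstoH1_of_convex (m.convex_elem i) (m.isOpen_elem i)
    (m.isBounded_elem i) (m.nonempty_elem i) hv
  obtain ⟨τ, hτ, hφτ⟩ := (m.traceBound_elem i).exists_limit hv hφ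
    (fun j => m.memL2Curve_frontier i (hφ j).continuous) hφv
  exact hasTrace_traceOn ⟨τ, hv, hτ, φ, hφ, hφv, hφτ⟩

theorem tendsto_tr (i : Fin m.N) {v : Plane → ℂ} (hv : MemH1 (m.elem i) v) {φ : ℕ → Plane → ℂ}
    (hφ : ∀ j, ContDiff ℝ ∞ (φ j)) (h : TendstoH1 (m.elem i) φ v) :
    Tendsto (fun j => eLpNorm (fun x => φ j x - m.tr i v x) 2
      (μH[1].restrict (frontier (m.elem i)))) atTop (𝓝 0) :=
  (m.hasTrace_tr i hv).tendsto subset_rfl (m.traceBound_elem i) hφ h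

theorem memL2Curve_tr (i : Fin m.N) {v : Plane → ℂ} (hv : MemH1 (m.elem i) v) :
    MemL2Curve (frontier (m.elem i)) (m.tr i v) := (m.hasTrace_tr i hv).2.1

/-! ### Green's formula on an element -/

theorem hasNormalDeriv_dn {v : Plane → ℂ} (hv : v ∈ m.trefftz) (i : Fin m.N) :
    HasNormalDeriv (m.elem i) v (m.dn i v) := by
  have h := (hv.2 i).2.2
  unfold dn normalDeriv
  rw [dif_pos h]
  exact h.choose_spec

theorem memL2Curve_dn {v : Plane → ℂ} (hv : v ∈ m.trefftz) (i : Fin m.N) :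
    MemL2Curve (frontier (m.elem i)) (m.dn i v) := (m.hasNormalDeriv_dn hv i).2.1

theorem memH1_of_mem_trefftz {v : Plane → ℂ} (hv : v ∈ m.trefftz) (i : Fin m.N) :
    MemH1 (m.elem i) v := (hv.2 i).1

/-- Green's formula on an element, tested against smooth functions. -/
theorem green_smooth {v : Plane → ℂ} (hv : v ∈ m.trefftz) (i : Fin m.N) {w : Plane → ℂ}
    (hw : ContDiff ℝ ∞ w) :
    ∫ x in m.elem i, ((∑ l, weakGrad (m.elem i) v l x * conj (pderiv l w x))
        - ((m.κ i ^ 2 : ℝ) : ℂ) * v x * conj (w x))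
      = ∫ x in frontier (m.elem i), m.dn i v x * conj (w x) ∂μH[1] := by
  obtain ⟨h1, h2, f, hf, hΔ, hgreen⟩ := m.hasNormalDeriv_dn hv i
  have hf' : MemL2 (m.elem i) fun x => -((m.κ i ^ 2 : ℝ) : ℂ) * v x := h1.1.const_mul _
  -- The Laplacian in the definition of the normal derivative is existentially quantified;
  -- uniqueness identifies it with `-κ² v`.
  have hae := hΔ.ae_unique (m.isOpen_elem i) hf hf' (hv.2 i).2.1
  rw [← hgreen _ (contDiff_conj hw)]
  refine integral_congr_ae ?_
  filter_upwards [hae] with x hx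
  rw [hx]
  simp only [pderiv_conj hw]
  ring

theorem integrable_green {v w : Plane → ℂ} {i : Fin m.N} (hv : MemH1 (m.elem i) v) {W : Plane → ℂ}
    (hw : MemL2 (m.elem i) w) (l : Fin 2) (hW : MemL2 (m.elem i) W) :
    Integrable (fun x => weakGrad (m.elem i) v l x * conj (W x)) (volume.restrict (m.elem i)) ∧
    Integrable (fun x => ((m.κ i ^ 2 : ℝ) : ℂ) * v x * conj (w x)) (volume.restrict (m.elem i)) :=
  ⟨(hv.memL2_weakGrad l).integrable_mul (memLp_conj hW),
    (hv.1.const_mul _).integrable_mul (memLp_conj hw)⟩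

/-- Green's formula on an element. -/
theorem green {v w : Plane → ℂ} (hv : v ∈ m.trefftz) (i : Fin m.N) (hw : MemH1 (m.elem i) w) :
    ∫ x in m.elem i, ((∑ l, weakGrad (m.elem i) v l x * conj (weakGrad (m.elem i) w l x))
        - ((m.κ i ^ 2 : ℝ) : ℂ) * v x * conj (w x))
      = ∫ x in frontier (m.elem i), m.dn i v x * conj (m.tr i w x) ∂μH[1] := by
  obtain ⟨φ, hφ, hφw⟩ := exists_tendstoH1_of_convex (m.convex_elem i) (m.isOpen_elem i)
    (m.isBounded_elem i) (m.nonempty_elem i) hw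
  have hvH := m.memH1_of_mem_trefftz hv i
  have split : ∀ (W : Fin 2 → Plane → ℂ) (w : Plane → ℂ), (∀ l, MemL2 (m.elem i) (W l)) →
      MemL2 (m.elem i) w →
      ∫ x in m.elem i, ((∑ l, weakGrad (m.elem i) v l x * conj (W l x))
        - ((m.κ i ^ 2 : ℝ) : ℂ) * v x * conj (w x))
      = (∑ l, ∫ x in m.elem i, weakGrad (m.elem i) v l x * conj (W l x))
        - ∫ x in m.elem i, ((m.κ i ^ 2 : ℝ) : ℂ) * v x * conj (w x) := by
    intro W w hW hw
    rw [integral_sub (integrable_finsetSum _ fun l _ => (m.integrable_green hvH hw l (hW l)).1)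
      (m.integrable_green hvH hw 0 (hW 0)).2, integral_finsetSum _ fun l _ =>
        (m.integrable_green hvH hw l (hW l)).1]
  have hφL : ∀ j, MemL2 (m.elem i) (φ j) := fun j =>
    memL2_of_contDiff (m.isOpen_elem i) (m.isBounded_elem i) (hφ j)
  have hφL' : ∀ j l, MemL2 (m.elem i) (pderiv l (φ j)) := fun j l =>
    memL2_of_contDiff (m.isOpen_elem i) (m.isBounded_elem i) (contDiff_pderiv (hφ j) l)
  have lhs : Tendsto (fun j => ∫ x in m.elem i,
      ((∑ l, weakGrad (m.elem i) v l x * conj (pderiv l (φ j) x))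
        - ((m.κ i ^ 2 : ℝ) : ℂ) * v x * conj (φ j x))) atTop
      (𝓝 (∫ x in m.elem i, ((∑ l, weakGrad (m.elem i) v l x * conj (weakGrad (m.elem i) w l x))
        - ((m.κ i ^ 2 : ℝ) : ℂ) * v x * conj (w x)))) := by
    rw [split _ _ (fun l => hw.memL2_weakGrad l) hw.1]
    simp only [fun j => split (fun l => pderiv l (φ j)) (φ j) (hφL' j) (hφL j)]
    refine Tendsto.sub (tendsto_finsetSum _ fun l _ => ?_) ?_
    · refine tendsto_integral_mul_of_tendsto_L2 (hvH.memL2_weakGrad l)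
        (memLp_conj (hw.memL2_weakGrad l)) (fun j => (memLp_conj (hφL' j l)).1) ?_
      refine (hφw.2 l).congr fun j => ?_
      exact (eLpNorm_conj_sub _ _ _).symm
    · refine tendsto_integral_mul_of_tendsto_L2 (hvH.1.const_mul _)
        (memLp_conj hw.1) (fun j => (memLp_conj (hφL j)).1) ?_
      refine hφw.1.congr fun j => ?_
      exact (eLpNorm_conj_sub _ _ _).symm
  have rhs : Tendsto (fun j => ∫ x in frontier (m.elem i), m.dn i v x * conj (φ j x) ∂μH[1]) atTop
      (𝓝 (∫ x in frontier (m.elem i), m.dn i v x * conj (m.tr i w x) ∂μH[1])) := by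
    refine tendsto_integral_mul_of_tendsto_L2 (m.memL2Curve_dn hv i)
      (memLp_conj (m.memL2Curve_tr i hw))
      (fun j => (memLp_conj (m.memL2Curve_frontier i (hφ j).continuous)).1) ?_
    refine (m.tendsto_tr i hw hφ hφw).congr fun j => ?_
    exact (eLpNorm_conj_sub _ _ _).symm
  refine tendsto_nhds_unique lhs (rhs.congr fun j => ?_)
  exact (m.green_smooth hv i (hφ j)).symm

/-- The integrand in Green's second formula. -/
noncomputable def wronskian (i : Fin m.N) (u v : Plane → ℂ) (x : Plane) : ℂ :=
  m.tr i u x * conj (m.dn i v x) - m.dn i u x * conj (m.tr i v x)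

theorem integrableOn_wronskian {u v : Plane → ℂ} (hu : u ∈ m.trefftz) (hv : v ∈ m.trefftz)
    (i : Fin m.N) : IntegrableOn (m.wronskian i u v) (frontier (m.elem i)) μH[1] :=
  ((m.memL2Curve_tr i (m.memH1_of_mem_trefftz hu i)).integrable_mul
    (memLp_conj (m.memL2Curve_dn hv i))).sub
  ((m.memL2Curve_dn hu i).integrable_mul
    (memLp_conj (m.memL2Curve_tr i (m.memH1_of_mem_trefftz hv i))))

/-- Green's first formula for `(u, v)` and the conjugate of the one for `(v, u)` have the same
volume term, because `κ` is real. -/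
theorem integral_wronskian {u v : Plane → ℂ} (hu : u ∈ m.trefftz) (hv : v ∈ m.trefftz)
    (i : Fin m.N) : ∫ x in frontier (m.elem i), m.wronskian i u v x ∂μH[1] = 0 := by
  have hu' := m.memH1_of_mem_trefftz hu i
  have hv' := m.memH1_of_mem_trefftz hv i
  unfold wronskian
  rw [integral_sub (integrable_mul_of_L2 (m.memL2Curve_tr i hu') (memLp_conj (m.memL2Curve_dn hv i)))
    (integrable_mul_of_L2 (m.memL2Curve_dn hu i) (memLp_conj (m.memL2Curve_tr i hv'))),
    ← m.green hu i hv', sub_eq_zero]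
  have h := congrArg conj (m.green hv i hu')
  rw [← integral_conj, ← integral_conj] at h
  have e1 : ∀ x, conj (m.dn i v x * conj (m.tr i u x)) = m.tr i u x * conj (m.dn i v x) := by
    intro x; simp [mul_comm]
  simp only [e1] at h
  rw [← h]
  refine integral_congr_ae (Eventually.of_forall fun x => ?_)
  simp only [Fin.sum_univ_two, map_sub, map_add, map_mul, Complex.conj_conj, Complex.conj_ofReal]
  ring

/-! ### The Trefftz space is closed under addition -/

theorem zero_mem_trefftz : (0 : Plane → ℂ) ∈ m.trefftz := by
  have hg : ∀ U, IsWeakGrad U (0 : Plane → ℂ) 0 := fun U =>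
    ⟨fun i => MemLp.zero, fun i φ _ => by simp⟩
  have hH : ∀ U, MemH1 U (0 : Plane → ℂ) := fun U => ⟨MemLp.zero, _, hg U⟩
  refine ⟨MemLp.zero, fun i => ⟨hH _, fun φ _ => by simp, 0, hH _, MemLp.zero, 0, MemLp.zero,
    fun φ _ => by simp, fun φ _ => ?_⟩⟩
  simp only [Pi.zero_apply, zero_mul, integral_zero, add_zero]
  rw [← integral_zero Plane ℂ (μ := volume.restrict (m.elem i))]
  refine integral_congr_ae ?_
  filter_upwards [weakGrad_ae_eq_of_isWeakGrad (m.isOpen_elem i) (hH _).1 (hg _) 0,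
    weakGrad_ae_eq_of_isWeakGrad (m.isOpen_elem i) (hH _).1 (hg _) 1] with x h0 h1
  simp [h0, h1]

theorem add_mem_trefftz {u v : Plane → ℂ} (hu : u ∈ m.trefftz) (hv : v ∈ m.trefftz) :
    u + v ∈ m.trefftz := by
  refine ⟨hu.1.add hv.1, fun i => ?_⟩
  have hu' := m.memH1_of_mem_trefftz hu i
  have hv' := m.memH1_of_mem_trefftz hv i
  have hg := (isWeakGrad_weakGrad hu').add hu'.1 hv'.1 (isWeakGrad_weakGrad hv')
  have hH : MemH1 (m.elem i) (u + v) := ⟨hu'.1.add hv'.1, _, hg⟩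
  obtain ⟨-, -, f₁, hf₁, hΔ₁, hg₁⟩ := m.hasNormalDeriv_dn hu i
  obtain ⟨-, -, f₂, hf₂, hΔ₂, hg₂⟩ := m.hasNormalDeriv_dn hv i
  refine ⟨hH, ?_, m.dn i u + m.dn i v, hH,
    (m.memL2Curve_dn hu i).add (m.memL2Curve_dn hv i), f₁ + f₂, hf₁.add hf₂,
    hΔ₁.add hu'.1 hv'.1 hf₁ hf₂ hΔ₂, fun φ hφ => ?_⟩
  · have := (hu.2 i).2.1.add hu'.1 hv'.1 (hu'.1.const_mul _) (hv'.1.const_mul _) (hv.2 i).2.1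
    convert this using 1
    ext x
    simp [mul_add]
  · have hφL : MemL2 (m.elem i) φ := memL2_of_contDiff (m.isOpen_elem i) (m.isBounded_elem i) hφ
    have hφL' : ∀ l, MemL2 (m.elem i) (pderiv l φ) := fun l =>
      memL2_of_contDiff (m.isOpen_elem i) (m.isBounded_elem i) (contDiff_pderiv hφ l)
    have hφc := m.memL2Curve_frontier i (ContDiff.continuous (𝕜 := ℝ) (n := ∞) hφ)
    have hint : ∀ (w f : Plane → ℂ), MemH1 (m.elem i) w → MemL2 (m.elem i) f → Integrable
        (fun x => (∑ l, weakGrad (m.elem i) w l x * pderiv l φ x) + f x * φ x)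
        (volume.restrict (m.elem i)) := fun w f hw hf =>
      (integrable_finsetSum _ fun l _ => (hw.memL2_weakGrad l).integrable_mul (hφL' l)).add
        (hf.integrable_mul hφL)
    simp only [Pi.add_apply, add_mul (m.dn i u _)]
    rw [integral_add (integrable_mul_of_L2 (m.memL2Curve_dn hu i) hφc)
      (integrable_mul_of_L2 (m.memL2Curve_dn hv i) hφc), ← hg₁ φ hφ, ← hg₂ φ hφ,
      ← integral_add (hint u f₁ hu' hf₁) (hint v f₂ hv' hf₂)]
    refine integral_congr_ae ?_
    filter_upwards [weakGrad_ae_eq_of_isWeakGrad (m.isOpen_elem i) hH.1 hg 0,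
      weakGrad_ae_eq_of_isWeakGrad (m.isOpen_elem i) hH.1 hg 1] with x h0 h1
    simp only [Fin.sum_univ_two, h0, h1, Pi.add_apply]
    ring

end Mesh

/-- The local spaces are already submodules, so induction over their supremum asks the Trefftz space
only for closure under zero and addition. -/
theorem DiscreteTrefftz.mem_trefftz {g : Grating} {m : Mesh g} (V : DiscreteTrefftz m)
    {v : Plane → ℂ} (hv : v ∈ V.space) : v ∈ m.trefftz := by
  unfold DiscreteTrefftz.space at hv
  induction hv using Submodule.iSup_induction' with
  | mem i x hx => exact V.loc_trefftz i x hx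
  | zero => exact m.zero_mem_trefftz
  | add x y _ _ hx hy => exact m.add_mem_trefftz hx hy

/-! ### Half discs -/

theorem HasHalfDisc.eventually_mem {K : Set Plane} {x : Plane} {f : Plane →L[ℝ] ℝ}
    (h : HasHalfDisc K x f) {d : Plane} (hd : f d < 0) : ∀ᶠ t in 𝓝[>] (0 : ℝ), x + t • d ∈ K := by
  have hc : Tendsto (fun t : ℝ => x + t • d) (𝓝[>] 0) (𝓝 x) := by
    have : Continuous fun t : ℝ => x + t • d := by fun_prop
    have h0 := this.tendsto 0
    simp only [zero_smul, add_zero] at h0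
    exact h0.mono_left nhdsWithin_le_nhds
  filter_upwards [hc.eventually h.2, self_mem_nhdsWithin] with t ht ht0
  apply ht
  rw [map_add, map_smul, smul_eq_mul]
  have : 0 < t := ht0
  nlinarith

/-- If both functionals were negative on `d`, a short ray from `x` in that direction would enter
both sets; if both were positive, the ray along `-d` would. -/
theorem HasHalfDisc.mul_nonpos {A B : Set Plane} (hAB : Disjoint A B) {x : Plane}
    {f₁ f₂ : Plane →L[ℝ] ℝ} (hA : HasHalfDisc A x f₁) (hB : HasHalfDisc B x f₂) (d : Plane) :
    f₁ d * f₂ d ≤ 0 := by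
  have key : ∀ d, ¬ (f₁ d < 0 ∧ f₂ d < 0) := by
    rintro d ⟨h1, h2⟩
    obtain ⟨t, ha, hb⟩ := ((hA.eventually_mem h1).and (hB.eventually_mem h2)).exists
    exact disjoint_left.1 hAB ha hb
  by_contra hcon
  push Not at hcon
  rcases pos_and_pos_or_neg_and_neg_of_mul_pos hcon with ⟨h1, h2⟩ | ⟨h1, h2⟩
  · exact key (-d) ⟨by rw [map_neg]; linarith, by rw [map_neg]; linarith⟩
  · exact key d ⟨h1, h2⟩

/-- Three pairwise disjoint sets cannot contain half discs with the same centre. -/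
theorem not_three_halfDiscs {A B C : Set Plane} (hAB : Disjoint A B) (hAC : Disjoint A C)
    (hBC : Disjoint B C) {x : Plane} (hA : ∃ f, HasHalfDisc A x f) (hB : ∃ f, HasHalfDisc B x f)
    (hC : ∃ f, HasHalfDisc C x f) : False := by
  obtain ⟨f₁, hA⟩ := hA
  obtain ⟨f₂, hB⟩ := hB
  obtain ⟨f₃, hC⟩ := hC
  have hne : ∀ f : Plane →L[ℝ] ℝ, f ≠ 0 → ∀ᵐ d ∂(volume : Measure Plane), f d ≠ 0 := by
    intro f hf
    have h : (LinearMap.ker (f : Plane →ₗ[ℝ] ℝ)) ≠ ⊤ := by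
      intro h
      apply hf
      ext d
      have : d ∈ LinearMap.ker (f : Plane →ₗ[ℝ] ℝ) := by rw [h]; trivial
      exact this
    exact measure_eq_zero_iff_ae_notMem.1 (Measure.addHaar_submodule volume _ h)
  -- Kernels of nonzero functionals are null sets, so a direction `d` avoids all three. The three
  -- pairwise products of the values at `d` are then negative, while the product of these products
  -- is a square.
  obtain ⟨d, h1, h2, h3⟩ :=
    ((hne f₁ hA.1).and ((hne f₂ hB.1).and (hne f₃ hC.1))).exists
  have e1 := (hA.mul_nonpos hAB hB d).lt_of_ne (mul_ne_zero h1 h2)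
  have e2 := (hA.mul_nonpos hAC hC d).lt_of_ne (mul_ne_zero h1 h3)
  have e3 := (hB.mul_nonpos hBC hC d).lt_of_ne (mul_ne_zero h2 h3)
  have := mul_pos_of_neg_of_neg e1 e2
  nlinarith [sq_nonneg (f₁ d), mul_pos this (neg_pos.2 e3), sq_nonneg (f₁ d * f₂ d * f₃ d)]

/-- The coordinate functional `x ↦ x l`. -/
noncomputable def coordFunctional (l : Fin 2) : Plane →L[ℝ] ℝ := EuclideanSpace.proj l

theorem coordFunctional_apply (l : Fin 2) (x : Plane) : coordFunctional l x = x l := rfl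

theorem coordFunctional_ne_zero (l : Fin 2) : coordFunctional l ≠ 0 := by
  intro h
  have : coordFunctional l (EuclideanSpace.single l 1) = 0 := by rw [h]; rfl
  simp [coordFunctional_apply] at this

/-- At a point on a side of the cell the exterior half plane acts as the third set in
`not_three_halfDiscs`. -/
theorem hasHalfDisc_lt {l : Fin 2} {x : Plane} {a : ℝ} (hx : x l = a) :
    ∃ f, HasHalfDisc {y : Plane | y l < a} x f :=
  ⟨coordFunctional l, coordFunctional_ne_zero l, Eventually.of_forall fun y hy => by
    rw [coordFunctional_apply, coordFunctional_apply, hx] at hy; exact hy⟩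

theorem hasHalfDisc_gt {l : Fin 2} {x : Plane} {a : ℝ} (hx : x l = a) :
    ∃ f, HasHalfDisc {y : Plane | a < y l} x f :=
  ⟨-coordFunctional l, neg_ne_zero.2 (coordFunctional_ne_zero l), Eventually.of_forall fun y hy => by
    simp only [neg_apply, coordFunctional_apply, hx] at hy
    exact neg_lt_neg_iff.1 hy⟩

/-! ### The cell -/

theorem continuous_coord (i : Fin 2) : Continuous fun x : Plane => x i := by fun_prop

namespace Grating

variable (g : Grating)

@[simp] theorem shift_zero : g.shift 0 = g.L := by simp [shift]

@[simp] theorem shift_one : g.shift 1 = 0 := by simp [shift]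

theorem isOpen_Ω : IsOpen g.Ω := by
  have h0 := continuous_coord 0
  have h1 := continuous_coord 1
  exact (isClosed_closure.isOpen_compl).inter ((isOpen_lt continuous_const h0).inter
    ((isOpen_lt h0 continuous_const).inter ((isOpen_lt continuous_const h1).inter
      (isOpen_lt h1 continuous_const))))

theorem bounds_of_mem_closure_Ω {x : Plane} (hx : x ∈ closure g.Ω) :
    0 ≤ x 0 ∧ x 0 ≤ g.L ∧ -g.H ≤ x 1 ∧ x 1 ≤ g.H := by
  have h0 := continuous_coord 0
  have h1 := continuous_coord 1
  have hcl : IsClosed {x : Plane | 0 ≤ x 0 ∧ x 0 ≤ g.L ∧ -g.H ≤ x 1 ∧ x 1 ≤ g.H} :=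
    (isClosed_le continuous_const h0).inter ((isClosed_le h0 continuous_const).inter
    ((isClosed_le continuous_const h1).inter (isClosed_le h1 continuous_const)))
  refine closure_minimal ?_ hcl hx
  rintro y ⟨-, h1, h2, h3, h4⟩
  exact ⟨h1.le, h2.le, h3.le, h4.le⟩

theorem notMem_D_of_mem_closure_Ω {x : Plane} (hx : x ∈ closure g.Ω) : x ∉ g.D := by
  intro hD
  obtain ⟨y, hy1, hy2⟩ := mem_closure_iff.1 hx g.D g.D_open hD
  exact hy2.1 (subset_closure hy1)

theorem notMem_closure_D {x : Plane} (hx : x ∈ closure g.Ω) (hΓ : x ∉ g.ΓD) :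
    x ∉ closure g.D := by
  intro h
  refine hΓ ⟨⟨h, ?_⟩, hx⟩
  rw [g.D_open.interior_eq]
  exact g.notMem_D_of_mem_closure_Ω hx

theorem add_shift_mem_closure_D {x : Plane} : x + g.shift ∈ closure g.D ↔ x ∈ closure g.D := by
  have h : (Homeomorph.addRight g.shift) ⁻¹' g.D = g.D := by
    ext y
    exact (g.D_periodic y).symm
  have h2 := (Homeomorph.addRight g.shift).preimage_closure g.D
  rw [h] at h2
  conv_rhs => rw [← h2]
  rfl

/-- A small step towards the centre of the rectangle enters its open interior while remaining
outside the closed obstacle. -/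
theorem mem_closure_Ω {x : Plane} (hD : x ∉ closure g.D) (h0 : 0 ≤ x 0) (hL : x 0 ≤ g.L)
    (h1 : -g.H ≤ x 1) (h2 : x 1 ≤ g.H) : x ∈ closure g.Ω := by
  set c : Plane := !₂[g.L / 2, 0] with hc
  have hc0 : c 0 = g.L / 2 := rfl
  have hc1 : c 1 = 0 := rfl
  have hcont : Tendsto (fun t : ℝ => x + t • (c - x)) (𝓝[>] 0) (𝓝 x) := by
    have : Continuous fun t : ℝ => x + t • (c - x) := by fun_prop
    have h0 := this.tendsto 0
    simp only [zero_smul, add_zero] at h0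
    exact h0.mono_left nhdsWithin_le_nhds
  refine mem_closure_of_tendsto hcont ?_
  have e1 := hcont.eventually (isClosed_closure.isOpen_compl.mem_nhds hD)
  have e2 : ∀ᶠ t : ℝ in 𝓝[>] 0, t < 1 :=
    (gt_mem_nhds one_pos).filter_mono nhdsWithin_le_nhds
  filter_upwards [e1, e2, self_mem_nhdsWithin] with t ht1 ht2 ht0
  have hL0 := g.L_pos
  have hH := g.H_pos
  have ht0' : 0 < t := ht0
  have h1t : 0 < 1 - t := by linarith
  have m1 := mul_pos ht0' hL0
  have m2 := mul_pos ht0' hH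
  have m3 := mul_nonneg h1t.le h0
  have m4 := mul_nonneg h1t.le (sub_nonneg.2 hL)
  have m5 := mul_nonneg h1t.le (sub_nonneg.2 h1)
  have m6 := mul_nonneg h1t.le (sub_nonneg.2 h2)
  refine ⟨ht1, ?_, ?_, ?_, ?_⟩ <;>
    simp only [PiLp.add_apply, PiLp.smul_apply, PiLp.sub_apply, smul_eq_mul, hc0, hc1] <;>
    nlinarith

theorem isClosed_Γ (y : ℝ) : IsClosed (g.Γ y) := by
  have h0 := continuous_coord 0
  have h1 := continuous_coord 1
  exact (isClosed_le continuous_const h0).inter ((isClosed_le h0 continuous_const).inter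
    (isClosed_eq h1 continuous_const))

theorem isClosed_ΓD : IsClosed g.ΓD := isClosed_frontier.inter isClosed_closure

theorem abs_lt_of_mem_ΓD {x : Plane} (hx : x ∈ g.ΓD) : |x 1| < g.H :=
  g.D_bounded x (frontier_subset_closure hx.1)

theorem disjoint_Γ : Disjoint (g.Γ g.H) (g.Γ (-g.H)) := by
  refine disjoint_left.2 fun x h1 h2 => ?_
  have := g.H_pos
  have e := h1.2.2.symm.trans h2.2.2
  linarith

theorem disjoint_Γ_ΓD {y : ℝ} (hy : |y| = g.H) : Disjoint (g.Γ y) g.ΓD := by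
  refine disjoint_left.2 fun x h1 h2 => ?_
  have := g.abs_lt_of_mem_ΓD h2
  rw [h1.2.2, hy] at this
  exact lt_irrefl _ this

end Grating

/-! ### The skeleton of the mesh -/

namespace Mesh

variable {g : Grating} (m : Mesh g)

theorem isClosed_outer : IsClosed m.outer :=
  ((g.isClosed_ΓD.union (g.isClosed_Γ _)).union (g.isClosed_Γ _))

theorem closure_elem (i : Fin m.N) :
    closure (m.elem i) = convexHull ℝ (m.vertices i : Set Plane) := by
  unfold elem
  rw [(convex_convexHull ℝ _).closure_interior_eq_closure_of_nonempty_interior (m.elem_nonempty i)]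
  exact ((m.vertices i).finite_toSet.isClosed_convexHull ℝ).closure_eq

theorem closure_Ω_subset : closure g.Ω ⊆ ⋃ i, closure (m.elem i) := by
  refine closure_minimal ?_ (isClosed_iUnion_of_finite fun i => isClosed_closure)
  simp only [m.closure_elem]
  exact m.elem_cover

theorem frontier_subset_closure_Ω (i : Fin m.N) : frontier (m.elem i) ⊆ closure g.Ω :=
  frontier_subset_closure.trans (closure_mono (m.elem_subset_Ω i))

theorem disjoint_elem {i j : Fin m.N} (h : i ≠ j) : Disjoint (m.elem i) (m.elem j) :=
  m.elem_disjoint i j h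

theorem exists_mem_frontier {x : Plane} (hx : x ∈ closure g.Ω) (h : ∀ i, x ∉ m.elem i) :
    ∃ i, x ∈ frontier (m.elem i) := by
  obtain ⟨i, hi⟩ := mem_iUnion.1 (m.closure_Ω_subset hx)
  refine ⟨i, hi, ?_⟩
  rw [(m.isOpen_elem i).interior_eq]
  exact h i

theorem notMem_elem_of_mem_frontier {i : Fin m.N} {x : Plane} (hx : x ∈ frontier (m.elem i))
    (j : Fin m.N) : x ∉ m.elem j := by
  intro hj
  by_cases hij : i = j
  · subst hij
    have := hx.2
    rw [(m.isOpen_elem i).interior_eq] at this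
    exact this hj
  · obtain ⟨y, hy1, hy2⟩ := mem_closure_iff.1 (frontier_subset_closure hx) _ (m.isOpen_elem j) hj
    exact disjoint_left.1 (m.disjoint_elem hij) hy2 hy1

/-- A boundary point of an element inside the cell lies on the boundary of another element. -/
theorem exists_neighbour {i : Fin m.N} {x : Plane} (hx : x ∈ frontier (m.elem i))
    (hxΩ : x ∈ g.Ω) : ∃ j, j ≠ i ∧ x ∈ frontier (m.elem j) := by
  have h1 : x ∈ closure (g.Ω \ closure (m.elem i)) := by
    -- The element is the interior of its own closure, so each of its boundary points is a limit of
    -- points outside that closure.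
    have hfr : x ∈ closure (closure (m.elem i))ᶜ := by
      rw [m.closure_elem, closure_compl]
      intro hx2
      have := hx.2
      rw [(m.isOpen_elem i).interior_eq] at this
      exact this hx2
    rw [mem_closure_iff] at hfr ⊢
    intro o ho hxo
    obtain ⟨y, ⟨hy1, hy2⟩, hy3⟩ := hfr _ (ho.inter g.isOpen_Ω) ⟨hxo, hxΩ⟩
    exact ⟨y, hy1, hy2, hy3⟩
  have h2 : g.Ω \ closure (m.elem i) ⊆ ⋃ j : {j // j ≠ i}, closure (m.elem j) := by
    rintro y ⟨hy1, hy2⟩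
    obtain ⟨j, hj⟩ := mem_iUnion.1 (m.closure_Ω_subset (subset_closure hy1))
    refine mem_iUnion.2 ⟨⟨j, ?_⟩, hj⟩
    rintro rfl
    exact hy2 hj
  have h3 := closure_minimal h2 (isClosed_iUnion_of_finite fun j => isClosed_closure) h1
  obtain ⟨⟨j, hji⟩, hj⟩ := mem_iUnion.1 h3
  refine ⟨j, hji, hj, ?_⟩
  rw [(m.isOpen_elem j).interior_eq]
  exact m.notMem_elem_of_mem_frontier hx j

theorem notMem_outer {x : Plane} (hD : x ∉ closure g.D) (h1 : x 1 ≠ g.H) (h2 : x 1 ≠ -g.H) :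
    x ∉ m.outer := by
  rintro ((h | h) | h)
  · exact hD (frontier_subset_closure h.1)
  · exact h1 h.2.2
  · exact h2 h.2.2

/-- Every boundary point of an element lies on the outer boundary, on an interface inside the cell,
or on a lateral interface. -/
theorem frontier_cases {i : Fin m.N} {x : Plane} (hx : x ∈ frontier (m.elem i)) (ho : x ∉ m.outer) :
    (∃ j, j ≠ i ∧ x ∈ m.interface i j) ∨ (∃ j, x ∈ m.periodicInterface j i) ∨
      ∃ j, x + g.shift ∈ m.periodicInterface i j := by
  have hcl := m.frontier_subset_closure_Ω i hx
  obtain ⟨h0, hL, hm, hp⟩ := g.bounds_of_mem_closure_Ω hcl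
  have hD : x ∉ closure g.D := g.notMem_closure_D hcl fun h => ho (Or.inl (Or.inl h))
  have n1 : x 1 ≠ g.H := fun h => ho (Or.inl (Or.inr ⟨h0, hL, h⟩))
  have n2 : x 1 ≠ -g.H := fun h => ho (Or.inr ⟨h0, hL, h⟩)
  rcases h0.eq_or_lt with h0' | h0'
  -- For a point of `Γ_left`, periodicity of the obstacle keeps the translate outside its closure.
  -- The translate is therefore in the closure of the cell, on the boundary of some element touching
  -- `Γ_right`.
  · right; right
    set y := x + g.shift with hy
    have y0 : y 0 = g.L := by simp [hy, ← h0']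
    have y1 : y 1 = x 1 := by simp [hy]
    have hyD : y ∉ closure g.D := by rwa [hy, g.add_shift_mem_closure_D]
    have hycl : y ∈ closure g.Ω := g.mem_closure_Ω hyD (by rw [y0]; exact g.L_pos.le) y0.le
      (by rw [y1]; exact hm) (by rw [y1]; exact hp)
    obtain ⟨j, hj⟩ := m.exists_mem_frontier hycl fun j hj => by
      have := (m.elem_subset_Ω j hj).2.2.1
      linarith
    exact ⟨j, ⟨by rwa [hy, add_sub_cancel_right], hj⟩,
      m.notMem_outer hyD (by rwa [y1]) (by rwa [y1])⟩
  rcases hL.eq_or_lt with hL' | hL'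
  · right; left
    set y := x - g.shift with hy
    have y0 : y 0 = 0 := by simp [hy, hL']
    have y1 : y 1 = x 1 := by simp [hy]
    have hyD : y ∉ closure g.D := by
      rw [← g.add_shift_mem_closure_D]
      rwa [hy, sub_add_cancel]
    have hycl : y ∈ closure g.Ω := g.mem_closure_Ω hyD y0.symm.le (by rw [y0]; exact g.L_pos.le)
      (by rw [y1]; exact hm) (by rw [y1]; exact hp)
    obtain ⟨j, hj⟩ := m.exists_mem_frontier hycl fun j hj => by
      have := (m.elem_subset_Ω j hj).2.1
      linarith
    exact ⟨j, ⟨hj, hx⟩, ho⟩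
  · left
    obtain ⟨j, hji, hj⟩ := m.exists_neighbour hx
      ⟨hD, h0', hL', lt_of_le_of_ne hm n2.symm, lt_of_le_of_ne hp n1⟩
    exact ⟨j, hji, ⟨hx, hj⟩, ho⟩

/-! ### Regular points of the skeleton -/

/-- At `x`, every element with `x` on its boundary contains a half disc. -/
def IsRegularPoint (x : Plane) : Prop :=
  ∀ i, x ∈ frontier (m.elem i) → ∃ f, HasHalfDisc (m.elem i) x f

theorem ae_isRegularPoint : ∀ᵐ x ∂(μH[1] : Measure Plane), m.IsRegularPoint x :=
  ae_all_iff.2 fun i => ae_exists_hasHalfDisc _ (m.elem_nonempty i)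

theorem measurePreserving_add (a : Plane) :
    MeasurePreserving (fun x : Plane => x + a) μH[1] μH[1] :=
  (IsometryEquiv.addRight a).measurePreserving_hausdorffMeasure 1

theorem ae_isRegularPoint_shift : ∀ᵐ x ∂(μH[1] : Measure Plane), m.IsRegularPoint x ∧
    m.IsRegularPoint (x + g.shift) ∧ m.IsRegularPoint (x - g.shift) := by
  have h1 := (measurePreserving_add g.shift).quasiMeasurePreserving.ae m.ae_isRegularPoint
  have h2 := (measurePreserving_add (-g.shift)).quasiMeasurePreserving.ae m.ae_isRegularPoint
  filter_upwards [m.ae_isRegularPoint, h1, h2] with x a b c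
  exact ⟨a, b, by simpa [sub_eq_add_neg] using c⟩

variable {m} in
theorem IsRegularPoint.eq_of_mem_three {x : Plane} (h : m.IsRegularPoint x) {i j k : Fin m.N}
    (hi : x ∈ frontier (m.elem i)) (hj : x ∈ frontier (m.elem j)) (hk : x ∈ frontier (m.elem k))
    (hij : i ≠ j) (hik : i ≠ k) : j = k := by
  by_contra hjk
  exact not_three_halfDiscs (m.disjoint_elem hij) (m.disjoint_elem hik) (m.disjoint_elem hjk)
    (h i hi) (h j hj) (h k hk)

variable {m} in
-- Two elements and the half plane beyond the lateral side would be three disjoint sets with half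
-- discs at `x`.
theorem IsRegularPoint.eq_of_lateral {x : Plane} (h : m.IsRegularPoint x) {i j : Fin m.N}
    (hi : x ∈ frontier (m.elem i)) (hj : x ∈ frontier (m.elem j)) (hx : x 0 = 0 ∨ x 0 = g.L) :
    i = j := by
  by_contra hij
  rcases hx with hx | hx
  · refine not_three_halfDiscs (m.disjoint_elem hij) ?_ ?_ (h i hi) (h j hj) (hasHalfDisc_lt hx) <;>
    · refine disjoint_left.2 fun y h1 (h2 : y 0 < 0) => ?_
      have := (m.elem_subset_Ω _ h1).2.1
      linarith
  · refine not_three_halfDiscs (m.disjoint_elem hij) ?_ ?_ (h i hi) (h j hj) (hasHalfDisc_gt hx) <;>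
    · refine disjoint_left.2 fun y h1 (h2 : g.L < y 0) => ?_
      have := (m.elem_subset_Ω _ h1).2.2.1
      linarith

variable {m} in
theorem IsRegularPoint.eq_of_artificial {x : Plane} (h : m.IsRegularPoint x) {i j : Fin m.N}
    (hi : x ∈ frontier (m.elem i)) (hj : x ∈ frontier (m.elem j))
    (hx : x 1 = -g.H ∨ x 1 = g.H) : i = j := by
  by_contra hij
  rcases hx with hx | hx
  · refine not_three_halfDiscs (m.disjoint_elem hij) ?_ ?_ (h i hi) (h j hj) (hasHalfDisc_lt hx) <;>
    · refine disjoint_left.2 fun y h1 (h2 : y 1 < -g.H) => ?_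
      have := (m.elem_subset_Ω _ h1).2.2.2.1
      linarith
  · refine not_three_halfDiscs (m.disjoint_elem hij) ?_ ?_ (h i hi) (h j hj) (hasHalfDisc_gt hx) <;>
    · refine disjoint_left.2 fun y h1 (h2 : g.H < y 1) => ?_
      have := (m.elem_subset_Ω _ h1).2.2.2.2
      linarith

theorem fst_eq_L_of_mem_periodicInterface {i j : Fin m.N} {x : Plane}
    (hx : x ∈ m.periodicInterface i j) : x 0 = g.L := by
  have h1 := (g.bounds_of_mem_closure_Ω (m.frontier_subset_closure_Ω i hx.1.1)).1
  have h2 := (g.bounds_of_mem_closure_Ω (m.frontier_subset_closure_Ω j hx.1.2)).2.1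
  simp only [PiLp.sub_apply, Grating.shift_zero] at h1
  linarith

/-- Lateral interfaces are stored on `Γ_right`, with the outer boundary removed there; periodicity
of the obstacle transfers the removal to the copy on `Γ_left`. -/
theorem notMem_outer_of_add_shift {x : Plane} (hxs : x + g.shift ∈ closure g.Ω)
    (h : x + g.shift ∉ m.outer) : x ∉ m.outer := by
  obtain ⟨b1, b2, -, -⟩ := g.bounds_of_mem_closure_Ω hxs
  rintro ((h' | h') | h')
  · refine h (Or.inl (Or.inl ?_))
    by_contra hcon
    have := g.notMem_closure_D hxs hcon
    rw [g.add_shift_mem_closure_D] at this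
    exact this (frontier_subset_closure h'.1)
  · exact h (Or.inl (Or.inr ⟨b1, b2, by simpa using h'.2.2⟩))
  · exact h (Or.inr ⟨b1, b2, by simpa using h'.2.2⟩)

/-! ### Decomposition of the boundary of an element -/

/-- The pieces of the boundary of the element `i`: its intersections with `Γ_H`, `Γ_{-H}`, `Γ_D`,
its interfaces with the other elements, and its lateral interfaces. -/
def piece (i : Fin m.N) : Fin 3 ⊕ {j // j ≠ i} ⊕ Fin m.N ⊕ Fin m.N → Set Plane
  | Sum.inl 0 => frontier (m.elem i) ∩ g.Γ g.H
  | Sum.inl 1 => frontier (m.elem i) ∩ g.Γ (-g.H)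
  | Sum.inl 2 => frontier (m.elem i) ∩ g.ΓD
  | Sum.inr (Sum.inl j) => m.interface i j
  | Sum.inr (Sum.inr (Sum.inl j)) => m.periodicInterface j i
  | Sum.inr (Sum.inr (Sum.inr j)) => (fun x => x + g.shift) ⁻¹' m.periodicInterface i j

theorem measurableSet_interface (i j : Fin m.N) : MeasurableSet (m.interface i j) :=
  (isClosed_frontier.measurableSet.inter isClosed_frontier.measurableSet).diff
    m.isClosed_outer.measurableSet

theorem measurableSet_periodicInterface (i j : Fin m.N) :
    MeasurableSet (m.periodicInterface i j) := by
  refine MeasurableSet.diff (MeasurableSet.inter ?_ isClosed_frontier.measurableSet)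
    m.isClosed_outer.measurableSet
  exact (isClosed_frontier.preimage (by fun_prop : Continuous fun x : Plane =>
    x - g.shift)).measurableSet

theorem measurableSet_piece (i : Fin m.N) (k) : MeasurableSet (m.piece i k) := by
  rcases k with k | j | j | j
  · fin_cases k
    · exact isClosed_frontier.measurableSet.inter (g.isClosed_Γ _).measurableSet
    · exact isClosed_frontier.measurableSet.inter (g.isClosed_Γ _).measurableSet
    · exact isClosed_frontier.measurableSet.inter g.isClosed_ΓD.measurableSet
  · exact m.measurableSet_interface i j
  · exact m.measurableSet_periodicInterface j i
  · exact (m.measurableSet_periodicInterface i j).preimage (measurable_add_const _)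

theorem iUnion_piece (i : Fin m.N) : ⋃ k, m.piece i k = frontier (m.elem i) := by
  apply subset_antisymm
  · refine iUnion_subset fun k => ?_
    rcases k with k | j | j | j
    · fin_cases k <;> exact inter_subset_left
    · exact fun x hx => hx.1.1
    · exact fun x hx => hx.1.2
    · intro x hx
      have := hx.1.1
      simpa using this
  · intro x hx
    rw [mem_iUnion]
    by_cases ho : x ∈ m.outer
    · rcases ho with (h | h) | h
      · exact ⟨Sum.inl 2, hx, h⟩
      · exact ⟨Sum.inl 0, hx, h⟩
      · exact ⟨Sum.inl 1, hx, h⟩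
    · rcases m.frontier_cases hx ho with ⟨j, hj, h⟩ | ⟨j, h⟩ | ⟨j, h⟩
      · exact ⟨Sum.inr (Sum.inl ⟨j, hj⟩), h⟩
      · exact ⟨Sum.inr (Sum.inr (Sum.inl j)), h⟩
      · exact ⟨Sum.inr (Sum.inr (Sum.inr j)), h⟩

theorem piece_inl_subset_outer (i : Fin m.N) (k : Fin 3) : m.piece i (Sum.inl k) ⊆ m.outer := by
  fin_cases k
  · exact fun x hx => Or.inl (Or.inr hx.2)
  · exact fun x hx => Or.inr hx.2
  · exact fun x hx => Or.inl (Or.inl hx.2)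

theorem piece_inr_disjoint_outer (i : Fin m.N) (k) {x : Plane} (hx : x ∈ m.piece i (Sum.inr k)) :
    x ∉ m.outer := by
  rcases k with j | j | j
  · exact hx.2
  · exact hx.2
  · exact m.notMem_outer_of_add_shift (m.frontier_subset_closure_Ω j hx.1.2) hx.2

/-- Two interfaces at one point would give a third element, and an inner interface cannot meet a
lateral side. Two lateral interfaces on the same side would give two elements at the translate of
`x`, which is why regularity is also needed at `x ± shift`. -/
theorem piece_unique (i : Fin m.N) {x : Plane} (hr : m.IsRegularPoint x)
    (hr1 : m.IsRegularPoint (x + g.shift)) (hr2 : m.IsRegularPoint (x - g.shift)) {k l}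
    (hk : x ∈ m.piece i k) (hl : x ∈ m.piece i l) : k = l := by
  have hH : |g.H| = g.H := abs_of_pos g.H_pos
  have hH' : |-g.H| = g.H := by rw [abs_neg, hH]
  have right0 : ∀ {j}, x ∈ m.periodicInterface j i → x 0 = g.L := fun h =>
    m.fst_eq_L_of_mem_periodicInterface h
  have left0 : ∀ {j}, x + g.shift ∈ m.periodicInterface i j → x 0 = 0 := fun h => by
    have := m.fst_eq_L_of_mem_periodicInterface h
    simpa using this
  have inner : ∀ {j}, j ≠ i → x ∈ m.interface i j → ¬ (x 0 = 0 ∨ x 0 = g.L) := fun hj h h' =>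
    hj (hr.eq_of_lateral h.1.1 h.1.2 h').symm
  have hLne := g.L_pos.ne'
  rcases k with k | k <;> rcases l with l | l
  · fin_cases k <;> fin_cases l <;> first
      | rfl
      | exact absurd hl.2 (disjoint_left.1 g.disjoint_Γ hk.2)
      | exact absurd hk.2 (disjoint_left.1 g.disjoint_Γ hl.2)
      | exact absurd hl.2 (disjoint_left.1 (g.disjoint_Γ_ΓD hH) hk.2)
      | exact absurd hk.2 (disjoint_left.1 (g.disjoint_Γ_ΓD hH) hl.2)
      | exact absurd hl.2 (disjoint_left.1 (g.disjoint_Γ_ΓD hH') hk.2)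
      | exact absurd hk.2 (disjoint_left.1 (g.disjoint_Γ_ΓD hH') hl.2)
  · exact absurd (m.piece_inl_subset_outer i k hk) (m.piece_inr_disjoint_outer i l hl)
  · exact absurd (m.piece_inl_subset_outer i l hl) (m.piece_inr_disjoint_outer i k hk)
  · rcases k with k | k | k <;> rcases l with l | l | l
    · have : k = l := Subtype.ext (hr.eq_of_mem_three hk.1.1 hk.1.2 hl.1.2 k.2.symm l.2.symm)
      rw [this]
    · exact absurd (Or.inr (right0 hl)) (inner k.2 hk)
    · exact absurd (Or.inl (left0 hl)) (inner k.2 hk)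
    · exact absurd (Or.inr (right0 hk)) (inner l.2 hl)
    · have : k = l := hr2.eq_of_lateral hk.1.1 hl.1.1 (Or.inl (by simp [right0 hk]))
      rw [this]
    · exact absurd ((right0 hk).symm.trans (left0 hl)) hLne
    · exact absurd (Or.inl (left0 hk)) (inner l.2 hl)
    · exact absurd ((right0 hl).symm.trans (left0 hk)) hLne
    · have : k = l := hr1.eq_of_lateral hk.1.2 hl.1.2 (Or.inr (by simp [left0 hk]))
      rw [this]

/-- The pieces cover the boundary and overlap only at irregular points or their translates, a null
set. The pieces on `Γ_left` are moved to `Γ_right` by a translation, which preserves arc length. -/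
theorem integral_frontier (i : Fin m.N) {X : Plane → ℂ}
    (hX : IntegrableOn X (frontier (m.elem i)) μH[1]) :
    ∫ x in frontier (m.elem i), X x ∂μH[1]
      = (∫ x in frontier (m.elem i) ∩ g.Γ g.H, X x ∂μH[1])
        + (∫ x in frontier (m.elem i) ∩ g.Γ (-g.H), X x ∂μH[1])
        + (∫ x in frontier (m.elem i) ∩ g.ΓD, X x ∂μH[1])
        + (∑ j : {j // j ≠ i}, ∫ x in m.interface i j, X x ∂μH[1])
        + (∑ j, ∫ x in m.periodicInterface j i, X x ∂μH[1])
        + ∑ j, ∫ x in m.periodicInterface i j, X (x - g.shift) ∂μH[1] := by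
  have hdis : Pairwise (Function.onFun (AEDisjoint (μH[1] : Measure Plane)) (m.piece i)) := by
    intro k l hkl
    refine measure_eq_zero_iff_ae_notMem.2 ?_
    filter_upwards [m.ae_isRegularPoint_shift] with x ⟨h, h1, h2⟩ hx
    exact hkl (m.piece_unique i h h1 h2 hx.1 hx.2)
  have h := integral_iUnion_ae (μ := (μH[1] : Measure Plane)) (f := X)
    (fun k => (m.measurableSet_piece i k).nullMeasurableSet) hdis (by rwa [m.iUnion_piece])
  rw [m.iUnion_piece, tsum_fintype] at h
  rw [h]
  simp only [Fintype.sum_sum_type, Fin.sum_univ_three]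
  have e : ∀ j, ∫ x in m.piece i (Sum.inr (Sum.inr (Sum.inr j))), X x ∂μH[1]
      = ∫ x in m.periodicInterface i j, X (x - g.shift) ∂μH[1] := by
    intro j
    have := (measurePreserving_add g.shift).setIntegral_preimage_emb
      (MeasurableEquiv.addRight g.shift).measurableEmbedding (fun x => X (x - g.shift))
      (m.periodicInterface i j)
    simpa [piece] using this
  simp only [e]
  simp only [piece]
  ring

end Mesh

theorem tendsto_eLpNorm_mono_set {μ : Measure Plane} {S S' : Set Plane} (h : S' ⊆ S)
    {f : ℕ → Plane → ℂ} (hf : Tendsto (fun j => eLpNorm (f j) 2 (μ.restrict S)) atTop (𝓝 0)) :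
    Tendsto (fun j => eLpNorm (f j) 2 (μ.restrict S')) atTop (𝓝 0) :=
  tendsto_of_tendsto_of_tendsto_of_le_of_le tendsto_const_nhds hf (fun _ => zero_le)
    fun _ => eLpNorm_mono_measure _ (Measure.restrict_mono_set _ h)

namespace Grating

variable (g : Grating)

/-! ### The incident field and the Dirichlet-to-Neumann operators -/

theorem smoothQP_subset : g.smoothQP ⊆ smoothFunctions := fun _ h => h.1

theorem isBounded_Ω : Bornology.IsBounded g.Ω := by
  refine (Metric.isBounded_closedBall (x := (0 : Plane)) (r := √(g.L ^ 2 + g.H ^ 2))).subset ?_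
  rintro x ⟨-, h0, h1, h2, h3⟩
  rw [mem_closedBall_zero_iff, EuclideanSpace.norm_eq]
  refine Real.sqrt_le_sqrt ?_
  rw [Fin.sum_univ_two, Real.norm_eq_abs, Real.norm_eq_abs, sq_abs, sq_abs]
  nlinarith

theorem Γ_eq_image (y : ℝ) : g.Γ y = (fun s : ℝ => (EuclideanSpace.single 1 y : Plane)
    + s • EuclideanSpace.single 0 (1 : ℝ)) '' Icc 0 g.L := by
  ext x
  constructor
  · rintro ⟨h0, h1, h2⟩
    refine ⟨x 0, ⟨h0, h1⟩, ?_⟩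
    ext i
    fin_cases i
    · simp
    · simpa using h2.symm
  · rintro ⟨s, ⟨h0, h1⟩, rfl⟩
    refine ⟨by simpa using h0, by simpa using h1, by simp⟩

theorem isometry_Γ (y : ℝ) : Isometry fun s : ℝ => (EuclideanSpace.single 1 y : Plane)
    + s • EuclideanSpace.single 0 (1 : ℝ) :=
  isometry_line _ (by simp)

theorem measure_Γ_ne_top (y : ℝ) : (μH[1] : Measure Plane) (g.Γ y) ≠ ⊤ := by
  rw [Γ_eq_image]
  exact hausdorffMeasure_isometry_image_ne_top (isometry_Γ y) (Metric.isBounded_Icc _ _)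

theorem isBounded_Γ (y : ℝ) : Bornology.IsBounded (g.Γ y) := by
  rw [Γ_eq_image]
  exact (isCompact_Icc.image (isometry_Γ y).continuous).isBounded

theorem memL2Curve_Γ (y : ℝ) {φ : Plane → ℂ} (hφ : Continuous φ) : MemL2Curve (g.Γ y) φ :=
  memLp_restrict_of_continuous hφ (g.isClosed_Γ y).measurableSet (g.isBounded_Γ y)
    (g.measure_Γ_ne_top y) 2

theorem integral_Γ (y : ℝ) (f : Plane → ℂ) : ∫ x in g.Γ y, f x ∂μH[1]
    = ∫ s in (0 : ℝ)..g.L, f ((EuclideanSpace.single 1 y : Plane)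
      + s • EuclideanSpace.single 0 (1 : ℝ)) := by
  rw [Γ_eq_image, ← map_volume_restrict_of_isometry (isometry_Γ y),
    (isometry_Γ y).isClosedEmbedding.measurableEmbedding.integral_map,
    intervalIntegral.integral_of_le g.L_pos.le, integral_Icc_eq_integral_Ioc]

theorem continuous_T (y e : ℝ) (M : ℕ) (φ : Plane → ℂ) : Continuous (g.T y e M φ) := by
  unfold T
  fun_prop

theorem contDiff_uInc : ContDiff ℝ ∞ g.uInc := by
  unfold uInc
  have h : ∀ l : Fin 2, ContDiff ℝ ∞ fun x : Plane => ((x l : ℝ) : ℂ) := fun l =>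
    Complex.ofRealCLM.contDiff.comp (coordFunctional l).contDiff
  exact (contDiff_const.mul (((h 0).mul contDiff_const).add ((h 1).mul contDiff_const))).cexp

theorem pderiv_one_uInc (x : Plane) :
    pderiv 1 g.uInc x = Complex.I * g.κp * Real.sin g.θ * g.uInc x := by
  have h : ∀ l : Fin 2, HasFDerivAt (fun x : Plane => ((x l : ℝ) : ℂ))
      (Complex.ofRealCLM.comp (coordFunctional l)) x := fun l =>
    Complex.ofRealCLM.hasFDerivAt.comp x (coordFunctional l).hasFDerivAt
  have h2 := ((((h 0).mul_const (Real.cos g.θ : ℂ)).add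
    ((h 1).mul_const (Real.sin g.θ : ℂ))).const_mul (Complex.I * g.κp)).cexp
  have h3 : HasFDerivAt g.uInc _ x := h2
  unfold pderiv
  rw [h3.fderiv]
  simp [uInc, coordFunctional_apply]
  ring

theorem εp_pos : 0 < g.εp := by
  have := g.ε_above (EuclideanSpace.single 1 (g.H + 1)) (by simp)
  rw [← this]
  exact g.ε_pos _

theorem κp_sq : g.κp ^ 2 = g.k ^ 2 * g.εp := by
  unfold κp
  rw [mul_pow, Real.sq_sqrt g.εp_pos.le]

theorem κp_pos : 0 < g.κp := mul_pos g.k_pos (Real.sqrt_pos.2 g.εp_pos)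

theorem α_zero : g.α 0 = g.κp * Real.cos g.θ := by simp [α]

/-- The mode `n = 0` is propagating and `sin θ ≤ 0` for the admissible angles, so the nonnegative
square root carries the minus sign. -/
theorem β_zero : g.β g.εp 0 = -(g.κp * Real.sin g.θ : ℝ) := by
  have hs : Real.sin g.θ ≤ 0 := Real.sin_nonpos_of_nonpos_of_neg_pi_le g.θ_mem.2 g.θ_mem.1
  have hc := Real.sin_sq_add_cos_sq g.θ
  unfold β
  rw [α_zero, ← κp_sq, if_pos]
  · have : g.κp ^ 2 - (g.κp * Real.cos g.θ) ^ 2 = (-(g.κp * Real.sin g.θ)) ^ 2 := by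
      linear_combination g.κp ^ 2 * (-hc)
    rw [this, Real.sqrt_sq]
    · push_cast; ring
    · nlinarith [g.κp_pos]
  · nlinarith [sq_nonneg (g.κp * Real.sin g.θ)]

/-- The incident wave carries the sign opposite to that of outgoing waves: its normal derivative on
`Γ_H` is minus `T_M^+ u^inc`, so the two contributions to the source reinforce each other. -/
theorem pderiv_one_uInc_eq (x : Plane) :
    pderiv 1 g.uInc x = -(Complex.I * g.β g.εp 0 * g.uInc x) := by
  rw [pderiv_one_uInc, β_zero]
  push_cast
  ring

/-- The operators `T` see a function only up to null sets, so the elementwise trace in the form and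
the global trace in the boundary value problem become interchangeable. -/
theorem fourierCoef_congr {y : ℝ} {φ ψ : Plane → ℂ} (h : φ =ᵐ[μH[1].restrict (g.Γ y)] ψ) (n : ℤ) :
    g.fourierCoef y φ n = g.fourierCoef y ψ n := by
  unfold fourierCoef
  congr 1
  refine integral_congr_ae ?_
  filter_upwards [h] with x hx
  rw [hx]

theorem T_congr {y : ℝ} {φ ψ : Plane → ℂ} (h : φ =ᵐ[μH[1].restrict (g.Γ y)] ψ) (e : ℝ) (M : ℕ) :
    g.T y e M φ = g.T y e M ψ := by
  ext x
  unfold T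
  simp only [g.fourierCoef_congr h]

theorem T_sub {y : ℝ} {φ ψ : Plane → ℂ} (hφ : MemL2Curve (g.Γ y) φ) (hψ : MemL2Curve (g.Γ y) ψ)
    (e : ℝ) (M : ℕ) (x : Plane) :
    g.T y e M (fun z => φ z - ψ z) x = g.T y e M φ x - g.T y e M ψ x := by
  have h : ∀ n, g.fourierCoef y (fun z => φ z - ψ z) n
      = g.fourierCoef y φ n - g.fourierCoef y ψ n := by
    intro n
    unfold fourierCoef
    have hc : MemL2Curve (g.Γ y) fun x => Complex.exp (-(Complex.I * g.α n * x 0)) :=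
      g.memL2Curve_Γ y (by fun_prop)
    rw [← mul_sub, ← integral_sub (integrable_mul_of_L2 hc hφ) (integrable_mul_of_L2 hc hψ)]
    simp only [mul_sub]
  unfold T
  simp only [h, sub_mul, Finset.sum_sub_distrib, mul_sub]

theorem integral_exp_two_pi {L : ℝ} (hL : 0 < L) {n : ℤ} (hn : n ≠ 0) :
    ∫ s in (0 : ℝ)..L, Complex.exp (-(Complex.I * (2 * Real.pi * n / L)) * s) = 0 := by
  have hL' : (L : ℂ) ≠ 0 := Complex.ofReal_ne_zero.2 hL.ne'
  have hn' : (n : ℂ) ≠ 0 := Int.cast_ne_zero.2 hn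
  have hc : -(Complex.I * (2 * Real.pi * n / L)) ≠ 0 := by
    have := Complex.ofReal_ne_zero.2 Real.pi_ne_zero
    simp [hL', hn', this]
  rw [integral_exp_mul_complex hc]
  have : -(Complex.I * (2 * Real.pi * n / L)) * L = ((-n : ℤ) : ℂ) * (2 * Real.pi * Complex.I) := by
    field_simp
    push_cast
    ring
  rw [this, Complex.exp_int_mul_two_pi_mul_I]
  simp

/-- On `Γ_H` the incident wave is a constant times `e^{iα_0 x₁}`, so orthogonality of the
exponentials over one period leaves only the mode `n = 0`. -/
theorem fourierCoef_uInc (n : ℤ) : g.fourierCoef g.H g.uInc n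
    = if n = 0 then Complex.exp (Complex.I * g.κp * (g.H * Real.sin g.θ)) else 0 := by
  have hL : (g.L : ℂ) ≠ 0 := Complex.ofReal_ne_zero.2 g.L_pos.ne'
  unfold fourierCoef
  rw [integral_Γ]
  have e : ∀ s : ℝ, Complex.exp (-(Complex.I * g.α n * ((EuclideanSpace.single 1 g.H
      + s • EuclideanSpace.single 0 (1 : ℝ) : Plane) 0 : ℝ)))
      * g.uInc ((EuclideanSpace.single 1 g.H : Plane) + s • EuclideanSpace.single 0 (1 : ℝ))
      = Complex.exp (Complex.I * g.κp * (g.H * Real.sin g.θ))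
        * Complex.exp (-(Complex.I * (2 * Real.pi * n / g.L)) * s) := by
    intro s
    unfold uInc
    rw [← Complex.exp_add, ← Complex.exp_add]
    congr 1
    simp [α]
    ring
  simp only [e]
  rw [intervalIntegral.integral_const_mul]
  split_ifs with hn
  · subst hn
    simp only [Int.cast_zero, mul_zero, zero_div, neg_zero, zero_mul, Complex.exp_zero,
      intervalIntegral.integral_const, sub_zero, Complex.real_smul, mul_one]
    field_simp
  · rw [integral_exp_two_pi g.L_pos hn]
    simp

/-- The incident wave is an eigenfunction of `T_M^+` on `Γ_H`. -/
theorem Tp_uInc (M : ℕ) {x : Plane} (hx : x 1 = g.H) :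
    g.Tp M g.uInc x = Complex.I * g.β g.εp 0 * g.uInc x := by
  unfold Tp T
  simp only [fourierCoef_uInc]
  rw [Finset.sum_eq_single 0]
  · rw [if_pos rfl]
    have : g.uInc x = Complex.exp (Complex.I * g.κp * (g.H * Real.sin g.θ))
        * Complex.exp (Complex.I * g.α 0 * x 0) := by
      unfold uInc
      rw [← Complex.exp_add, hx, α_zero]
      congr 1
      push_cast
      ring
    rw [this]
    ring
  · intro n _ hn
    rw [if_neg hn]
    simp
  · intro h
    exact absurd (Finset.mem_Icc.2 ⟨by simp, by simp⟩) h

theorem norm_phase : ‖g.phase‖ = 1 := by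
  unfold phase
  have : Complex.I * g.α 0 * g.L = ((g.α 0 * g.L : ℝ) : ℂ) * Complex.I := by push_cast; ring
  rw [this, Complex.norm_exp_ofReal_mul_I]

theorem phase_mul_conj : g.phase * conj g.phase = 1 := by
  rw [Complex.mul_conj, Complex.normSq_eq_norm_sq, norm_phase]
  simp

end Grating

/-! ### Traces of quasi-periodic functions on the mesh -/

namespace Mesh

variable {g : Grating} (m : Mesh g)

theorem Γ_subset {y : ℝ} (hy : |y| = g.H) : g.Γ y ⊆ ⋃ i, frontier (m.elem i) := by
  intro x hx
  have hD : x ∉ closure g.D := fun h => by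
    have := g.D_bounded x h
    rw [hx.2.2, hy] at this
    exact lt_irrefl _ this
  have hb := abs_le.1 hy.le
  have hcl := g.mem_closure_Ω hD hx.1 hx.2.1 (by rw [hx.2.2]; exact hb.1) (by rw [hx.2.2]; exact hb.2)
  refine mem_iUnion.2 (m.exists_mem_frontier hcl fun i hi => ?_)
  have h := (m.elem_subset_Ω i hi).2.2.2
  rw [hx.2.2, ← abs_lt, hy] at h
  exact lt_irrefl _ h

/-- The mesh serves as an auxiliary device: the artificial boundary is covered by boundaries of
finitely many convex elements, each with its own trace inequality. -/
theorem traceBound_Γ (m : Mesh g) {y : ℝ} (hy : |y| = g.H) : TraceBound g.Ω (g.Γ y) :=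
  (TraceBound.iUnion fun i => (m.traceBound_elem i).mono (m.elem_subset_Ω i) subset_rfl).mono
    subset_rfl (m.Γ_subset hy)

theorem hasTrace_traceΓ (m : Mesh g) {y : ℝ} (hy : |y| = g.H) {u : Plane → ℂ} (hu : u ∈ g.H1QP) :
    HasTrace g.smoothQP g.Ω (g.Γ y) u (g.traceΓ y u) := by
  obtain ⟨hu1, φ, hφ, hφu⟩ := hu
  obtain ⟨τ, hτ, hφτ⟩ := (m.traceBound_Γ hy).exists_limit hu1 (fun j => (hφ j).1)
    (fun j => g.memL2Curve_Γ y (hφ j).1.continuous) hφu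
  exact hasTrace_traceOn ⟨τ, hu1, hτ, φ, hφ, hφu, hφτ⟩

theorem traceΓ_smooth (m : Mesh g) {y : ℝ} (hy : |y| = g.H) {w : Plane → ℂ} (hw : w ∈ g.smoothQP) :
    g.traceΓ y w =ᵐ[μH[1].restrict (g.Γ y)] w := by
  have hH := memH1_of_contDiff g.isOpen_Ω g.isBounded_Ω hw.1
  have ht := tendstoH1_const g.isOpen_Ω g.isBounded_Ω hw.1
  have htr := m.hasTrace_traceΓ hy ⟨hH, fun _ => w, fun _ => hw, ht⟩
  have h := htr.tendsto g.smoothQP_subset (m.traceBound_Γ hy) (fun _ => hw.1) ht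
  exact ae_eq_of_tendsto_L2_same (fun _ => hw.1.continuous.aestronglyMeasurable) htr.2.1.1
    hw.1.continuous.aestronglyMeasurable h (by simp)

/-- The trace on the boundary of an element agrees with the trace on a part of the boundary of the
cell. -/
theorem tr_ae_eq_of_hasTrace {A : Set (Plane → ℂ)} (hA : A ⊆ smoothFunctions) {Γ : Set Plane}
    {u τ : Plane → ℂ} (h : HasTrace A g.Ω Γ u τ) (i : Fin m.N) :
    m.tr i u =ᵐ[μH[1].restrict (frontier (m.elem i) ∩ Γ)] τ := by
  obtain ⟨hu, hτ, φ, hφA, hφu, hφτ⟩ := h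
  have hφ : ∀ j, ContDiff ℝ ∞ (φ j) := fun j => hA (hφA j)
  have huK := hu.mono (m.elem_subset_Ω i)
  have h1 := m.tendsto_tr i huK hφ (hφu.mono (m.isOpen_elem i) (m.elem_subset_Ω i) hu)
  exact ae_eq_of_tendsto_L2_same (fun j => (hφ j).continuous.aestronglyMeasurable)
    ((m.memL2Curve_tr i huK).1.mono_measure (Measure.restrict_mono_set _ inter_subset_left))
    (hτ.1.mono_measure (Measure.restrict_mono_set _ inter_subset_right))
    (tendsto_eLpNorm_mono_set inter_subset_left h1)
    (tendsto_eLpNorm_mono_set inter_subset_right hφτ)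

/-- A single sequence of functions smooth across the interface converges to `u` on both elements, so
both traces are limits of the same restrictions. -/
theorem tr_ae_eq_tr {u : Plane → ℂ} (hu : u ∈ g.H1QP) (i j : Fin m.N) :
    m.tr i u =ᵐ[μH[1].restrict (m.interface i j)] m.tr j u := by
  obtain ⟨hu1, φ, hφ, hφu⟩ := hu
  have hi := m.tendsto_tr i (hu1.mono (m.elem_subset_Ω i)) (fun j => (hφ j).1)
    (hφu.mono (m.isOpen_elem i) (m.elem_subset_Ω i) hu1)
  have hj := m.tendsto_tr j (hu1.mono (m.elem_subset_Ω j)) (fun j => (hφ j).1)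
    (hφu.mono (m.isOpen_elem j) (m.elem_subset_Ω j) hu1)
  have si : m.interface i j ⊆ frontier (m.elem i) := fun x hx => hx.1.1
  have sj : m.interface i j ⊆ frontier (m.elem j) := fun x hx => hx.1.2
  exact ae_eq_of_tendsto_L2_same (fun j => (hφ j).1.continuous.aestronglyMeasurable)
    ((m.memL2Curve_tr i (hu1.mono (m.elem_subset_Ω i))).1.mono_measure
      (Measure.restrict_mono_set _ si))
    ((m.memL2Curve_tr j (hu1.mono (m.elem_subset_Ω j))).1.mono_measure
      (Measure.restrict_mono_set _ sj))
    (tendsto_eLpNorm_mono_set si hi) (tendsto_eLpNorm_mono_set sj hj)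

theorem measurePreserving_sub_shift (S : Set Plane) (hS : MeasurableSet S) :
    MeasurePreserving (fun x : Plane => x - g.shift)
      ((μH[1] : Measure Plane).restrict ((fun x : Plane => x - g.shift) ⁻¹' S))
      (μH[1].restrict S) := by
  have := (measurePreserving_add (-g.shift)).restrict_preimage hS
  simpa [sub_eq_add_neg] using this

/-- The approximating functions are exactly quasi-periodic. Since the phase has modulus one, their
`L²` convergence on `Γ_left` becomes convergence on `Γ_right` to the translated trace times the
phase. -/
theorem phase_mul_tr_ae_eq {u : Plane → ℂ} (hu : u ∈ g.H1QP) (i j : Fin m.N) :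
    (fun x => g.phase * m.tr i u (x - g.shift)) =ᵐ[μH[1].restrict (m.periodicInterface i j)]
      m.tr j u := by
  obtain ⟨hu1, φ, hφ, hφu⟩ := hu
  have hi := m.tendsto_tr i (hu1.mono (m.elem_subset_Ω i)) (fun j => (hφ j).1)
    (hφu.mono (m.isOpen_elem i) (m.elem_subset_Ω i) hu1)
  have hj := m.tendsto_tr j (hu1.mono (m.elem_subset_Ω j)) (fun j => (hφ j).1)
    (hφu.mono (m.isOpen_elem j) (m.elem_subset_Ω j) hu1)
  have htri := m.memL2Curve_tr i (hu1.mono (m.elem_subset_Ω i))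
  have mp := measurePreserving_sub_shift (g := g) (frontier (m.elem i))
    isClosed_frontier.measurableSet
  have si : m.periodicInterface i j ⊆ (fun x : Plane => x - g.shift) ⁻¹' frontier (m.elem i) :=
    fun x hx => hx.1.1
  have sj : m.periodicInterface i j ⊆ frontier (m.elem j) := fun x hx => hx.1.2
  have hi' : Tendsto (fun n => eLpNorm (fun x => φ n x - g.phase * m.tr i u (x - g.shift)) 2
      (μH[1].restrict ((fun x : Plane => x - g.shift) ⁻¹' frontier (m.elem i)))) atTop (𝓝 0) := by
    refine hi.congr fun n => ?_
    have hm : AEStronglyMeasurable (fun x => φ n x - m.tr i u x)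
        (μH[1].restrict (frontier (m.elem i))) :=
      ((hφ n).1.continuous.aestronglyMeasurable).sub htri.1
    rw [← eLpNorm_comp_measurePreserving hm mp]
    refine eLpNorm_congr_norm_ae (Eventually.of_forall fun x => ?_)
    have h := (hφ n).2.1 (x - g.shift)
    rw [sub_add_cancel] at h
    rw [h, ← mul_sub, norm_mul, g.norm_phase, one_mul]
    rfl
  exact ae_eq_of_tendsto_L2_same (fun j => (hφ j).1.continuous.aestronglyMeasurable)
    (((htri.1.comp_measurePreserving mp).const_mul _).mono_measure
      (Measure.restrict_mono_set _ si))
    ((m.memL2Curve_tr j (hu1.mono (m.elem_subset_Ω j))).1.mono_measure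
      (Measure.restrict_mono_set _ sj))
    (tendsto_eLpNorm_mono_set si hi') (tendsto_eLpNorm_mono_set sj hj)

theorem eq_or_eq_of_abs_eq {y : ℝ} (hy : |y| = g.H) {x : Plane} (hx : x ∈ g.Γ y) :
    x 1 = -g.H ∨ x 1 = g.H := by
  rw [hx.2.2, ← hy]
  rcases abs_choice y with h | h <;> rw [h] <;> simp

/-- At a regular point of `Γ y` exactly one element contributes to the sum, and its trace is the
global one. -/
theorem outerTr_ae_eq {y : ℝ} (hy : |y| = g.H) {u : Plane → ℂ} (hu : u ∈ g.H1QP) :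
    m.outerTr u =ᵐ[μH[1].restrict (g.Γ y)] g.traceΓ y u := by
  have htr := m.hasTrace_traceΓ hy hu
  have hall : ∀ᵐ x ∂(μH[1] : Measure Plane), ∀ i, x ∈ frontier (m.elem i) ∩ g.Γ y →
      m.tr i u x = g.traceΓ y u x := by
    refine ae_all_iff.2 fun i => ?_
    exact (ae_restrict_iff' (isClosed_frontier.measurableSet.inter
      (g.isClosed_Γ y).measurableSet)).1 (m.tr_ae_eq_of_hasTrace g.smoothQP_subset htr i)
  rw [EventuallyEq, ae_restrict_iff' (g.isClosed_Γ y).measurableSet]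
  filter_upwards [hall, m.ae_isRegularPoint] with x hx hreg hxΓ
  obtain ⟨i, hi⟩ := mem_iUnion.1 (m.Γ_subset hy hxΓ)
  unfold outerTr
  rw [Finset.sum_eq_single i, indicator_of_mem hi, hx i ⟨hi, hxΓ⟩]
  · intro j _ hji
    refine indicator_of_notMem (fun hj => hji ?_) _
    exact hreg.eq_of_artificial hj hi (eq_or_eq_of_abs_eq hy hxΓ)
  · intro h
    exact absurd (Finset.mem_univ i) h

end Mesh

/-! ### Folding the cell onto a cylinder -/

namespace Grating

variable (g : Grating)

/-- The map of the plane onto a cylinder that identifies points differing by multiples of the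
period. -/
noncomputable def toCylinder (x : Plane) : ℂ × ℝ :=
  -- The shift by `-π` makes the strip `0 < x₁ ≤ L` correspond to the range `(-π, π]` of
  -- `Complex.arg`.
  (Complex.exp (((2 * Real.pi * x 0 / g.L - Real.pi : ℝ) : ℂ) * Complex.I), x 1)

/-- The inverse of `toCylinder` on the strip `0 < x₁ ≤ L`. -/
noncomputable def ofCylinder (q : ℂ × ℝ) : Plane :=
  EuclideanSpace.single 0 ((q.1.arg + Real.pi) * g.L / (2 * Real.pi)) + EuclideanSpace.single 1 q.2

/-- The strip `0 < x₁ ≤ L`, a fundamental domain for the translations by multiples of the period. -/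
def strip : Set Plane := {x | 0 < x 0 ∧ x 0 ≤ g.L}

theorem measurableSet_strip : MeasurableSet g.strip :=
  (measurableSet_lt measurable_const (continuous_coord 0).measurable).inter
    (measurableSet_le (continuous_coord 0).measurable measurable_const)

theorem contDiff_toCylinder : ContDiff ℝ ∞ g.toCylinder := by
  have h : ∀ l : Fin 2, ContDiff ℝ ∞ fun x : Plane => x l := fun l =>
    (coordFunctional l).contDiff
  refine ContDiff.prodMk (ContDiff.cexp ((Complex.ofRealCLM.contDiff.comp ?_).mul contDiff_const))
    (h 1)
  exact ((contDiff_const.mul (h 0)).div_const _).sub contDiff_const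

theorem measurable_ofCylinder : Measurable g.ofCylinder := by
  have h : ∀ l : Fin 2, Continuous fun r : ℝ => (EuclideanSpace.single l r : Plane) := fun l => by
    have : (fun r : ℝ => (EuclideanSpace.single l r : Plane))
        = fun r => r • EuclideanSpace.single l (1 : ℝ) := by
      ext r i
      by_cases hi : i = l <;> simp [hi]
    rw [this]
    fun_prop
  refine Measurable.add ((h 0).measurable.comp ?_) ((h 1).measurable.comp measurable_snd)
  exact (((Complex.measurable_arg.comp measurable_fst).add_const _).mul_const _).div_const _

theorem ofCylinder_toCylinder {x : Plane} (hx : x ∈ g.strip) :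
    g.ofCylinder (g.toCylinder x) = x := by
  have hπ := Real.pi_pos
  have hL := g.L_pos
  have h1 : 0 < 2 * Real.pi * x 0 / g.L := by have := hx.1; positivity
  have h2 : 2 * Real.pi * x 0 / g.L ≤ 2 * Real.pi := by
    rw [div_le_iff₀ hL]
    have := hx.2
    gcongr
  have harg : (g.toCylinder x).1.arg = 2 * Real.pi * x 0 / g.L - Real.pi := by
    unfold toCylinder
    rw [Complex.exp_mul_I, Complex.arg_cos_add_sin_mul_I ⟨by linarith, by linarith⟩]
  unfold ofCylinder
  rw [harg]
  ext i
  fin_cases i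
  · simp
    field_simp
  · simp [toCylinder]

theorem toCylinder_add_shift (x : Plane) : g.toCylinder (x + g.shift) = g.toCylinder x := by
  unfold toCylinder
  have hL := g.L_pos.ne'
  refine Prod.ext ?_ (by simp)
  have : (((2 * Real.pi * (x + g.shift) 0 / g.L - Real.pi : ℝ) : ℂ)) * Complex.I
      = ((2 * Real.pi * x 0 / g.L - Real.pi : ℝ) : ℂ) * Complex.I + 2 * Real.pi * Complex.I := by
    simp only [PiLp.add_apply, shift_zero]
    rw [← Complex.ofReal_ofNat, ← Complex.ofReal_mul, ← add_mul, ← Complex.ofReal_add]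
    congr 2
    field_simp
    ring
  simp only [this, Complex.exp_add, Complex.exp_two_pi_mul_I, mul_one]

theorem toCylinder_eq_iff {x y : Plane} (hx : x ∈ g.strip) (hy0 : 0 ≤ y 0) (hyL : y 0 ≤ g.L)
    (h : g.toCylinder x = g.toCylinder y) : y = x ∨ y = x - g.shift := by
  rcases hy0.eq_or_lt with h0 | h0
  · right
    have hy' : y + g.shift ∈ g.strip := by
      constructor <;> simp [← h0, g.L_pos]
    have := g.ofCylinder_toCylinder hy'
    rw [g.toCylinder_add_shift, ← h, g.ofCylinder_toCylinder hx] at this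
    rw [this, add_sub_cancel_right]
  · left
    have := g.ofCylinder_toCylinder (x := y) ⟨h0, hyL⟩
    rw [← this, ← h, g.ofCylinder_toCylinder hx]

theorem isCompact_ΓD : IsCompact g.ΓD :=
  Metric.isCompact_of_isClosed_isBounded g.isClosed_ΓD
    (g.isBounded_Ω.closure.subset inter_subset_right)

/-- The quasi-periodic function on the plane induced by a function on the cylinder. -/
noncomputable def ofCylinderFun (F : ℂ × ℝ → ℝ) (x : Plane) : ℂ :=
  Complex.exp (Complex.I * g.α 0 * x 0) * F (g.toCylinder x)

theorem ofCylinderFun_mem_smoothQP {F : ℂ × ℝ → ℝ} (hF : ContDiff ℝ ∞ F)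
    (hFc : HasCompactSupport F) : g.ofCylinderFun F ∈ g.smoothQP := by
  refine ⟨?_, fun x => ?_, ?_⟩
  · have h : ContDiff ℝ ∞ fun x : Plane => ((x 0 : ℝ) : ℂ) :=
      Complex.ofRealCLM.contDiff.comp (coordFunctional 0).contDiff
    exact (contDiff_const.mul h).cexp.mul
      (Complex.ofRealCLM.contDiff.comp (hF.comp g.contDiff_toCylinder))
  · unfold ofCylinderFun phase
    rw [g.toCylinder_add_shift, ← mul_assoc, ← Complex.exp_add]
    congr 2
    simp
    ring
  · obtain ⟨R, hR⟩ := hFc.isCompact.isBounded.subset_closedBall 0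
    refine ⟨R, fun x hx => ?_⟩
    unfold ofCylinderFun
    have : F (g.toCylinder x) = 0 := by
      refine image_eq_zero_of_notMem_tsupport fun h => ?_
      have h1 := mem_closedBall_zero_iff.1 (hR h)
      have h2 : ‖(g.toCylinder x).2‖ ≤ ‖g.toCylinder x‖ := norm_snd_le _
      have h3 : ‖(g.toCylinder x).2‖ = |x 1| := rfl
      linarith
    rw [this]
    simp

/-- A density on the strip that is orthogonal to all smooth quasi-periodic functions vanishing on
`Γ_D` vanishes away from `Γ_D`. -/
theorem ae_eq_zero_of_integral_mul_smoothQP {f : Plane → ℂ} (hf : Integrable f μH[1])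
    (hsupp : ∀ x, x ∉ g.strip → f x = 0)
    (h : ∀ w ∈ g.smoothQP, (∀ x ∈ g.ΓD, w x = 0) → ∫ x, f x * conj (w x) ∂μH[1] = 0) :
    ∀ᵐ x ∂(μH[1] : Measure Plane), x ∈ g.strip → x ∉ g.ΓD → x - g.shift ∉ g.ΓD → f x = 0 := by
  set μ : Measure Plane := μH[1].restrict g.strip with hμ
  have hP : Measurable g.toCylinder := g.contDiff_toCylinder.continuous.measurable
  set ν : Measure (ℂ × ℝ) := μ.map g.toCylinder with hν
  have hQ : MeasurePreserving g.ofCylinder ν μ := by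
    refine ⟨g.measurable_ofCylinder, ?_⟩
    rw [hν, Measure.map_map g.measurable_ofCylinder hP]
    conv_rhs => rw [← Measure.map_id (μ := μ)]
    refine Measure.map_congr ?_
    filter_upwards [ae_restrict_mem g.measurableSet_strip] with x hx
    exact g.ofCylinder_toCylinder hx
  -- The conjugate phase of a quasi-periodic test function is absorbed into the density; what is
  -- left of the test function is the pullback of a real function on the cylinder.
  set e : Plane → ℂ := fun x => conj (Complex.exp (Complex.I * g.α 0 * x 0)) with he
  have hec : Continuous e := by fun_prop
  have he1 : ∀ x, ‖e x‖ = 1 := by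
    intro x
    have : Complex.I * g.α 0 * x 0 = ((g.α 0 * x 0 : ℝ) : ℂ) * Complex.I := by push_cast; ring
    simp only [he, RCLike.norm_conj]
    rw [this, Complex.norm_exp_ofReal_mul_I]
  set k : Plane → ℂ := fun x => f x * e x with hk
  have hki : Integrable k μ := by
    refine (hf.restrict (s := g.strip)).mul_bdd hec.aestronglyMeasurable
      (Eventually.of_forall fun x => (he1 x).le)
  have hkQ : Integrable (k ∘ g.ofCylinder) ν := hQ.integrable_comp_of_integrable hki
  -- The image of the compact set `Γ_D` is closed, so test functions supported in `U` pull back to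
  -- functions vanishing on `Γ_D`.
  set U : Set (ℂ × ℝ) := (g.toCylinder '' g.ΓD)ᶜ with hU
  have hUo : IsOpen U :=
    (g.isCompact_ΓD.image g.contDiff_toCylinder.continuous).isClosed.isOpen_compl
  -- The measure `ν` is not locally finite, since it comes from arc length on a two-dimensional
  -- strip; the fundamental lemma needs only the integrability of the density.
  have key := hUo.ae_eq_zero_of_integral_contDiff_smul_eq_zero
    (hkQ.locallyIntegrable.locallyIntegrableOn U) fun F hF hFc hFs => by
    have hw := g.ofCylinderFun_mem_smoothQP hF hFc
    have hw0 : ∀ x ∈ g.ΓD, g.ofCylinderFun F x = 0 := by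
      intro x hx
      unfold ofCylinderFun
      have : F (g.toCylinder x) = 0 := by
        refine image_eq_zero_of_notMem_tsupport fun h => ?_
        exact hFs h (mem_image_of_mem _ hx)
      rw [this]
      simp
    have h1 := h _ hw hw0
    have hsm : AEStronglyMeasurable (fun z => F z • (k ∘ g.ofCylinder) z) ν :=
      hF.continuous.aestronglyMeasurable.smul hkQ.1
    rw [hν, integral_map hP.aemeasurable hsm, hμ, ← h1,
      ← integral_indicator g.measurableSet_strip]
    refine integral_congr_ae (Eventually.of_forall fun x => ?_)
    by_cases hx : x ∈ g.strip
    · simp only [indicator_of_mem hx, Function.comp_apply, g.ofCylinder_toCylinder hx, hk, he,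
        ofCylinderFun, map_mul, Complex.conj_ofReal, Complex.real_smul]
      ring
    · simp only [indicator_of_notMem hx, hsupp x hx, zero_mul]
  have key2 := ae_of_ae_map hP.aemeasurable key
  rw [hμ, ae_restrict_iff' g.measurableSet_strip] at key2
  filter_upwards [key2] with x hx hxs hxD hxD'
  have hPU : g.toCylinder x ∈ U := by
    rintro ⟨y, hy, hyx⟩
    obtain ⟨b1, b2, -, -⟩ := g.bounds_of_mem_closure_Ω hy.2
    rcases g.toCylinder_eq_iff hxs b1 b2 hyx.symm with h | h
    · exact hxD (h ▸ hy)
    · exact hxD' (h ▸ hy)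
  have := hx hxs hPU
  rw [Function.comp_apply, g.ofCylinder_toCylinder hxs] at this
  refine (mul_eq_zero.1 this).resolve_right fun h0 => ?_
  have := he1 x
  rw [h0, norm_zero] at this
  exact zero_ne_one this

end Grating

/-! ### Normal derivatives of the solution -/

namespace Mesh

variable {g : Grating} (m : Mesh g)

theorem κ_sq (i : Fin m.N) {x : Plane} (hx : x ∈ m.elem i) : g.k ^ 2 * g.ε x = m.κ i ^ 2 := by
  have h := m.ε_const i x hx
  unfold κ
  rw [mul_pow, Real.sq_sqrt (by rw [← h]; exact (g.ε_pos x).le), ← h]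

/-- What the open elements miss of the cell lies on their boundaries, and boundaries of convex sets
have zero area. -/
theorem Ω_ae_eq : g.Ω =ᵐ[(volume : Measure Plane)] ⋃ i, m.elem i := by
  have h1 : ∀ᵐ x ∂(volume : Measure Plane), ∀ i, x ∉ frontier (m.elem i) :=
    ae_all_iff.2 fun i => measure_eq_zero_iff_ae_notMem.1 ((m.convex_elem i).addHaar_frontier _)
  filter_upwards [h1] with x hx
  refine propext ⟨fun h => ?_, fun h => ?_⟩
  · by_contra hcon
    obtain ⟨i, hi⟩ := m.exists_mem_frontier (subset_closure h) fun i hi =>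
      hcon (mem_iUnion.2 ⟨i, hi⟩)
    exact hx i hi
  · obtain ⟨i, hi⟩ := mem_iUnion.1 h
    exact m.elem_subset_Ω i hi

theorem mem_H1QP0_of_smooth {w : Plane → ℂ} (hw : w ∈ g.smoothQP) (h0 : ∀ x ∈ g.ΓD, w x = 0) :
    w ∈ g.H1QP0 := by
  have hH := memH1_of_contDiff g.isOpen_Ω g.isBounded_Ω hw.1
  have ht := tendstoH1_const g.isOpen_Ω g.isBounded_Ω hw.1
  refine ⟨⟨hH, fun _ => w, fun _ => hw, ht⟩, hH, MemLp.zero, fun _ => w, fun _ => hw, ht, ?_⟩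
  have : eLpNorm (fun x => w x - (0 : Plane → ℂ) x) 2 (μH[1].restrict g.ΓD) = 0 := by
    rw [← eLpNorm_zero (p := 2) (μ := μH[1].restrict g.ΓD) (ε := ℂ)]
    refine eLpNorm_congr_ae ?_
    filter_upwards [ae_restrict_mem g.isClosed_ΓD.measurableSet] with x hx
    simp [h0 x hx]
  simp only [this]
  exact tendsto_const_nhds

/-- The Neumann data of the truncated problem on `Γ_H`. -/
noncomputable def topData (g : Grating) (M : ℕ) (u : Plane → ℂ) (x : Plane) : ℂ :=
  pderiv 1 g.uInc x + g.Tp M (fun z => g.traceΓ g.H u z - g.uInc z) x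

/-- The Neumann data of the truncated problem on `Γ_{-H}`. -/
noncomputable def bottomData (g : Grating) (M : ℕ) (u : Plane → ℂ) : Plane → ℂ :=
  g.Tm M (g.traceΓ (-g.H) u)

theorem continuous_topData (M : ℕ) (u : Plane → ℂ) : Continuous (topData g M u) :=
  (contDiff_pderiv g.contDiff_uInc 1).continuous.add (g.continuous_T _ _ _ _)

theorem continuous_bottomData (M : ℕ) (u : Plane → ℂ) : Continuous (bottomData g M u) :=
  g.continuous_T _ _ _ _

/-- The volume term of the weak problem splits over the elements, where Green's formula converts it
into boundary integrals. All information on how the normal derivatives of `u` match is contained in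
this identity. -/
theorem sum_integral_dn {M : ℕ} {u : Plane → ℂ} (hu : g.IsTruncatedSolution M u)
    (huT : u ∈ m.trefftz) {w : Plane → ℂ} (hw : w ∈ g.smoothQP) (h0 : ∀ x ∈ g.ΓD, w x = 0) :
    ∑ i, ∫ x in frontier (m.elem i), m.dn i u x * conj (w x) ∂μH[1]
      = (∫ x in g.Γ g.H, topData g M u x * conj (w x) ∂μH[1])
        + ∫ x in g.Γ (-g.H), bottomData g M u x * conj (w x) ∂μH[1] := by
  have h := hu.neumann w (mem_H1QP0_of_smooth hw h0)
  have hH : |g.H| = g.H := abs_of_pos g.H_pos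
  have hH' : |-g.H| = g.H := by rw [abs_neg, hH]
  have e1 : ∫ x in g.Γ g.H, (pderiv 1 g.uInc x + g.Tp M (fun z => g.traceΓ g.H u z - g.uInc z) x)
        * conj (g.traceΓ g.H w x) ∂μH[1]
      = ∫ x in g.Γ g.H, topData g M u x * conj (w x) ∂μH[1] := by
    refine integral_congr_ae ?_
    filter_upwards [m.traceΓ_smooth hH hw] with x hx
    rw [hx]
    rfl
  have e2 : ∫ x in g.Γ (-g.H), g.Tm M (g.traceΓ (-g.H) u) x * conj (g.traceΓ (-g.H) w x) ∂μH[1]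
      = ∫ x in g.Γ (-g.H), bottomData g M u x * conj (w x) ∂μH[1] := by
    refine integral_congr_ae ?_
    filter_upwards [m.traceΓ_smooth hH' hw] with x hx
    rw [hx]
    rfl
  rw [e1, e2] at h
  rw [← h]
  have huH := hu.mem.1
  have hae : ∀ i, (fun x => (∑ l, weakGrad g.Ω u l x * conj (weakGrad g.Ω w l x))
        - ((g.k ^ 2 * g.ε x : ℝ) : ℂ) * u x * conj (w x)) =ᵐ[volume.restrict (m.elem i)]
      fun x => (∑ l, weakGrad (m.elem i) u l x * conj (pderiv l w x))
        - ((m.κ i ^ 2 : ℝ) : ℂ) * u x * conj (w x) := by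
    intro i
    have a : ∀ᵐ x ∂(volume.restrict (m.elem i)), ∀ l,
        weakGrad (m.elem i) u l x = weakGrad g.Ω u l x := ae_all_iff.2 fun l =>
      weakGrad_ae_eq_of_subset (m.isOpen_elem i) (m.elem_subset_Ω i) huH l
    have b : ∀ᵐ x ∂(volume.restrict (m.elem i)), ∀ l, weakGrad g.Ω w l x = pderiv l w x :=
      ae_all_iff.2 fun l => ae_restrict_of_ae_restrict_of_subset (m.elem_subset_Ω i)
        (weakGrad_ae_eq_pderiv g.isOpen_Ω g.isBounded_Ω hw.1 l)
    filter_upwards [a, b, ae_restrict_mem (m.isOpen_elem i).measurableSet] with x ha hb hx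
    rw [m.κ_sq i hx]
    simp only [ha, hb]
  have hint : ∀ i, IntegrableOn (fun x => (∑ l, weakGrad g.Ω u l x * conj (weakGrad g.Ω w l x))
        - ((g.k ^ 2 * g.ε x : ℝ) : ℂ) * u x * conj (w x)) (m.elem i) := by
    intro i
    refine Integrable.congr ?_ (hae i).symm
    have hL := memL2_of_contDiff (m.isOpen_elem i) (m.isBounded_elem i) hw.1
    have hL' := fun l => memL2_of_contDiff (m.isOpen_elem i) (m.isBounded_elem i)
      (contDiff_pderiv hw.1 l)
    have huK := m.memH1_of_mem_trefftz huT i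
    exact (integrable_finsetSum _ fun l _ => (m.integrable_green huK hL l (hL' l)).1).sub
      (m.integrable_green huK hL 0 (hL' 0)).2
  rw [setIntegral_congr_set m.Ω_ae_eq, integral_iUnion
    (fun i => (m.isOpen_elem i).measurableSet) (fun i j hij => m.disjoint_elem hij)
    (integrableOn_finite_iUnion.2 hint), tsum_fintype]
  refine Finset.sum_congr rfl fun i _ => ?_
  rw [integral_congr_ae (hae i), m.green_smooth huT i hw.1]

/-! ### The Neumann defect on the folded cell -/

/-- The part of the boundary of the `i`-th element in the strip `0 < x₁ ≤ L`. -/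
def rightPart (i : Fin m.N) : Set Plane := frontier (m.elem i) ∩ {x | 0 < x 0}

/-- The translate of the part of the boundary of the `i`-th element on `Γ_left`. -/
def leftPart (i : Fin m.N) : Set Plane :=
  (fun x : Plane => x - g.shift) ⁻¹' (frontier (m.elem i) ∩ {x | x 0 = 0})

/-- The density, on the cell folded along its lateral sides, of the functional
`w ↦ ∑ ∫_{∂K} ∂_{n_K}u w̄` minus the Neumann data. -/
noncomputable def neumannDefect (M : ℕ) (u : Plane → ℂ) (x : Plane) : ℂ :=
  (∑ i, (m.rightPart i).indicator (m.dn i u) x)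
    + (∑ i, (m.leftPart i).indicator (fun y => g.phase * m.dn i u (y - g.shift)) x)
    - (g.Γ g.H ∩ {y | 0 < y 0}).indicator (topData g M u) x
    - (g.Γ (-g.H) ∩ {y | 0 < y 0}).indicator (bottomData g M u) x

theorem measurableSet_pos : MeasurableSet {x : Plane | 0 < x 0} :=
  measurableSet_lt measurable_const (continuous_coord 0).measurable

theorem measurableSet_fst_eq_zero : MeasurableSet {x : Plane | x 0 = 0} :=
  measurableSet_eq_fun (continuous_coord 0).measurable measurable_const

theorem measurableSet_rightPart (i : Fin m.N) : MeasurableSet (m.rightPart i) :=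
  isClosed_frontier.measurableSet.inter measurableSet_pos

theorem measurableSet_leftPart (i : Fin m.N) : MeasurableSet (m.leftPart i) :=
  (isClosed_frontier.measurableSet.inter measurableSet_fst_eq_zero).preimage
    (by fun_prop : Measurable fun x : Plane => x - g.shift)

theorem measurableSet_Γ_pos (y : ℝ) : MeasurableSet (g.Γ y ∩ {x | 0 < x 0}) :=
  (g.isClosed_Γ y).measurableSet.inter measurableSet_pos

theorem integrable_dn_mul {u : Plane → ℂ} (hu : u ∈ m.trefftz) (i : Fin m.N) {w : Plane → ℂ}
    (hw : Continuous w) :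
    IntegrableOn (fun x => m.dn i u x * conj (w x)) (frontier (m.elem i)) μH[1] :=
  integrable_mul_of_L2 (m.memL2Curve_dn hu i) (memLp_conj (m.memL2Curve_frontier i hw))

theorem integrable_Γ (y : ℝ) {f : Plane → ℂ} (hf : Continuous f) :
    IntegrableOn f (g.Γ y) μH[1] := by
  have : IsFiniteMeasure ((μH[1] : Measure Plane).restrict (g.Γ y)) :=
    ⟨by simpa using (g.measure_Γ_ne_top y).lt_top⟩
  exact (g.memL2Curve_Γ y hf).integrable one_le_two

theorem integrableOn_dn {u : Plane → ℂ} (hu : u ∈ m.trefftz) (i : Fin m.N) :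
    IntegrableOn (m.dn i u) (frontier (m.elem i)) μH[1] := by
  have := m.integrable_dn_mul hu i (w := fun _ => 1) continuous_const
  simpa using this

theorem measurePreserving_leftPart (i : Fin m.N) : MeasurePreserving (fun x : Plane => x - g.shift)
    ((μH[1] : Measure Plane).restrict (m.leftPart i))
    (μH[1].restrict (frontier (m.elem i) ∩ {x | x 0 = 0})) :=
  measurePreserving_sub_shift _ (isClosed_frontier.measurableSet.inter measurableSet_fst_eq_zero)

theorem integrable_neumannDefect {M : ℕ} {u : Plane → ℂ} (huT : u ∈ m.trefftz) :
    Integrable (m.neumannDefect M u) μH[1] := by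
  refine (((integrable_finsetSum _ fun i _ => ?_).add (integrable_finsetSum _ fun i _ => ?_)).sub
    ?_).sub ?_
  · rw [integrable_indicator_iff (m.measurableSet_rightPart i)]
    exact (m.integrableOn_dn huT i).mono_set inter_subset_left
  · rw [integrable_indicator_iff (m.measurableSet_leftPart i)]
    have h : IntegrableOn (m.dn i u) (frontier (m.elem i) ∩ {x | x 0 = 0}) μH[1] :=
      (m.integrableOn_dn huT i).mono_set inter_subset_left
    exact ((m.measurePreserving_leftPart i).integrable_comp_of_integrable h).const_mul _
  · rw [integrable_indicator_iff (measurableSet_Γ_pos _)]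
    exact (integrable_Γ _ (continuous_topData M u)).mono_set inter_subset_left
  · rw [integrable_indicator_iff (measurableSet_Γ_pos _)]
    exact (integrable_Γ _ (continuous_bottomData M u)).mono_set inter_subset_left

/-- The part on `Γ_left` is translated to `Γ_right`. Conjugating the quasi-periodicity of `w`
introduces the conjugate phase, which the phase multiplying the normal derivative cancels. -/
theorem integral_frontier_eq_right_add_left {u : Plane → ℂ} (huT : u ∈ m.trefftz) (i : Fin m.N)
    {w : Plane → ℂ} (hw : w ∈ g.smoothQP) :
    ∫ x in frontier (m.elem i), m.dn i u x * conj (w x) ∂μH[1]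
      = (∫ x in m.rightPart i, m.dn i u x * conj (w x) ∂μH[1])
        + ∫ x in m.leftPart i, g.phase * m.dn i u (x - g.shift) * conj (w x) ∂μH[1] := by
  have hint := m.integrable_dn_mul huT i hw.1.continuous
  rw [← integral_inter_add_sdiff measurableSet_pos hint]
  congr 1
  have hset : frontier (m.elem i) \ {x : Plane | 0 < x 0}
      = frontier (m.elem i) ∩ {x : Plane | x 0 = 0} := by
    ext x
    refine and_congr_right fun hx => ?_
    have := (g.bounds_of_mem_closure_Ω (m.frontier_subset_closure_Ω i hx)).1
    exact ⟨fun h => le_antisymm (not_lt.1 h) this, fun h => not_lt.2 (le_of_eq h)⟩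
  rw [hset]
  have hm := (m.measurePreserving_leftPart i).integral_comp
    (MeasurableEquiv.subRight g.shift).measurableEmbedding (fun x => m.dn i u x * conj (w x))
  rw [← hm]
  refine integral_congr_ae (Eventually.of_forall fun x => ?_)
  have h := hw.2.1 (x - g.shift)
  rw [sub_add_cancel] at h
  simp only
  rw [h, map_mul]
  linear_combination (-(m.dn i u (x - g.shift) * conj (w (x - g.shift)))) * g.phase_mul_conj

/-- Passing to the half-open strip removes only the left endpoint, which has zero length. -/
theorem integral_Γ_pos (y : ℝ) {f : Plane → ℂ} :
    ∫ x in g.Γ y, f x ∂μH[1] = ∫ x in g.Γ y ∩ {x | 0 < x 0}, f x ∂μH[1] := by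
  have := Measure.nullSingletonClass_hausdorff Plane one_pos
  refine setIntegral_congr_set ?_
  have hne : ∀ᵐ x ∂(μH[1] : Measure Plane), x ≠ EuclideanSpace.single 1 y :=
    measure_eq_zero_iff_ae_notMem.1 (measure_singleton (EuclideanSpace.single 1 y : Plane))
  filter_upwards [hne] with x hx
  refine propext ⟨fun h => ⟨h, lt_of_le_of_ne h.1 fun h0 => hx ?_⟩, fun h => h.1⟩
  ext i
  fin_cases i
  · simpa using h0.symm
  · simpa using h.2.2

/-- This is `sum_integral_dn` after every boundary integral has been moved into the strip. -/
theorem integral_neumannDefect {M : ℕ} {u : Plane → ℂ} (hu : g.IsTruncatedSolution M u)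
    (huT : u ∈ m.trefftz) {w : Plane → ℂ} (hw : w ∈ g.smoothQP) (h0 : ∀ x ∈ g.ΓD, w x = 0) :
    ∫ x, m.neumannDefect M u x * conj (w x) ∂μH[1] = 0 := by
  have hwc := hw.1.continuous
  have ind : ∀ (S : Set Plane) (f : Plane → ℂ) (x : Plane), S.indicator f x * conj (w x)
      = S.indicator (fun y => f y * conj (w y)) x := by
    intro S f x
    by_cases hx : x ∈ S <;> simp [hx]
  have i1 : ∀ i, Integrable ((m.rightPart i).indicator fun y => m.dn i u y * conj (w y)) μH[1] := by
    intro i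
    rw [integrable_indicator_iff (m.measurableSet_rightPart i)]
    exact (m.integrable_dn_mul huT i hwc).mono_set inter_subset_left
  have i2 : ∀ i, Integrable ((m.leftPart i).indicator
      fun y => g.phase * m.dn i u (y - g.shift) * conj (w y)) μH[1] := by
    intro i
    rw [integrable_indicator_iff (m.measurableSet_leftPart i)]
    have h : IntegrableOn (fun y => m.dn i u y * conj (w y))
        (frontier (m.elem i) ∩ {x | x 0 = 0}) μH[1] :=
      (m.integrable_dn_mul huT i hwc).mono_set inter_subset_left
    refine ((m.measurePreserving_leftPart i).integrable_comp_of_integrable h).congr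
      (Eventually.of_forall fun x => ?_)
    have h := hw.2.1 (x - g.shift)
    rw [sub_add_cancel] at h
    simp only [Function.comp_apply]
    rw [h, map_mul]
    linear_combination (-(m.dn i u (x - g.shift) * conj (w (x - g.shift)))) * g.phase_mul_conj
  have i3 : ∀ y, ∀ f : Plane → ℂ, Continuous f →
      Integrable ((g.Γ y ∩ {x | 0 < x 0}).indicator fun y => f y * conj (w y)) μH[1] := by
    intro y f hf
    rw [integrable_indicator_iff (measurableSet_Γ_pos _)]
    exact (integrable_Γ y (hf.mul (Complex.continuous_conj.comp hwc))).mono_set inter_subset_left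
  have ht := i3 g.H (topData g M u) (continuous_topData M u)
  have hb := i3 (-g.H) (bottomData g M u) (continuous_bottomData M u)
  simp only [neumannDefect, sub_mul, add_mul, Finset.sum_mul, ind]
  have s1 := integrable_finsetSum Finset.univ fun i _ => i1 i
  have s2 := integrable_finsetSum Finset.univ fun i _ => i2 i
  have a1 := integral_sub ((s1.add s2).sub ht) hb
  have a2 := integral_sub (s1.add s2) ht
  simp only [Pi.add_apply, Pi.sub_apply] at a1 a2
  rw [a1, a2, integral_add s1 s2, integral_finsetSum _ fun i _ => i1 i,
    integral_finsetSum _ fun i _ => i2 i,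
    integral_indicator (measurableSet_Γ_pos _), integral_indicator (measurableSet_Γ_pos _),
    ← integral_Γ_pos, ← integral_Γ_pos, ← Finset.sum_add_distrib]
  have := m.sum_integral_dn hu huT hw h0
  simp only [m.integral_frontier_eq_right_add_left huT _ hw] at this
  simp only [integral_indicator (m.measurableSet_rightPart _),
    integral_indicator (m.measurableSet_leftPart _)]
  rw [this]
  ring

theorem neumannDefect_eq_zero_of_notMem_strip {M : ℕ} {u : Plane → ℂ} {x : Plane}
    (hx : x ∉ g.strip) : m.neumannDefect M u x = 0 := by
  have h1 : ∀ i, x ∉ m.rightPart i := fun i h =>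
    hx ⟨h.2, (g.bounds_of_mem_closure_Ω (m.frontier_subset_closure_Ω i h.1)).2.1⟩
  have h2 : ∀ i, x ∉ m.leftPart i := fun i h => by
    have h0 : (x - g.shift) 0 = 0 := h.2
    simp only [PiLp.sub_apply, Grating.shift_zero] at h0
    exact hx ⟨by linarith [g.L_pos], by linarith⟩
  have h3 : ∀ y, x ∉ g.Γ y ∩ {y | 0 < y 0} := fun y h => hx ⟨h.2, h.1.2.1⟩
  unfold neumannDefect
  simp only [indicator_of_notMem (h1 _), indicator_of_notMem (h2 _), indicator_of_notMem (h3 _),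
    Finset.sum_const_zero]
  ring

theorem ae_neumannDefect_eq_zero {M : ℕ} {u : Plane → ℂ} (hu : g.IsTruncatedSolution M u)
    (huT : u ∈ m.trefftz) : ∀ᵐ x ∂(μH[1] : Measure Plane),
      x ∈ g.strip → x ∉ g.ΓD → x - g.shift ∉ g.ΓD → m.neumannDefect M u x = 0 :=
  g.ae_eq_zero_of_integral_mul_smoothQP (m.integrable_neumannDefect huT)
    (fun _ hx => m.neumannDefect_eq_zero_of_notMem_strip hx)
    fun _ hw h0 => m.integral_neumannDefect hu huT hw h0

theorem sub_shift_notMem_ΓD {x : Plane} (hx : x 0 < g.L) : x - g.shift ∉ g.ΓD := fun h => by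
  have := (g.bounds_of_mem_closure_Ω h.2).1
  simp only [PiLp.sub_apply, Grating.shift_zero] at this
  linarith

/-- The normal derivatives of the solution from the two sides of an interface are opposite. -/
theorem dn_add_dn_ae_eq_zero {M : ℕ} {u : Plane → ℂ} (hu : g.IsTruncatedSolution M u)
    (huT : u ∈ m.trefftz) {i j : Fin m.N} (hij : i ≠ j) :
    ∀ᵐ x ∂(μH[1].restrict (m.interface i j)), m.dn i u x + m.dn j u x = 0 := by
  rw [ae_restrict_iff' (m.measurableSet_interface i j)]
  filter_upwards [m.ae_neumannDefect_eq_zero hu huT, m.ae_isRegularPoint] with x hdef hreg hx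
  obtain ⟨b1, b2, -, -⟩ := g.bounds_of_mem_closure_Ω (m.frontier_subset_closure_Ω i hx.1.1)
  -- A regular point common to two distinct elements cannot be lateral, so no translated terms and
  -- no artificial data enter the defect, and only the elements `i` and `j` contribute.
  have n1 : x 0 ≠ 0 := fun h => hij (hreg.eq_of_lateral hx.1.1 hx.1.2 (Or.inl h))
  have n2 : x 0 ≠ g.L := fun h => hij (hreg.eq_of_lateral hx.1.1 hx.1.2 (Or.inr h))
  have p1 : 0 < x 0 := lt_of_le_of_ne b1 n1.symm
  have h := hdef ⟨p1, b2⟩ (fun h => hx.2 (Or.inl (Or.inl h)))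
    (sub_shift_notMem_ΓD (lt_of_le_of_ne b2 n2))
  have h2 : ∀ k, x ∉ m.leftPart k := fun k hk => by
    have h0 : (x - g.shift) 0 = 0 := hk.2
    simp only [PiLp.sub_apply, Grating.shift_zero] at h0
    exact n2 (by linarith)
  have h3 : x ∉ g.Γ g.H ∩ {y | 0 < y 0} := fun h => hx.2 (Or.inl (Or.inr h.1))
  have h4 : x ∉ g.Γ (-g.H) ∩ {y | 0 < y 0} := fun h => hx.2 (Or.inr h.1)
  unfold neumannDefect at h
  simp only [indicator_of_notMem (h2 _), indicator_of_notMem h3, indicator_of_notMem h4,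
    Finset.sum_const_zero, add_zero, sub_zero] at h
  rw [← h, ← Finset.sum_subset (Finset.subset_univ {i, j}), Finset.sum_pair hij,
    indicator_of_mem (show x ∈ m.rightPart i from ⟨hx.1.1, p1⟩),
    indicator_of_mem (show x ∈ m.rightPart j from ⟨hx.1.2, p1⟩)]
  intro k _ hk
  simp only [Finset.mem_insert, Finset.mem_singleton, not_or] at hk
  refine indicator_of_notMem (fun hxk => ?_) _
  exact hk.2 (hreg.eq_of_mem_three hx.1.1 hxk.1 hx.1.2 (Ne.symm hk.1) hij)

/-- The normal derivatives of the solution on the two lateral sides match. -/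
theorem phase_mul_dn_add_dn_ae_eq_zero {M : ℕ} {u : Plane → ℂ} (hu : g.IsTruncatedSolution M u)
    (huT : u ∈ m.trefftz) (i j : Fin m.N) :
    ∀ᵐ x ∂(μH[1].restrict (m.periodicInterface i j)),
      g.phase * m.dn i u (x - g.shift) + m.dn j u x = 0 := by
  rw [ae_restrict_iff' (m.measurableSet_periodicInterface i j)]
  filter_upwards [m.ae_neumannDefect_eq_zero hu huT, m.ae_isRegularPoint_shift] with x hdef hregs hx
  obtain ⟨hreg, -, hreg'⟩ := hregs
  have hL := m.fst_eq_L_of_mem_periodicInterface hx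
  have p1 : 0 < x 0 := hL ▸ g.L_pos
  have q0 : (x - g.shift) 0 = 0 := by simp [hL]
  have hcl := m.frontier_subset_closure_Ω j hx.1.2
  have hD : x - g.shift ∉ closure g.D := by
    rw [← g.add_shift_mem_closure_D, sub_add_cancel]
    exact g.notMem_closure_D hcl fun h => hx.2 (Or.inl (Or.inl h))
  have h := hdef ⟨p1, hL.le⟩ (fun h => hx.2 (Or.inl (Or.inl h)))
    fun h => hD (frontier_subset_closure h.1)
  have h3 : x ∉ g.Γ g.H ∩ {y | 0 < y 0} := fun h => hx.2 (Or.inl (Or.inr h.1))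
  have h4 : x ∉ g.Γ (-g.H) ∩ {y | 0 < y 0} := fun h => hx.2 (Or.inr h.1)
  unfold neumannDefect at h
  simp only [indicator_of_notMem h3, indicator_of_notMem h4, sub_zero] at h
  -- Regularity at `x` and at its translate leaves one element on each lateral side, hence one term
  -- in each sum.
  rw [Finset.sum_eq_single j, Finset.sum_eq_single i,
    indicator_of_mem (show x ∈ m.rightPart j from ⟨hx.1.2, p1⟩),
    indicator_of_mem (show x ∈ m.leftPart i from ⟨hx.1.1, q0⟩), add_comm] at h
  · exact h
  · intro k _ hk
    refine indicator_of_notMem (fun hxk => hk ?_) _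
    exact hreg'.eq_of_lateral hxk.1 hx.1.1 (Or.inl q0)
  · intro h
    exact absurd (Finset.mem_univ i) h
  · intro k _ hk
    refine indicator_of_notMem (fun hxk => hk ?_) _
    exact hreg.eq_of_lateral hxk.1 hx.1.2 (Or.inr hL)
  · intro h
    exact absurd (Finset.mem_univ j) h

/-- Away from the two endpoints of the segment, the defect contains one normal derivative and the
Neumann data. Both data terms are kept so that one statement serves `y = H` and `y = -H`; the
condition `0 < x 0` is recorded in order to evaluate the indicators later. -/
theorem ae_dn_eq_of_Γ {M : ℕ} {u : Plane → ℂ} (hu : g.IsTruncatedSolution M u)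
    (huT : u ∈ m.trefftz) {y : ℝ} (hy : |y| = g.H) (i : Fin m.N) :
    ∀ᵐ x ∂(μH[1].restrict (frontier (m.elem i) ∩ g.Γ y)),
      m.dn i u x = (g.Γ g.H ∩ {y | 0 < y 0}).indicator (topData g M u) x
        + (g.Γ (-g.H) ∩ {y | 0 < y 0}).indicator (bottomData g M u) x ∧ 0 < x 0 := by
  have := Measure.nullSingletonClass_hausdorff Plane one_pos
  have hne : ∀ s : ℝ, ∀ᵐ x ∂(μH[1] : Measure Plane), x ≠ EuclideanSpace.single 0 s
      + EuclideanSpace.single 1 y := fun s =>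
    measure_eq_zero_iff_ae_notMem.1
      (measure_singleton (EuclideanSpace.single 0 s + EuclideanSpace.single 1 y : Plane))
  rw [ae_restrict_iff' (isClosed_frontier.measurableSet.inter (g.isClosed_Γ y).measurableSet)]
  filter_upwards [m.ae_neumannDefect_eq_zero hu huT, m.ae_isRegularPoint, hne 0, hne g.L] with x hdef
    hreg e0 eL hx
  have ext2 : ∀ s, x 0 = s → x = EuclideanSpace.single 0 s + EuclideanSpace.single 1 y := by
    intro s hs
    ext l
    fin_cases l
    · simpa using hs
    · simpa using hx.2.2.2
  have n1 : x 0 ≠ 0 := fun h => e0 (ext2 _ h)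
  have n2 : x 0 ≠ g.L := fun h => eL (ext2 _ h)
  have p1 : 0 < x 0 := lt_of_le_of_ne hx.2.1 n1.symm
  have hD : x ∉ g.ΓD := disjoint_left.1 (g.disjoint_Γ_ΓD hy) hx.2
  have h := hdef ⟨p1, hx.2.2.1⟩ hD (sub_shift_notMem_ΓD (lt_of_le_of_ne hx.2.2.1 n2))
  have h2 : ∀ k, x ∉ m.leftPart k := fun k hk => by
    have h0 : (x - g.shift) 0 = 0 := hk.2
    simp only [PiLp.sub_apply, Grating.shift_zero] at h0
    exact n2 (by linarith)
  unfold neumannDefect at h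
  simp only [indicator_of_notMem (h2 _), Finset.sum_const_zero, add_zero] at h
  rw [Finset.sum_eq_single i, indicator_of_mem (show x ∈ m.rightPart i from ⟨hx.1, p1⟩)] at h
  · exact ⟨by linear_combination h, p1⟩
  · intro k _ hk
    refine indicator_of_notMem (fun hxk => hk ?_) _
    exact hreg.eq_of_artificial hxk.1 hx.1 (eq_or_eq_of_abs_eq hy hx.2)
  · intro h
    exact absurd (Finset.mem_univ i) h

theorem dn_ae_eq_topData {M : ℕ} {u : Plane → ℂ} (hu : g.IsTruncatedSolution M u)
    (huT : u ∈ m.trefftz) (i : Fin m.N) :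
    ∀ᵐ x ∂(μH[1].restrict (frontier (m.elem i) ∩ g.Γ g.H)), m.dn i u x = topData g M u x := by
  filter_upwards [m.ae_dn_eq_of_Γ hu huT (abs_of_pos g.H_pos) i, ae_restrict_mem
    (isClosed_frontier.measurableSet.inter (g.isClosed_Γ _).measurableSet)] with x ⟨h, h0⟩ hx
  have hn : x ∉ g.Γ (-g.H) ∩ {y | 0 < y 0} := fun h' =>
    disjoint_left.1 g.disjoint_Γ hx.2 h'.1
  rw [h, indicator_of_mem (show x ∈ g.Γ g.H ∩ {y | 0 < y 0} from ⟨hx.2, h0⟩),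
    indicator_of_notMem hn, add_zero]

theorem dn_ae_eq_bottomData {M : ℕ} {u : Plane → ℂ} (hu : g.IsTruncatedSolution M u)
    (huT : u ∈ m.trefftz) (i : Fin m.N) :
    ∀ᵐ x ∂(μH[1].restrict (frontier (m.elem i) ∩ g.Γ (-g.H))),
      m.dn i u x = bottomData g M u x := by
  filter_upwards [m.ae_dn_eq_of_Γ hu huT (y := -g.H) (by rw [abs_neg, abs_of_pos g.H_pos]) i,
    ae_restrict_mem (isClosed_frontier.measurableSet.inter (g.isClosed_Γ _).measurableSet)]
    with x ⟨h, h0⟩ hx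
  have hn : x ∉ g.Γ g.H ∩ {y | 0 < y 0} := fun h' =>
    disjoint_left.1 g.disjoint_Γ h'.1 hx.2
  rw [h, indicator_of_mem (show x ∈ g.Γ (-g.H) ∩ {y | 0 < y 0} from ⟨hx.2, h0⟩),
    indicator_of_notMem hn, zero_add]

end Mesh

/-! ### Consistency -/

/-- With no jump in `u` or in its normal flux, the penalty terms vanish whatever `a`, `b` and `ξ`
are, and the averages equal the one-sided values. -/
theorem faceIntegrand_eq (ξ a b : ℝ) {u₁ u₂ d₁ d₂ : ℂ} (hu : u₁ = u₂) (hd : d₁ + d₂ = 0)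
    (v₁ v₂ e₁ e₂ : ℂ) :
    faceIntegrand ξ a b u₁ u₂ d₁ d₂ v₁ v₂ e₁ e₂
      = (u₁ * conj e₁ - d₁ * conj v₁) + (u₂ * conj e₂ - d₂ * conj v₂) := by
  obtain rfl := hu
  obtain rfl : d₂ = -d₁ := by linear_combination hd
  simp only [faceIntegrand, map_add, map_sub]
  ring

namespace Mesh

variable {g : Grating} (m : Mesh g)

theorem interface_comm (i j : Fin m.N) : m.interface i j = m.interface j i := by
  simp only [interface, inter_comm]

theorem integral_faceIntegrand_interface (c : Flux m) {M : ℕ} {u v : Plane → ℂ}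
    (hu : g.IsTruncatedSolution M u) (huT : u ∈ m.trefftz) (hvT : v ∈ m.trefftz) {i j : Fin m.N}
    (hij : i ≠ j) :
    ∫ x in m.interface i j, faceIntegrand (m.ξ i j) (c.a x) (c.b x)
        (m.tr i u x) (m.tr j u x) (m.dn i u x) (m.dn j u x)
        (m.tr i v x) (m.tr j v x) (m.dn i v x) (m.dn j v x) ∂μH[1]
      = (∫ x in m.interface i j, m.wronskian i u v x ∂μH[1])
        + ∫ x in m.interface i j, m.wronskian j u v x ∂μH[1] := by
  have hi := (m.integrableOn_wronskian huT hvT i).mono_set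
    (show m.interface i j ⊆ frontier (m.elem i) from fun x hx => hx.1.1)
  have hj := (m.integrableOn_wronskian huT hvT j).mono_set
    (show m.interface i j ⊆ frontier (m.elem j) from fun x hx => hx.1.2)
  rw [← integral_add hi hj]
  refine integral_congr_ae ?_
  filter_upwards [m.tr_ae_eq_tr hu.mem i j, m.dn_add_dn_ae_eq_zero hu huT hij] with x h1 h2
  exact faceIntegrand_eq _ _ _ h1 h2 _ _ _ _

theorem integral_faceIntegrand_periodicInterface (c : Flux m) {M : ℕ} {u v : Plane → ℂ}
    (hu : g.IsTruncatedSolution M u) (huT : u ∈ m.trefftz) (hvT : v ∈ m.trefftz) (i j : Fin m.N) :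
    ∫ x in m.periodicInterface i j, faceIntegrand (m.ξ i j) (c.a x) (c.b x)
        (g.phase * m.tr i u (x - g.shift)) (m.tr j u x)
        (g.phase * m.dn i u (x - g.shift)) (m.dn j u x)
        (g.phase * m.tr i v (x - g.shift)) (m.tr j v x)
        (g.phase * m.dn i v (x - g.shift)) (m.dn j v x) ∂μH[1]
      = (∫ x in m.periodicInterface i j, m.wronskian i u v (x - g.shift) ∂μH[1])
        + ∫ x in m.periodicInterface i j, m.wronskian j u v x ∂μH[1] := by
  have hi : IntegrableOn (fun x => m.wronskian i u v (x - g.shift)) (m.periodicInterface i j)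
      μH[1] :=
    IntegrableOn.mono_set ((measurePreserving_sub_shift (g := g) (frontier (m.elem i))
      isClosed_frontier.measurableSet).integrable_comp_of_integrable
      (m.integrableOn_wronskian huT hvT i)) fun x hx => hx.1.1
  have hj := (m.integrableOn_wronskian huT hvT j).mono_set
    (show m.periodicInterface i j ⊆ frontier (m.elem j) from fun x hx => hx.1.2)
  rw [← integral_add hi hj]
  refine integral_congr_ae ?_
  filter_upwards [m.phase_mul_tr_ae_eq hu.mem i j, m.phase_mul_dn_add_dn_ae_eq_zero hu huT i j]
    with x h1 h2
  rw [faceIntegrand_eq _ _ _ h1 h2]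
  simp only [wronskian, map_mul]
  -- Multiplying both arguments by the phase does not change the sesquilinear integrand, because the
  -- phase times its conjugate is one.
  linear_combination (m.tr i u (x - g.shift) * conj (m.dn i v (x - g.shift))
    - m.dn i u (x - g.shift) * conj (m.tr i v (x - g.shift))) * g.phase_mul_conj

/-- Each face counts once in the form but contributes one integrand to each adjacent element, so the
sum over faces is regrouped as a sum over elements. -/
theorem innerForm_eq (c : Flux m) {M : ℕ} {u v : Plane → ℂ}
    (hu : g.IsTruncatedSolution M u) (huT : u ∈ m.trefftz) (hvT : v ∈ m.trefftz) :
    m.innerForm c u v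
      = ∑ i, ((∑ j : {j // j ≠ i}, ∫ x in m.interface i j, m.wronskian i u v x ∂μH[1])
        + (∑ j, ∫ x in m.periodicInterface j i, m.wronskian i u v x ∂μH[1])
        + ∑ j, ∫ x in m.periodicInterface i j, m.wronskian i u v (x - g.shift) ∂μH[1]) := by
  unfold innerForm
  simp only [m.integral_faceIntegrand_periodicInterface c hu huT hvT, Finset.sum_add_distrib]
  have h1 : ∀ i, ∑ j ∈ Finset.univ.filter (fun j => i < j), ∫ x in m.interface i j,
      faceIntegrand (m.ξ i j) (c.a x) (c.b x)
        (m.tr i u x) (m.tr j u x) (m.dn i u x) (m.dn j u x)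
        (m.tr i v x) (m.tr j v x) (m.dn i v x) (m.dn j v x) ∂μH[1]
      = ∑ j ∈ Finset.univ.filter (fun j => i < j),
        ((∫ x in m.interface i j, m.wronskian i u v x ∂μH[1])
          + ∫ x in m.interface j i, m.wronskian j u v x ∂μH[1]) := by
    intro i
    refine Finset.sum_congr rfl fun j hj => ?_
    rw [m.integral_faceIntegrand_interface c hu huT hvT (Finset.mem_filter.1 hj).2.ne,
      m.interface_comm j i]
  -- Both orders of an unordered pair are collected, which gives the sum over all ordered pairs of
  -- distinct indices.
  have h2 : ∀ f : Fin m.N → Fin m.N → ℂ,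
      ∑ i, ∑ j ∈ Finset.univ.filter (fun j => i < j), (f i j + f j i)
        = ∑ i, ∑ j : {j // j ≠ i}, f i j := by
    intro f
    have e : ∀ i, ∑ j : {j // j ≠ i}, f i j
        = ∑ j, ((if i < j then f i j else 0) + if j < i then f i j else 0) := by
      intro i
      rw [← Finset.sum_subtype (Finset.univ.filter fun j => j ≠ i) (by simp) fun j => f i j,
        Finset.sum_filter]
      refine Finset.sum_congr rfl fun j _ => ?_
      rcases lt_trichotomy i j with h | h | h
      · simp [h, h.ne', h.le]
      · simp [h]
      · simp [h, h.ne, h.le]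
    simp only [e, Finset.sum_filter, Finset.sum_add_distrib]
    rw [Finset.sum_comm (f := fun i j => if j < i then f i j else 0)]
  simp only [h1]
  rw [h2 fun i j => ∫ x in m.interface i j, m.wronskian i u v x ∂μH[1],
    Finset.sum_comm (f := fun i j => ∫ x in m.periodicInterface i j, m.wronskian j u v x ∂μH[1])]
  ring

theorem dirichletForm_eq (c : Flux m) {M : ℕ} {u v : Plane → ℂ}
    (hu : g.IsTruncatedSolution M u) :
    m.dirichletForm c u v = ∑ i, ∫ x in frontier (m.elem i) ∩ g.ΓD, m.wronskian i u v x ∂μH[1] := by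
  refine Finset.sum_congr rfl fun i _ => integral_congr_ae ?_
  filter_upwards [m.tr_ae_eq_of_hasTrace g.smoothQP_subset hu.dirichlet i] with x hx
  simp only [wronskian, hx, Pi.zero_apply]
  ring

/-- The relation `∂u = T_M^- u` removes the term with `d` and turns `-T_M^- u v̄` into `-∂u v̄`. -/
theorem artificialForm_bottom_eq (c : Flux m) {M : ℕ} {u v : Plane → ℂ}
    (hu : g.IsTruncatedSolution M u) (huT : u ∈ m.trefftz) :
    m.artificialForm c (-g.H) (g.Tm M) u v
      = ∑ i, ∫ x in frontier (m.elem i) ∩ g.Γ (-g.H), m.wronskian i u v x ∂μH[1] := by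
  have hT : g.Tm M (m.outerTr u) = bottomData g M u :=
    g.T_congr (m.outerTr_ae_eq (by rw [abs_neg, abs_of_pos g.H_pos]) hu.mem) _ _
  refine Finset.sum_congr rfl fun i _ => integral_congr_ae ?_
  filter_upwards [m.dn_ae_eq_bottomData hu huT i] with x hx
  simp only [wronskian, hT, hx]
  ring

/-- By linearity of `T_M^+`, the residual is `∂u^inc - T_M^+ u^inc`, and each of the two terms
equals `-iβ₀ u^inc`. -/
theorem topData_eq {M : ℕ} {u : Plane → ℂ} (hu : u ∈ g.H1QP) {x : Plane} (hx : x 1 = g.H) :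
    topData g M u x = g.Tp M (m.outerTr u) x + -2 * Complex.I * g.β g.εp 0 * g.uInc x := by
  have hH := abs_of_pos g.H_pos
  have h1 : g.Tp M (m.outerTr u) = g.Tp M (g.traceΓ g.H u) :=
    g.T_congr (m.outerTr_ae_eq hH hu) _ _
  have h2 : g.Tp M (fun z => g.traceΓ g.H u z - g.uInc z) x
      = g.Tp M (g.traceΓ g.H u) x - g.Tp M g.uInc x :=
    g.T_sub (m.hasTrace_traceΓ hH hu).2.1 (g.memL2Curve_Γ _ g.contDiff_uInc.continuous) _ _ _
  rw [topData, h1, h2, g.Tp_uInc M hx, g.pderiv_one_uInc_eq]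
  ring

/-- Needed to split the integral on `Γ_H`: the coefficient `d` is bounded, and the remaining factors
are products of two `L²` functions. -/
theorem integrableOn_functional (c : Flux m) (M : ℕ) {v : Plane → ℂ} (hvT : v ∈ m.trefftz)
    (i : Fin m.N) :
    IntegrableOn (fun x => -2 * Complex.I * g.β g.εp 0 * g.uInc x
      * (conj (m.tr i v x) - c.d x * Complex.I * (m.κ i : ℂ)⁻¹
          * conj (m.dn i v x - g.Tp M (m.outerTr v) x))) (frontier (m.elem i) ∩ g.Γ g.H) μH[1] := by
  set S := frontier (m.elem i) ∩ g.Γ g.H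
  have hS1 : (μH[1] : Measure Plane).restrict S ≤ μH[1].restrict (frontier (m.elem i)) :=
    Measure.restrict_mono_set _ inter_subset_left
  have hS2 : (μH[1] : Measure Plane).restrict S ≤ μH[1].restrict (g.Γ g.H) :=
    Measure.restrict_mono_set _ inter_subset_right
  have htr : MemLp (fun x => conj (m.tr i v x)) 2 (μH[1].restrict S) :=
    memLp_conj ((m.memL2Curve_tr i (m.memH1_of_mem_trefftz hvT i)).mono_measure hS1)
  have hdn : MemLp (fun x => conj (m.dn i v x - g.Tp M (m.outerTr v) x)) 2 (μH[1].restrict S) :=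
    memLp_conj (((m.memL2Curve_dn hvT i).mono_measure hS1).sub
      ((g.memL2Curve_Γ g.H (g.continuous_T g.H g.εp M (m.outerTr v))).mono_measure hS2))
  have hd : MemLp (fun x => (c.d x : ℂ)) ⊤ (μH[1].restrict S) :=
    (c.d_bdd.ofReal (K := ℂ)).mono_measure (Measure.restrict_mono_set _
      (inter_subset_right.trans subset_union_left))
  have hdd : MemLp (fun x => (c.d x : ℂ) * conj (m.dn i v x - g.Tp M (m.outerTr v) x)) 2
      (μH[1].restrict S) := hdn.mul hd
  have hinc : MemLp g.uInc 2 (μH[1].restrict S) :=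
    (g.memL2Curve_Γ g.H g.contDiff_uInc.continuous).mono_measure hS2
  have h := integrable_mul_of_L2 (hinc.const_mul (-2 * Complex.I * g.β g.εp 0))
    (htr.sub (hdd.const_mul (Complex.I * (m.κ i : ℂ)⁻¹)))
  refine h.congr (Eventually.of_forall fun x => ?_)
  simp only [Pi.sub_apply]
  ring

/-- Substituting `T_M^+ u = ∂u + 2iβ₀ u^inc` leaves Green's integrand plus the source tested against
`v̄` and against the term with `d`, that is, the integrand of the functional. -/
theorem artificialForm_top_eq (c : Flux m) {M : ℕ} {u v : Plane → ℂ}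
    (hu : g.IsTruncatedSolution M u) (huT : u ∈ m.trefftz) (hvT : v ∈ m.trefftz) :
    m.artificialForm c g.H (g.Tp M) u v
      = m.functional c M v
        + ∑ i, ∫ x in frontier (m.elem i) ∩ g.Γ g.H, m.wronskian i u v x ∂μH[1] := by
  unfold artificialForm functional
  rw [← Finset.sum_add_distrib]
  refine Finset.sum_congr rfl fun i _ => ?_
  rw [← integral_add (m.integrableOn_functional c M hvT i)
    ((m.integrableOn_wronskian huT hvT i).mono_set inter_subset_left)]
  refine integral_congr_ae ?_
  filter_upwards [m.dn_ae_eq_topData hu huT i, ae_restrict_mem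
    (isClosed_frontier.measurableSet.inter (g.isClosed_Γ _).measurableSet)] with x hx hmem
  rw [m.topData_eq hu.mem hmem.2.2.2] at hx
  simp only [wronskian, hx]
  ring

theorem form_eq_functional (c : Flux m) {M : ℕ} {u v : Plane → ℂ}
    (hu : g.IsTruncatedSolution M u) (huT : u ∈ m.trefftz) (hvT : v ∈ m.trefftz) :
    m.form c M u v = m.functional c M v := by
  have h : ∑ i, ∫ x in frontier (m.elem i), m.wronskian i u v x ∂μH[1] = 0 :=
    Finset.sum_eq_zero fun i _ => m.integral_wronskian huT hvT i
  simp only [fun i => m.integral_frontier i (m.integrableOn_wronskian huT hvT i),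
    Finset.sum_add_distrib] at h
  rw [form, m.innerForm_eq c hu huT hvT, m.artificialForm_top_eq c hu huT hvT,
    m.artificialForm_bottom_eq c hu huT, m.dirichletForm_eq c hu]
  simp only [Finset.sum_add_distrib]
  linear_combination h

end Mesh

end DtNTDG

theorem proposition4p1 (g : DtNTDG.Grating) (m : DtNTDG.Mesh g) (c : DtNTDG.Flux m)
    (V : DtNTDG.DiscreteTrefftz m) (M : ℕ) (u : DtNTDG.Plane → ℂ)
    (hu : g.IsTruncatedSolution M u) (huT : u ∈ m.trefftz) :
    ∀ v ∈ V.space, m.form c M u v = m.functional c M v :=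
  fun _ hv => m.form_eq_functional c hu huT (V.mem_trefftz hv)
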